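/- **Setting.** Mesh the cylinder $\Omega_0\times(-1,1)$, $\Omega_0$ the unit disk, by the products of radial cells $\{\rho_i<r<\rho_{i+1}\}$, $0=\rho_0<\dots<\rho_{n_r}=1$ (a disk for $i=0$, annuli otherwise), with axial cells $(z_k,z_{k+1})$, $-1=z_0<\dots<z_{n_z}=1$. Let $N_h=n_rn_z$ and let $h$ be the minimum of all the radial thicknesses $\rho_{i+1}-\rho_i$ and axial lengths $z_{k+1}-z_k$. Let $Q$ be the continuous hierarchical basis on $(-1,1)$ of degree at most $N_p$: the piecewise linear hat functions at the interior nodes and, on each axial cell mapped affinely to $[-1,1]$, the bubbles $(1-s^2)P^{(1,1)}_n(s)$, $n+2\le N_p$. Let $M^Q,A^Q$ be its mass and stiffness matrices in $L^2(-1,1)$. Let $P_n^{(a,b)}$ be the orthonormal polynomials for the weight $(1-x)^a(1+x)^b$ on $(-1,1)$ and $Q_n^{t,(a,b,c)}$ those for $x^a(1-x)^b(t-x)^c$ on $(0,1)$. Let $Y_{m,1}=r^m\cos m\theta$ and $Y_{m,0}=r^m\sin m\theta$. For $n=m+2k$, $k\ge0$, put $Z^{(a)}_{n,m,j}=Y_{m,j}P^{(a,m)}_k(2r^2-1)$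 and, for $0<\rho<1$, $Z^{\rho,(a,b)}_{n,m,j}=Y_{m,j}\,Q_k^{t,(a,b,m)}\big(\tfrac{1-r^2}{1-\rho^2}\big)$ with $t=(1-\rho^2)^{-1}$. The basis $\Phi_{m,j}$ of the Fourier mode $(m,j)$ ($0\le m\le N_p$, $j\in\{0,1\}$, $(m,j)\ne(0,0)$) on the mesh of the disk consists of the following functions, written in the variable $(x,y)$ divided by the outer radius of the cell. * Bubbles, for $n=m,m+2,\dots$ with $n+2\le N_p$: $(1-r^2)Z^{(1)}_{n,m,j}$ on the disk cell, and $(1-r^2)(r^2-\rho^2)Z^{\rho,(1,1)}_{n,m,j}$ on an annular cell with ratio $\rho$ of inner to outer radius. * One hat function per interior radius $\rho_{i+1}$: on the outer of the two adjacent cells it is $(1-r^2)Z^{\rho,(1,0)}_{m,m,j}$; on the inner one it is the multiple of $Z^{(0)}_{m,m,j}$ (disk) or of $(r^2-\rho^2)Z^{\rho,(0,1)}_{m,m,j}$ (annulus) that makes it continuous. Each function is extended by zero. Let $\lambda=\lambda(r)\in L^\infty(\Omega_0)$ with $\lambda\ge0$ a.e. Let $M^\Phi_{m,j}$ be the $L^2(\Omega_0)$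 mass matrix of $\Phi_{m,j}$, and let $K^\Phi_{m,j}$ be its stiffness matrix plus its $\lambda$-weighted mass matrix. A reverse Cholesky factor of $A$ is a lower triangular matrix $L$ with positive diagonal and $L^\top L=A$; the hat functions are ordered first, then the bubbles by increasing degree. **Proposition (Spectrum).** Fix $\kappa\ge1$ and $\theta>0$. There are constants $0<c\le C<\infty$, depending only on $\kappa$ and $\theta$, such that the following holds for every mesh that is quasi-uniform, i.e. has all radial thicknesses and axial lengths at most $\kappa h$, and satisfies $N_h\ge\theta h^{-2}$, for every $\lambda$ as above, every $N_p\ge1$ and every mode $(m,j)$. The reverse Cholesky factorizations $L^\top L=A^Q$ and $V^\top V=K^\Phi_{m,j}$ exist, and $$\sigma(L^{-\top}M^QL^{-1})\subseteq\Big[\frac{\theta}{12N_hN_p^4},\frac4{\pi^2}\Big],\qquad \sigma(V^{-\top}M^\Phi_{m,j}V^{-1})\subseteq\big[c\,(N_hN_p^4+\|\lambda\|_{L^\infty})^{-1},\,C\big].$$ In particular, the first lower bound is $1/(12N_hN_p^4)$ if $N_h\ge h^{-2}$. Moreover, let $[\mu_a,\mu_b]$ and $[\mu_c,\mu_d]$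 be nonempty intervals with $$\sigma(L^{-\top}M^QL^{-1})\subseteq[\mu_a,\mu_b]\subseteq\Big[\frac{\theta}{12N_hN_p^4},\frac4{\pi^2}\Big],$$ $$\sigma(-V^{-\top}M^\Phi_{m,j}V^{-1})\subseteq[\mu_c,\mu_d]\subseteq\big[-C,\,-c\,(N_hN_p^4+\|\lambda\|_{L^\infty})^{-1}\big].$$ For an ADI tolerance $\epsilon>0$ let $$\ell_{\max}=\Big\lceil\frac{\log(16\gamma)\log(4/\epsilon)}{\pi^2}\Big\rceil,\qquad \gamma=\frac{|\mu_c-\mu_a||\mu_d-\mu_b|}{|\mu_c-\mu_b||\mu_d-\mu_a|},$$ be the index of the final ADI iterate. Then $\ell_{\max}=\mathcal O(\log(N_h^{1/4}N_p)\log\epsilon^{-1})$: for all $x_0>1$ and $0<\epsilon_0<1$ there is a constant $D$, depending only on $\kappa,\theta,x_0,\epsilon_0$, such that $$\ell_{\max}\le D\log(N_h^{1/4}N_p)\log\epsilon^{-1}\quad\text{whenever } N_h^{1/4}N_p\ge x_0 \text{ and } 0<\epsilon\le\epsilon_0.$$ -/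

import Mathlib

open scoped Polynomial
open MeasureTheory Matrix

noncomputable section

namespace DiskFEM

/-! ### Orthonormal polynomials -/

/-- The inner product `∫_a^b p q w dx` of two polynomials for the weight `w` on `(a, b)`. -/
def polyInner (w : ℝ → ℝ) (a b : ℝ) (p q : ℝ[X]) : ℝ :=
  ∫ x in a..b, p.eval x * q.eval x * w x

/-- The monic orthogonal polynomials for the weight `w` on `(a, b)`, by Gram-Schmidt applied to
`1, X, X ^ 2, …`. -/
def monicOrtho (w : ℝ → ℝ) (a b : ℝ) (n : ℕ) : ℝ[X] :=
  Polynomial.X ^ n - ∑ k : Fin n,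
    Polynomial.C (polyInner w a b (Polynomial.X ^ n) (monicOrtho w a b k) /
      polyInner w a b (monicOrtho w a b k) (monicOrtho w a b k)) * monicOrtho w a b k
termination_by n
decreasing_by all_goals exact k.2

/-- The orthonormal polynomial of degree `n` (with positive leading coefficient) for the weight `w`
on `(a, b)`. -/
def orthonormalPoly (w : ℝ → ℝ) (a b : ℝ) (n : ℕ) : ℝ[X] :=
  Polynomial.C (Real.sqrt (polyInner w a b (monicOrtho w a b n) (monicOrtho w a b n)))⁻¹ *
    monicOrtho w a b n

/-- The orthonormal Jacobi polynomial `P_n^{(a,b)}`, weight `(1 - x) ^ a * (1 + x) ^ b` on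
`(-1, 1)`. -/
def jacobi (a b n : ℕ) : ℝ[X] :=
  orthonormalPoly (fun x => (1 - x) ^ a * (1 + x) ^ b) (-1) 1 n

/-- The orthonormal semiclassical Jacobi polynomial `Q_n^{t,(a,b,c)}`, weight
`x ^ a * (1 - x) ^ b * (t - x) ^ c` on `(0, 1)`. -/
def semiJacobi (t : ℝ) (a b c n : ℕ) : ℝ[X] :=
  orthonormalPoly (fun x => x ^ a * (1 - x) ^ b * (t - x) ^ c) 0 1 n

/-! ### Zernike and Zernike annular polynomials

The plane `ℝ²` is modelled by `ℂ` (Euclidean norm, Lebesgue measure, real inner product), a point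
`(x, y)` being `x + i y`. -/

/-- The harmonic polynomial `Y_{m,j}`: `r ^ m cos (m θ)` if `j = 1`, `r ^ m sin (m θ)` if `j = 0`;
these are the real and imaginary parts of `(x + i y) ^ m`. -/
def harmonicY (m : ℕ) (j : Fin 2) (z : ℂ) : ℝ :=
  if j = 1 then (z ^ m).re else (z ^ m).im

theorem harmonicY_one (m : ℕ) (z : ℂ) :
    harmonicY m 1 z = ‖z‖ ^ m * Real.cos (m * z.arg) := by
  conv_lhs => rw [← Complex.norm_mul_exp_arg_mul_I z]
  simp only [harmonicY, if_true, mul_pow, ← Complex.exp_nat_mul, ← Complex.ofReal_pow,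
    Complex.re_ofReal_mul]
  rw [show (m : ℂ) * ((z.arg : ℂ) * Complex.I) = ((m * z.arg : ℝ) : ℂ) * Complex.I by
    push_cast; ring, Complex.exp_ofReal_mul_I_re]

theorem harmonicY_zero (m : ℕ) (z : ℂ) :
    harmonicY m 0 z = ‖z‖ ^ m * Real.sin (m * z.arg) := by
  conv_lhs => rw [← Complex.norm_mul_exp_arg_mul_I z]
  simp only [harmonicY, zero_ne_one, if_false, mul_pow, ← Complex.exp_nat_mul,
    ← Complex.ofReal_pow, Complex.im_ofReal_mul]
  rw [show (m : ℂ) * ((z.arg : ℂ) * Complex.I) = ((m * z.arg : ℝ) : ℂ) * Complex.I by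
    push_cast; ring, Complex.exp_ofReal_mul_I_im]

/-- The generalized Zernike polynomial `Z^{(a)}_{n,m,j}` of degree `n = m + 2 k` on the unit
disk. -/
def zernike (a k m : ℕ) (j : Fin 2) (z : ℂ) : ℝ :=
  harmonicY m j z * (jacobi a m k).eval (2 * ‖z‖ ^ 2 - 1)

/-- The generalized Zernike annular polynomial `Z^{ρ,(a,b)}_{n,m,j}`, `n = m + 2 k`, on the annulus
of inner radius `ρ` and outer radius one. -/
def zernikeAnnular (ρ : ℝ) (a b k m : ℕ) (j : Fin 2) (z : ℂ) : ℝ :=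
  harmonicY m j z *
    (semiJacobi (1 - ρ ^ 2)⁻¹ a b m k).eval ((1 - ‖z‖ ^ 2) / (1 - ρ ^ 2))

/-! ### Bubble and hat functions

The cell with radii `ρ₁ < ρ₂` is the disk of radius `ρ₂` if `ρ₁ = 0`, an annulus otherwise. -/

/-- The bubble function `B^K_{n,m,j}`, `n = m + 2 k`, of the cell `K` with radii `ρ₁ < ρ₂`,
extended by zero. -/
def bubble (ρ₁ ρ₂ : ℝ) (k m : ℕ) (j : Fin 2) (z : ℂ) : ℝ :=
  if ρ₁ ≤ ‖z‖ ∧ ‖z‖ ≤ ρ₂ then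
    if ρ₁ = 0 then
      (1 - (‖z‖ / ρ₂) ^ 2) * zernike 1 k m j (z / ρ₂)
    else
      (1 - (‖z‖ / ρ₂) ^ 2) * ((‖z‖ / ρ₂) ^ 2 - (ρ₁ / ρ₂) ^ 2) *
        zernikeAnnular (ρ₁ / ρ₂) 1 1 k m j (z / ρ₂)
  else 0

/-- The constant value of the polynomial `Q_0^{t,(a,b,m)}` attached to the annulus with radii
`ρ₁ < ρ₂`. -/
def annulusConst (ρ₁ ρ₂ : ℝ) (a b m : ℕ) : ℝ :=
  (semiJacobi (1 - (ρ₁ / ρ₂) ^ 2)⁻¹ a b m 0).eval 0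

/-- The coefficient that makes a hat function continuous at the radius `ρ₂`; since the polynomials
`P_0` and `Q_0` are orthonormal, and not equal to one, their values enter. -/
def hatCoeff (ρ₁ ρ₂ ρ₃ : ℝ) (m : ℕ) : ℝ :=
  if ρ₁ = 0 then
    (1 - (ρ₂ / ρ₃) ^ 2) * (ρ₂ / ρ₃) ^ m *
      (annulusConst ρ₂ ρ₃ 1 0 m / (jacobi 0 m 0).eval 0)
  else
    (1 - (ρ₂ / ρ₃) ^ 2) * (ρ₂ / ρ₃) ^ m * (1 - (ρ₁ / ρ₂) ^ 2)⁻¹ *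
      (annulusConst ρ₂ ρ₃ 1 0 m / annulusConst ρ₁ ρ₂ 0 1 m)

/-- The hat function `H^{K,K'}_{m,j}` of the adjacent cells `K`, with radii `ρ₁ < ρ₂`, and `K'`,
with radii `ρ₂ < ρ₃`, extended by zero: disk-annulus if `ρ₁ = 0`, annulus-annulus otherwise. -/
def hat (ρ₁ ρ₂ ρ₃ : ℝ) (m : ℕ) (j : Fin 2) (z : ℂ) : ℝ :=
  if ρ₁ ≤ ‖z‖ ∧ ‖z‖ ≤ ρ₂ then
    if ρ₁ = 0 then
      hatCoeff ρ₁ ρ₂ ρ₃ m * zernike 0 0 m j (z / ρ₂)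
    else
      hatCoeff ρ₁ ρ₂ ρ₃ m * (((‖z‖ / ρ₂) ^ 2 - (ρ₁ / ρ₂) ^ 2) *
        zernikeAnnular (ρ₁ / ρ₂) 0 1 0 m j (z / ρ₂))
  else if ρ₂ < ‖z‖ ∧ ‖z‖ ≤ ρ₃ then
    (1 - (‖z‖ / ρ₃) ^ 2) * zernikeAnnular (ρ₂ / ρ₃) 1 0 0 m j (z / ρ₃)
  else 0

/-! ### Univariate basis on the interval -/

/-- The piecewise linear hat function with nodes `a < b < c`. -/
def lineHat (a b c x : ℝ) : ℝ :=
  if a ≤ x ∧ x ≤ b then (x - a) / (b - a)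
  else if b < x ∧ x ≤ c then (c - x) / (c - b)
  else 0

/-- The weighted Jacobi polynomial `(1 - s ^ 2) P_n^{(1,1)}(s)` (of degree `n + 2`), mapped
affinely from `[-1, 1]` to the cell `[a, b]` and extended by zero. -/
def lineBubble (a b : ℝ) (n : ℕ) (x : ℝ) : ℝ :=
  if a ≤ x ∧ x ≤ b then
    (1 - ((2 * x - a - b) / (b - a)) ^ 2) * (jacobi 1 1 n).eval ((2 * x - a - b) / (b - a))
  else 0

/-! ### Meshes of the cylinder -/

/-- A mesh of the cylinder (unit disk) × (-1, 1): the product of the concentric radial cells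
`ρ i < r < ρ (i + 1)`, `i < nr` (a disk for `i = 0`), with the axial cells `ζ k < z < ζ (k + 1)`,
`k < nz`. -/
structure CylinderMesh where
  nr : ℕ
  nz : ℕ
  ρ : ℕ → ℝ
  ζ : ℕ → ℝ
  ρ_zero : ρ 0 = 0
  ρ_last : ρ nr = 1
  ρ_lt : ∀ i < nr, ρ i < ρ (i + 1)
  ζ_zero : ζ 0 = -1
  ζ_last : ζ nz = 1
  ζ_lt : ∀ k < nz, ζ k < ζ (k + 1)

namespace CylinderMesh

variable (T : CylinderMesh)

/-- The number `N_h` of three-dimensional cells. -/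
def numCells : ℕ := T.nr * T.nz

/-- The smallest cell size `h`, the size being the radial thickness (the radius, for a disk) or the
axial length, whichever is less. -/
def size : ℝ :=
  min (⨅ i : Fin T.nr, (T.ρ (i + 1) - T.ρ i)) (⨅ k : Fin T.nz, (T.ζ (k + 1) - T.ζ k))

/-- Quasi-uniformity with constant `κ`: no radial thickness or axial length exceeds `κ h`. -/
def QuasiUniform (κ : ℝ) : Prop :=
  (∀ i < T.nr, T.ρ (i + 1) - T.ρ i ≤ κ * T.size) ∧
    ∀ k < T.nz, T.ζ (k + 1) - T.ζ k ≤ κ * T.size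

/-- Indices of the truncated basis of the disk in the Fourier mode `m`: first the hat functions at
the interior radii, then, by increasing degree, the bubble functions `B_{m + 2 k, m, j}` with
`m + 2 k + 2 ≤ p`, one per cell. -/
abbrev DiskIndex (p m : ℕ) : Type :=
  Fin (T.nr - 1) ⊕ₗ (Fin ((p - m) / 2) ×ₗ Fin T.nr)

/-- The truncated hierarchical basis of the disk, restricted to the Fourier mode `(m, j)`; it
vanishes on the unit circle. -/
def diskBasis (p m : ℕ) (j : Fin 2) (s : T.DiskIndex p m) : ℂ → ℝ :=
  match ofLex s with
  | Sum.inl i => hat (T.ρ i) (T.ρ (i + 1)) (T.ρ (i + 2)) m j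
  | Sum.inr q => bubble (T.ρ (ofLex q).2) (T.ρ ((ofLex q).2 + 1)) (ofLex q).1 m j

/-- Indices of the truncated basis of the interval: first the hat functions at the interior nodes,
then, by increasing degree, the bubble functions of degree `n + 2 ≤ p`, one per cell. -/
abbrev LineIndex (p : ℕ) : Type :=
  Fin (T.nz - 1) ⊕ₗ (Fin (p - 1) ×ₗ Fin T.nz)

/-- The truncated hierarchical basis of the interval; it vanishes at `-1` and `1`. -/
def lineBasis (p : ℕ) (s : T.LineIndex p) : ℝ → ℝ :=
  match ofLex s with
  | Sum.inl i => lineHat (T.ζ i) (T.ζ (i + 1)) (T.ζ (i + 2))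
  | Sum.inr q => lineBubble (T.ζ (ofLex q).2) (T.ζ ((ofLex q).2 + 1)) (ofLex q).1

/-- The mass matrix `M^Q`. -/
def lineMass (p : ℕ) : Matrix (T.LineIndex p) (T.LineIndex p) ℝ :=
  Matrix.of fun s s' => ∫ x in (-1 : ℝ)..1, T.lineBasis p s x * T.lineBasis p s' x

/-- The stiffness matrix `A^Q`. The basis functions are continuous and piecewise polynomial, so
`deriv` is their weak derivative off the finitely many nodes. -/
def lineStiffness (p : ℕ) : Matrix (T.LineIndex p) (T.LineIndex p) ℝ :=
  Matrix.of fun s s' => ∫ x in (-1 : ℝ)..1, deriv (T.lineBasis p s) x * deriv (T.lineBasis p s') x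

/-- The block `M^Φ_{m,j}` of the mass matrix of the disk. -/
def diskMass (p m : ℕ) (j : Fin 2) : Matrix (T.DiskIndex p m) (T.DiskIndex p m) ℝ :=
  Matrix.of fun s s' => ∫ z in Metric.ball (0 : ℂ) 1,
    T.diskBasis p m j s z * T.diskBasis p m j s' z

/-- The block `[M_λ^Φ]_{m,j}` of the weighted mass matrix, for the coefficient `λ = lam (r)`. -/
def diskWeightedMass (lam : ℝ → ℝ) (p m : ℕ) (j : Fin 2) :
    Matrix (T.DiskIndex p m) (T.DiskIndex p m) ℝ :=
  Matrix.of fun s s' => ∫ z in Metric.ball (0 : ℂ) 1,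
    lam ‖z‖ * T.diskBasis p m j s z * T.diskBasis p m j s' z

/-- The block `A^Φ_{m,j}` of the stiffness matrix of the disk. The basis functions are continuous
and piecewise polynomial, so `gradient` is their weak gradient off the circles of the mesh. -/
def diskStiffness (p m : ℕ) (j : Fin 2) : Matrix (T.DiskIndex p m) (T.DiskIndex p m) ℝ :=
  Matrix.of fun s s' => ∫ z in Metric.ball (0 : ℂ) 1,
    inner ℝ (gradient (T.diskBasis p m j s) z) (gradient (T.diskBasis p m j s') z)

/-- The block `K^Φ_{m,j} = [M_λ^Φ]_{m,j} + A^Φ_{m,j}`. -/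
def diskHelmholtz (lam : ℝ → ℝ) (p m : ℕ) (j : Fin 2) :
    Matrix (T.DiskIndex p m) (T.DiskIndex p m) ℝ :=
  T.diskWeightedMass lam p m j + T.diskStiffness p m j

end CylinderMesh

/-! ### Reverse Cholesky factorization and the ADI iteration count -/

/-- `L` is the reverse Cholesky factor of `A`: lower triangular with positive diagonal and
`Lᵀ L = A`. -/
def IsReverseCholesky {ι : Type} [Fintype ι] [LinearOrder ι] (A L : Matrix ι ι ℝ) : Prop :=
  (∀ s s', s < s' → L s s' = 0) ∧ (∀ s, 0 < L s s) ∧ Lᵀ * L = A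

/-- Membership of a rotationally invariant coefficient `λ = lam (r)` in `L^∞` of the unit disk,
with `λ ≥ 0` almost everywhere. -/
def AdmissibleCoeff (lam : ℝ → ℝ) : Prop :=
  MemLp (fun z : ℂ => lam ‖z‖) ⊤ (volume.restrict (Metric.ball (0 : ℂ) 1)) ∧
    ∀ᵐ z : ℂ ∂(volume.restrict (Metric.ball (0 : ℂ) 1)), 0 ≤ lam ‖z‖

/-- The norm `‖λ‖_{L^∞}` on the unit disk of the coefficient `λ = lam (r)`. -/
def coeffNorm (lam : ℝ → ℝ) : ℝ :=
  (eLpNorm (fun z : ℂ => lam ‖z‖) ⊤ (volume.restrict (Metric.ball (0 : ℂ) 1))).toReal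

/-- The cross-ratio `γ` of the two spectral intervals `[μa, μb]` and `[μc, μd]`. -/
def adiGamma (μa μb μc μd : ℝ) : ℝ :=
  |μc - μa| * |μd - μb| / (|μc - μb| * |μd - μa|)

/-- The index `ℓ_max` of the final ADI iterate, for the tolerance `ε`. -/
def adiIterations (μa μb μc μd ε : ℝ) : ℕ :=
  ⌈Real.log (16 * adiGamma μa μb μc μd) * Real.log (4 / ε) / Real.pi ^ 2⌉₊

end DiskFEM

end

open DiskFEM

namespace DiskFEM

/-! ### Reverse Cholesky factors and generalized Rayleigh quotients -/

section LinearAlgebra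

variable {ι : Type} [Fintype ι] [LinearOrder ι]

/-! Substituting w = L⁻¹v turns the eigenvalues of L⁻ᵀML⁻¹ into values of the Rayleigh quotient of M
against A = LᵀL (`IsReverseCholesky.spectrum_subset`). Each spectral inclusion is therefore a pair
of form inequalities for continuous piecewise polynomials: a Poincaré inequality for the upper end,
an inverse (Markov type) inequality for the lower end. Linear independence
(`IsHierarchical.eq_zero`) makes the mass forms definite, the Poincaré inequality passes this on to
the stiffness forms, and the factorizations exist by `exists_isReverseCholesky`.

The disk is reduced to one variable. On a cell each function of a mode is Y q(r²) with Y harmonic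
and homogeneous of degree m. With x = r², and up to an angular constant, the mass form becomes ∫ x^m
q². The stiffness form becomes ∫ x^(m+1) q'², plus boundary terms that telescope over the cells
(`diskMass_eq`, `diskStiffness_eq`).

Both Poincaré inequalities add the derivative of a weight times g² on each cell so that a square
appears; by continuity the boundary terms cancel in the sum. The weight ω tan(ωx) with ω tending to
π/2 gives 4/π² on (-1,1) (`poincare_interval`); the weight x^(m+1) gives a constant that is uniform
in m (`poincare_radial`).

For the inverse inequalities the ratio of the two forms is computed exactly on the orthogonal
polynomials for x^m on (0,1), by integration by parts and the Jacobi equation; the constants add up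
when the orthogonal components are joined one degree at a time (`inverse_inequality_of_ortho`). On
an annulus the weight is absorbed into the polynomial r^m q(r²) of r, at a cost governed by the
ratio of the two radii. This is where quasi-uniformity enters. Then θh⁻² ≤ N_h replaces h⁻² by
N_h/θ.

For the iteration count, γ ≤ μ_b/μ_a = O(N_h p⁴), which is the fourth power of N_h^(1/4) p; of the
disk spectrum only the sign matters (`adiGamma_bounds`, `adiIterations_le`). -/

theorem IsReverseCholesky.isUnit_det {A L : Matrix ι ι ℝ} (h : IsReverseCholesky A L) :
    IsUnit L.det := by
  rw [Matrix.det_of_isLowerTriangular L (fun i j hij => h.1 i j hij)]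
  exact (Finset.prod_pos fun i _ => h.2.1 i).ne'.isUnit

/-- An LDL factorization for the reversed order yields an upper triangular U with UAUᵀ diagonal. The
transpose of U⁻¹, with rescaled rows, is then the factor. -/
theorem exists_isReverseCholesky {A : Matrix ι ι ℝ} (hA : A.PosDef) :
    ∃ L, IsReverseCholesky A L := by
  classical
  let : LocallyFiniteOrder ιᵒᵈ := Fintype.toLocallyFiniteOrder
  let : LocallyFiniteOrderBot ιᵒᵈ :=
    LocallyFiniteOrderBot.ofIic ιᵒᵈ (fun a => Finset.univ.filter (· ≤ a)) (by simp)
  let e : ιᵒᵈ ≃ ι := OrderDual.ofDual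
  have hS : (A.submatrix e e).PosDef := hA.submatrix e.injective
  set R : Matrix ιᵒᵈ ιᵒᵈ ℝ := LDL.lowerInv hS with hR
  set U : Matrix ι ι ℝ := R.submatrix e.symm e.symm with hU
  have hRdet : IsUnit R.det := (Matrix.isUnit_iff_isUnit_det R).1 (isUnit_of_invertible R)
  have hUdet : IsUnit U.det := by rwa [hU, Matrix.det_submatrix_equiv_self]
  have hUtri : U.BlockTriangular id := by
    intro i j hij
    exact LDL.lowerInv_triangular hS (i := e.symm i) (j := e.symm j) hij
  obtain ⟨d, hd⟩ : ∃ d : ι → ℝ, U * A * Uᵀ = diagonal d := by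
    refine ⟨fun i => LDL.diagEntries hS (e.symm i), ?_⟩
    have h := LDL.diag_eq_lowerInv_conj hS
    have h2 := congrArg (fun M : Matrix ιᵒᵈ ιᵒᵈ ℝ => M.submatrix e.symm e.symm) h
    simp only [LDL.diag, Matrix.conjTranspose_eq_transpose_of_trivial] at h2
    rw [Matrix.submatrix_mul_equiv _ _ _ e.symm _ |>.symm,
      Matrix.submatrix_mul_equiv _ _ _ e.symm _ |>.symm] at h2
    rw [Matrix.submatrix_diagonal_equiv] at h2
    exact h2.symm
  have : Invertible U := Matrix.invertibleOfIsUnitDet U hUdet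
  have hWtri : U⁻¹.BlockTriangular id := blockTriangular_inv_of_blockTriangular hUtri
  have hWdet : U⁻¹.det ≠ 0 := by
    rw [Matrix.det_nonsing_inv]; simpa using hUdet.ne_zero
  have hWdiag : ∀ i, U⁻¹ i i ≠ 0 := by
    rw [Matrix.det_of_isUpperTriangular hWtri] at hWdet
    intro i
    exact Finset.prod_ne_zero_iff.1 hWdet i (Finset.mem_univ i)
  have hdpos : ∀ i, 0 < d i := by
    have hpd : (U * A * Uᵀ).PosDef := by
      have := hA.mul_mul_conjTranspose_same (B := U)
        (Matrix.vecMul_injective_of_isUnit ((Matrix.isUnit_iff_isUnit_det U).2 hUdet))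
      simpa [Matrix.conjTranspose_eq_transpose_of_trivial] using this
    rw [hd] at hpd
    exact Matrix.posDef_diagonal_iff.1 hpd
  have hAeq : A = U⁻¹ * diagonal d * U⁻¹ᵀ := by
    rw [← hd, Matrix.transpose_nonsing_inv]
    have h1 : IsUnit Uᵀ.det := by rwa [Matrix.det_transpose]
    rw [Matrix.mul_assoc U A, ← Matrix.mul_assoc U⁻¹, Matrix.nonsing_inv_mul _ hUdet,
      Matrix.one_mul, Matrix.mul_assoc, Matrix.mul_nonsing_inv _ h1, Matrix.mul_one]
  -- The square root carries the sign of the diagonal entry of U⁻¹, so that the diagonal of the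
  -- factor is positive whatever the normalization of U.
  let σ : ι → ℝ := fun i => SignType.sign (U⁻¹ i i) * Real.sqrt (d i)
  have hσ : ∀ i, σ i * σ i = d i := by
    intro i
    have h1 : ((SignType.sign (U⁻¹ i i) : SignType) : ℝ) * (SignType.sign (U⁻¹ i i) : ℝ) = 1 := by
      rcases lt_or_gt_of_ne (hWdiag i) with h | h
      · simp [sign_neg h]
      · simp [sign_pos h]
    calc σ i * σ i = ((SignType.sign (U⁻¹ i i) : ℝ) * (SignType.sign (U⁻¹ i i) : ℝ)) *
          (Real.sqrt (d i) * Real.sqrt (d i)) := by simp only [σ]; ring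
      _ = d i := by rw [h1, one_mul, Real.mul_self_sqrt (hdpos i).le]
  refine ⟨diagonal σ * U⁻¹ᵀ, ?_, ?_, ?_⟩
  · intro s s' hss
    rw [Matrix.diagonal_mul, Matrix.transpose_apply, hWtri hss, mul_zero]
  · intro s
    rw [Matrix.diagonal_mul, Matrix.transpose_apply]
    have : σ s * U⁻¹ s s = Real.sqrt (d s) * |U⁻¹ s s| := by
      simp only [σ]; rw [← sign_mul_self (U⁻¹ s s)]; ring
    rw [this]
    exact mul_pos (Real.sqrt_pos.2 (hdpos s)) (abs_pos.2 (hWdiag s))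
  · rw [Matrix.transpose_mul, Matrix.transpose_transpose, Matrix.diagonal_transpose,
      Matrix.mul_assoc, ← Matrix.mul_assoc (diagonal σ), Matrix.diagonal_mul_diagonal]
    simp only [hσ]
    rw [← Matrix.mul_assoc, ← hAeq]

/-- The eigenvalues of `L⁻ᵀ M L⁻¹` are values of the generalized Rayleigh quotient of `M` and
`A = Lᵀ L`. -/
theorem IsReverseCholesky.spectrum_subset {A L M : Matrix ι ι ℝ} (h : IsReverseCholesky A L)
    {α β : ℝ} (hα : ∀ v, α * (v ⬝ᵥ A *ᵥ v) ≤ v ⬝ᵥ M *ᵥ v)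
    (hβ : ∀ v, v ⬝ᵥ M *ᵥ v ≤ β * (v ⬝ᵥ A *ᵥ v)) :
    spectrum ℝ (L⁻¹ᵀ * M * L⁻¹) ⊆ Set.Icc α β := by
  intro μ hμ
  have hdet := h.isUnit_det
  rw [← Matrix.spectrum_toLin', ← Module.End.hasEigenvalue_iff_mem_spectrum] at hμ
  obtain ⟨v, hv⟩ := hμ.exists_hasEigenvector
  have hv1 : (L⁻¹ᵀ * M * L⁻¹) *ᵥ v = μ • v := by
    rw [← Matrix.toLin'_apply]; exact hv.apply_eq_smul
  set w := L⁻¹ *ᵥ v with hw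
  have hLw : L *ᵥ w = v := by
    rw [hw, Matrix.mulVec_mulVec, Matrix.mul_nonsing_inv _ hdet, Matrix.one_mulVec]
  have hA : w ⬝ᵥ A *ᵥ w = v ⬝ᵥ v := by
    rw [← h.2.2, ← Matrix.mulVec_mulVec, Matrix.dotProduct_mulVec, Matrix.vecMul_transpose, hLw]
  have hM : w ⬝ᵥ M *ᵥ w = μ * (v ⬝ᵥ v) := by
    have : v ⬝ᵥ ((L⁻¹ᵀ * M * L⁻¹) *ᵥ v) = w ⬝ᵥ M *ᵥ w := by
      rw [← Matrix.mulVec_mulVec, ← hw, ← Matrix.mulVec_mulVec, Matrix.dotProduct_mulVec,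
        Matrix.vecMul_transpose]
    rw [← this, hv1, dotProduct_smul, smul_eq_mul]
  have hpos : 0 < v ⬝ᵥ v := by
    have := Matrix.dotProduct_star_self_pos_iff (v := v) |>.2 hv.2
    simpa using this
  have h1 := hα w
  have h2 := hβ w
  rw [hA, hM] at h1 h2
  exact ⟨le_of_mul_le_mul_right h1 hpos, le_of_mul_le_mul_right h2 hpos⟩

end LinearAlgebra

/-- The quadratic form of a Gram matrix of a bilinear form. -/
theorem dotProduct_gram_mulVec {ι V : Type*} [Fintype ι] [AddCommGroup V] [Module ℝ V]
    (B : V →ₗ[ℝ] V →ₗ[ℝ] ℝ) (f : ι → V) (v : ι → ℝ) :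
    v ⬝ᵥ (Matrix.of fun s s' => B (f s) (f s')) *ᵥ v =
      B (∑ s, v s • f s) (∑ s, v s • f s) := by
  simp only [map_sum, LinearMap.sum_apply, map_smul, LinearMap.smul_apply, dotProduct, mulVec,
    Matrix.of_apply, smul_eq_mul, Finset.mul_sum]
  rw [Finset.sum_comm]
  refine Finset.sum_congr rfl fun s _ => Finset.sum_congr rfl fun s' _ => by ring

open Polynomial

/-! ### Integrals of polynomials -/

/-- The integral of a polynomial over `[a, b]`, as a linear functional. -/
noncomputable def polyIntegral (a b : ℝ) : ℝ[X] →ₗ[ℝ] ℝ where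
  toFun p := ∫ x in a..b, p.eval x
  map_add' p q := by
    simp only [eval_add]
    exact intervalIntegral.integral_add (p.continuous.intervalIntegrable _ _)
      (q.continuous.intervalIntegrable _ _)
  map_smul' c p := by simp

theorem polyIntegral_apply (a b : ℝ) (p : ℝ[X]) :
    polyIntegral a b p = ∫ x in a..b, p.eval x := rfl

theorem polyIntegral_C_mul (a b c : ℝ) (p : ℝ[X]) :
    polyIntegral a b (C c * p) = c * polyIntegral a b p := by
  rw [← smul_eq_C_mul, map_smul, smul_eq_mul]

theorem polyIntegral_natCast_mul (a b : ℝ) (n : ℕ) (p : ℝ[X]) :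
    polyIntegral a b ((n : ℝ[X]) * p) = n * polyIntegral a b p := by
  rw [← polyIntegral_C_mul, C_eq_natCast]

theorem polyIntegral_derivative (a b : ℝ) (p : ℝ[X]) :
    polyIntegral a b (derivative p) = p.eval b - p.eval a :=
  intervalIntegral.integral_eq_sub_of_hasDerivAt (fun x _ => p.hasDerivAt x)
    (p.derivative.continuous.intervalIntegrable _ _)

theorem polyIntegral_mono {a b : ℝ} (hab : a ≤ b) {p q : ℝ[X]}
    (h : ∀ x ∈ Set.Icc a b, p.eval x ≤ q.eval x) : polyIntegral a b p ≤ polyIntegral a b q :=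
  intervalIntegral.integral_mono_on hab (p.continuous.intervalIntegrable _ _)
    (q.continuous.intervalIntegrable _ _) h

theorem polyIntegral_nonneg {a b : ℝ} (hab : a ≤ b) {p : ℝ[X]}
    (h : ∀ x ∈ Set.Icc a b, 0 ≤ p.eval x) : 0 ≤ polyIntegral a b p :=
  intervalIntegral.integral_nonneg hab h

theorem polyIntegral_pos {a b : ℝ} (hab : a < b) {p : ℝ[X]} (hp : p ≠ 0)
    (h : ∀ x ∈ Set.Icc a b, 0 ≤ p.eval x) : 0 < polyIntegral a b p := by
  obtain ⟨x, hx, hx0⟩ : ∃ x ∈ Set.Icc a b, p.eval x ≠ 0 := by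
    by_contra! hcon
    exact hp (eq_zero_of_infinite_isRoot p
      ((Set.Icc_infinite hab).mono fun x hx => hcon x hx))
  exact intervalIntegral.integral_pos hab p.continuous.continuousOn
    (fun y hy => h y ⟨hy.1.le, hy.2⟩) ⟨x, hx, lt_of_le_of_ne (h x hx) hx0.symm⟩

theorem polyIntegral_comp_linear {a b : ℝ} (p : ℝ[X]) :
    polyIntegral a b p = (b - a) * polyIntegral 0 1 (p.comp (C (b - a) * X + C a)) := by
  have h := intervalIntegral.integral_comp_mul_deriv (a := 0) (b := 1)
    (f := fun y => (b - a) * y + a) (f' := fun _ => b - a) (g := fun x => p.eval x)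
    (fun x _ => by simpa using ((hasDerivAt_id x).const_mul (b - a)).add_const a)
    continuousOn_const p.continuous
  simp only [mul_zero, zero_add, mul_one, sub_add_cancel] at h
  rw [polyIntegral_apply, ← h, ← polyIntegral_C_mul, polyIntegral_apply]
  refine intervalIntegral.integral_congr fun x _ => ?_
  simp [mul_comm]

theorem polyIntegral_comp_sq (a b : ℝ) (p : ℝ[X]) :
    polyIntegral (a ^ 2) (b ^ 2) p = polyIntegral a b (2 * X * p.comp (X ^ 2)) := by
  have h := intervalIntegral.integral_comp_mul_deriv (a := a) (b := b)
    (f := fun y => y ^ 2) (f' := fun y => 2 * y) (g := fun x => p.eval x)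
    (fun x _ => by simpa using hasDerivAt_pow 2 x)
    (by fun_prop) p.continuous
  rw [polyIntegral_apply, ← h, polyIntegral_apply]
  refine intervalIntegral.integral_congr fun x _ => ?_
  simp [mul_comm]

/-- The bilinear form `∫_a^b w p q`. -/
noncomputable def polyForm (a b : ℝ) (w : ℝ[X]) : ℝ[X] →ₗ[ℝ] ℝ[X] →ₗ[ℝ] ℝ :=
  (LinearMap.mul ℝ ℝ[X]).compr₂ (polyIntegral a b ∘ₗ LinearMap.mulLeft ℝ w)

/-- The bilinear form `∫_a^b w p' q'`. -/
noncomputable def polyDerivForm (a b : ℝ) (w : ℝ[X]) : ℝ[X] →ₗ[ℝ] ℝ[X] →ₗ[ℝ] ℝ :=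
  (polyForm a b w).compl₁₂ derivative derivative

@[simp]
theorem polyForm_apply (a b : ℝ) (w p q : ℝ[X]) :
    polyForm a b w p q = polyIntegral a b (w * (p * q)) := rfl

@[simp]
theorem polyDerivForm_apply (a b : ℝ) (w p q : ℝ[X]) :
    polyDerivForm a b w p q = polyIntegral a b (w * (derivative p * derivative q)) := rfl

theorem polyForm_self_nonneg {a b : ℝ} (hab : a ≤ b) {w : ℝ[X]}
    (hw : ∀ x ∈ Set.Icc a b, 0 ≤ w.eval x) (p : ℝ[X]) : 0 ≤ polyForm a b w p p :=
  polyIntegral_nonneg hab fun x hx => by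
    change 0 ≤ (w * (p * p)).eval x
    rw [eval_mul, eval_mul]; exact mul_nonneg (hw x hx) (mul_self_nonneg _)

theorem polyForm_self_pos {a b : ℝ} (hab : a < b) {w : ℝ[X]} (hw0 : w ≠ 0)
    (hw : ∀ x ∈ Set.Icc a b, 0 ≤ w.eval x) {p : ℝ[X]} (hp : p ≠ 0) : 0 < polyForm a b w p p :=
  polyIntegral_pos hab (mul_ne_zero hw0 (mul_ne_zero hp hp)) fun x hx => by
    change 0 ≤ (w * (p * p)).eval x
    rw [eval_mul, eval_mul]; exact mul_nonneg (hw x hx) (mul_self_nonneg _)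

/-! ### Orthogonal polynomials for the weight `x ^ m` on `(0, 1)` -/

theorem eval_X_pow_nonneg {a b : ℝ} (ha : 0 ≤ a) (m : ℕ) :
    ∀ x ∈ Set.Icc a b, 0 ≤ (X ^ m : ℝ[X]).eval x := fun x hx => by
  simpa using pow_nonneg (ha.trans hx.1) m

/-- `P` is orthogonal, for the weight `x ^ m` on `(0, 1)`, to all polynomials of degree
less than `k`. -/
def OrthoBelow (m k : ℕ) (P : ℝ[X]) : Prop :=
  ∀ q : ℝ[X], q.degree < k → polyForm 0 1 (X ^ m) P q = 0

theorem OrthoBelow.eq_zero {m k : ℕ} {P : ℝ[X]} (h : OrthoBelow m k P) (hP : P.degree < k) :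
    P = 0 := by
  by_contra h0
  exact (polyForm_self_pos zero_lt_one (pow_ne_zero m X_ne_zero)
    (eval_X_pow_nonneg le_rfl m) h0).ne' (h P hP)

/-- A dimension count: polynomials of degree at most k form a space of dimension k + 1, and
orthogonality imposes only k conditions. -/
theorem exists_orthoBelow (m k : ℕ) :
    ∃ P : ℝ[X], P.natDegree = k ∧ P ≠ 0 ∧ OrthoBelow m k P := by
  have hfin : ∀ n, Module.finrank ℝ (degreeLT ℝ n) = n := fun n => by
    rw [LinearEquiv.finrank_eq (degreeLTEquiv ℝ n), Module.finrank_fin_fun]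
  have : ∀ n, FiniteDimensional ℝ (degreeLT ℝ n) := fun n =>
    (degreeLTEquiv ℝ n).symm.finiteDimensional
  let f : degreeLT ℝ (k + 1) →ₗ[ℝ] (degreeLT ℝ k →ₗ[ℝ] ℝ) :=
    (polyForm 0 1 (X ^ m)).compl₁₂ (degreeLT ℝ (k + 1)).subtype (degreeLT ℝ k).subtype
  have hker : LinearMap.ker f ≠ ⊥ := by
    apply LinearMap.ker_ne_bot_of_finrank_lt
    rw [hfin, Module.finrank_linearMap_self, hfin]
    exact Nat.lt_succ_self k
  obtain ⟨⟨P, hPdeg⟩, hPker, hP0⟩ := (Submodule.ne_bot_iff _).1 hker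
  have hP0' : P ≠ 0 := fun h => hP0 (Subtype.ext h)
  have hortho : OrthoBelow m k P := fun q hq =>
    LinearMap.congr_fun (LinearMap.mem_ker.1 hPker) ⟨q, mem_degreeLT.2 hq⟩
  refine ⟨P, le_antisymm ?_ ?_, hP0', hortho⟩
  · have := mem_degreeLT.1 hPdeg
    rw [degree_eq_natDegree hP0'] at this
    exact Nat.lt_succ_iff.1 (by exact_mod_cast this)
  -- A smaller degree would make P orthogonal to itself.
  · by_contra! hlt
    refine hP0' (hortho.eq_zero ?_)
    rw [degree_eq_natDegree hP0']
    exact_mod_cast hlt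

/-- The Jacobi differential operator `x ^ (-m) (x ^ (m + 1) (1 - x) q')'`. -/
noncomputable def jacobiOp (m : ℕ) (q : ℝ[X]) : ℝ[X] :=
  ((m : ℝ[X]) + 1) * (1 - X) * derivative q - X * derivative q +
    X * (1 - X) * derivative (derivative q)

/-- The divergence form makes the operator symmetric for the weight x^m: the factor x^(m+1) (1 - x)
vanishes at both ends. -/
theorem X_pow_mul_jacobiOp (m : ℕ) (q : ℝ[X]) :
    X ^ m * jacobiOp m q = derivative (X ^ (m + 1) * (1 - X) * derivative q) := by
  simp only [jacobiOp, derivative_mul, derivative_X_pow, derivative_sub, derivative_one,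
    derivative_X, Nat.cast_add, Nat.cast_one, Nat.add_sub_cancel, map_add, map_natCast, map_one]
  ring

theorem coeff_X_mul_derivative (q : ℝ[X]) (n : ℕ) :
    (X * derivative q).coeff n = n * q.coeff n := by
  cases n with
  | zero => simp
  | succ n => rw [coeff_X_mul, coeff_derivative]; push_cast; ring

theorem coeff_jacobiOp (m : ℕ) (q : ℝ[X]) (n : ℕ) :
    (jacobiOp m q).coeff n =
      (n + 1) * (n + m + 1) * q.coeff (n + 1) - n * (n + m + 1) * q.coeff n := by
  have h : jacobiOp m q = C ((m : ℝ) + 1) * derivative q - C ((m : ℝ) + 1) * (X * derivative q)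
      + X * derivative (derivative q) - X * derivative (X * derivative q) := by
    simp only [jacobiOp, derivative_mul, derivative_X, map_add, map_natCast, map_one]
    ring
  rw [h, coeff_sub, coeff_add, coeff_sub, coeff_C_mul, coeff_C_mul, coeff_X_mul_derivative,
    coeff_X_mul_derivative, coeff_X_mul_derivative, coeff_X_mul_derivative, coeff_derivative]
  ring

theorem degree_jacobiOp_lt {m k : ℕ} {q : ℝ[X]} (hq : q.degree < k) :
    (jacobiOp m q).degree < k := by
  rw [degree_lt_iff_coeff_zero] at hq ⊢
  intro n hn
  rw [coeff_jacobiOp, hq n hn, hq (n + 1) (hn.trans n.le_succ)]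
  ring

section Ortho

variable {m k : ℕ} {P : ℝ[X]}

/-- The operator is symmetric and does not raise degrees, so the image of P is again orthogonal to
all lower degrees. Subtracting the multiple of P with the same coefficient of degree k leaves a
polynomial of lower degree that is still orthogonal to lower degrees, hence zero. -/
theorem OrthoBelow.jacobiOp_eq (h : OrthoBelow m k P) (hP : P.natDegree = k) :
    jacobiOp m P = C (-((k : ℝ) * (k + m + 1))) * P := by
  rw [← sub_eq_zero]
  have hlow : (jacobiOp m P - C (-((k : ℝ) * (k + m + 1))) * P).degree < k := by
    rw [degree_lt_iff_coeff_zero]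
    intro n hn
    rw [coeff_sub, coeff_jacobiOp, coeff_C_mul,
      coeff_eq_zero_of_natDegree_lt (n := n + 1) (by omega)]
    rcases hn.eq_or_lt with rfl | hn'
    · ring
    · rw [coeff_eq_zero_of_natDegree_lt (n := n) (by omega)]; ring
  refine OrthoBelow.eq_zero (m := m) ?_ hlow
  intro q hq
  have h1 : polyForm 0 1 (X ^ m) (jacobiOp m P) q = 0 := by
    have e1 : X ^ m * (jacobiOp m P * q) = derivative (X ^ (m + 1) * (1 - X) *
        (derivative P * q - derivative q * P)) + X ^ m * (P * jacobiOp m q) := by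
      rw [← mul_assoc, X_pow_mul_jacobiOp, mul_left_comm (X ^ m) P, X_pow_mul_jacobiOp]
      simp only [derivative_mul, derivative_sub]
      ring
    have h2 := h _ (degree_jacobiOp_lt (m := m) hq)
    rw [polyForm_apply] at h2 ⊢
    rw [e1, map_add, polyIntegral_derivative, h2]
    simp
  rw [map_sub, LinearMap.sub_apply, h1, ← smul_eq_C_mul, map_smul, LinearMap.smul_apply, h q hq]
  simp

/-- The Jacobi equation at x = 1, where its second-order term vanishes. -/
theorem OrthoBelow.derivative_eval_one (h : OrthoBelow m k P) (hP : P.natDegree = k) :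
    (derivative P).eval 1 = k * (k + m + 1) * P.eval 1 := by
  have := congrArg (eval 1) (h.jacobiOp_eq hP)
  simp [jacobiOp] at this
  linarith

theorem OrthoBelow.derivative_eval_zero (h : OrthoBelow 0 k P) (hP : P.natDegree = k) :
    (derivative P).eval 0 = -(k * (k + 1) * P.eval 0) := by
  have := congrArg (eval 0) (h.jacobiOp_eq hP)
  simp [jacobiOp] at this
  linarith

/-- The leading terms of xP' and kP cancel, so P is orthogonal to the difference. -/
theorem OrthoBelow.integral_mul_X_derivative (h : OrthoBelow m k P) (hP : P.natDegree = k) :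
    polyIntegral 0 1 (X ^ m * (P * (X * derivative P))) =
      k * polyIntegral 0 1 (X ^ m * (P * P)) := by
  have hlow : (X * derivative P - C (k : ℝ) * P).degree < (k : WithBot ℕ) := by
    rw [degree_lt_iff_coeff_zero]
    intro n hn
    rw [coeff_sub, coeff_X_mul_derivative, coeff_C_mul]
    rcases hn.eq_or_lt with rfl | hn'
    · ring
    · rw [coeff_eq_zero_of_natDegree_lt (n := n) (by omega)]; ring
  have := h _ hlow
  rw [map_sub, ← smul_eq_C_mul, map_smul, polyForm_apply, polyForm_apply, smul_eq_mul] at this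
  linarith

/-- Integrate the derivative of x^(m+1) P²; the end 0 contributes nothing. -/
theorem OrthoBelow.integral_sq (h : OrthoBelow m k P) (hP : P.natDegree = k) :
    (m + 1 + 2 * k) * polyIntegral 0 1 (X ^ m * (P * P)) = P.eval 1 ^ 2 := by
  have e : derivative (X ^ (m + 1) * (P * P)) =
      ((m + 1 : ℕ) : ℝ[X]) * (X ^ m * (P * P)) +
        ((2 : ℕ) : ℝ[X]) * (X ^ m * (P * (X * derivative P))) := by
    simp only [derivative_mul, derivative_X_pow, Nat.add_sub_cancel, map_natCast]
    push_cast
    ring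
  have h1 := polyIntegral_derivative 0 1 (X ^ (m + 1) * (P * P))
  rw [e, map_add, polyIntegral_natCast_mul, polyIntegral_natCast_mul,
    h.integral_mul_X_derivative hP] at h1
  simp at h1
  linarith

theorem degree_derivative_lt_of_natDegree (hP : P.natDegree = k) (hP0 : P ≠ 0) :
    (derivative P).degree < k := by
  rw [← hP, ← degree_eq_natDegree hP0]
  exact degree_derivative_lt hP0

/-- Integrating by parts pairs P with (m+1)P' + xP'', which has lower degree. Only the boundary
value P(1)P'(1) survives, and the two preceding identities evaluate it. -/
theorem OrthoBelow.integral_derivative_sq (h : OrthoBelow m k P) (hP : P.natDegree = k) :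
    polyIntegral 0 1 (X ^ (m + 1) * (derivative P * derivative P)) =
      k * (k + m + 1) * (m + 1 + 2 * k) * polyIntegral 0 1 (X ^ m * (P * P)) := by
  set R := C ((m : ℝ) + 1) * derivative P + X * derivative (derivative P) with hR
  have hlow : R.degree < k := by
    rw [degree_lt_iff_coeff_zero]
    intro n hn
    rw [hR, coeff_add, coeff_C_mul, coeff_X_mul_derivative, coeff_derivative,
      coeff_eq_zero_of_natDegree_lt (n := n + 1) (by omega)]
    ring
  have e : X ^ (m + 1) * (derivative P * derivative P) =
      derivative (X ^ (m + 1) * (P * derivative P)) - X ^ m * (P * R) := by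
    simp only [hR, derivative_mul, derivative_X_pow, Nat.add_sub_cancel, map_natCast, map_add,
      map_one, Nat.cast_add, Nat.cast_one]
    ring
  have h2 := h R hlow
  rw [polyForm_apply] at h2
  rw [e, map_sub, polyIntegral_derivative, h2]
  simp only [eval_mul, eval_pow, eval_X, one_pow, h.derivative_eval_one hP]
  rw [mul_assoc _ _ (polyIntegral _ _ _), h.integral_sq hP]
  simp
  ring

/-- Integration by parts leaves PP' at both ends, that is k(k+1)(P(0)² + P(1)²). The derivative of
(2x - 1)P² expresses this sum of squares through ∫ P². -/
theorem OrthoBelow.integral_derivative_sq_unweighted (h : OrthoBelow 0 k P)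
    (hP : P.natDegree = k) (hP0 : P ≠ 0) :
    polyIntegral 0 1 (1 * (derivative P * derivative P)) =
      k * (k + 1) * (4 * k + 2) * polyIntegral 0 1 (1 * (P * P)) := by
  have hd1 := degree_derivative_lt_of_natDegree hP hP0
  have h1 := h _ hd1
  have hd2 : (derivative (derivative P)).degree < k := by
    by_cases h0 : derivative P = 0
    · rw [h0, derivative_zero]; simp
    · exact (degree_derivative_lt h0).trans hd1
  have h2 := h _ hd2
  have h3 := h.integral_mul_X_derivative hP
  rw [polyForm_apply, pow_zero] at h1 h2
  rw [pow_zero] at h3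
  have e : (1 : ℝ[X]) * (derivative P * derivative P) =
      derivative (P * derivative P) - 1 * (P * derivative (derivative P)) := by
    simp only [derivative_mul]
    ring
  have e2 : derivative ((2 * X - 1) * (P * P)) = ((2 : ℕ) : ℝ[X]) * (1 * (P * P)) +
      ((4 : ℕ) : ℝ[X]) * (1 * (P * (X * derivative P))) -
        ((2 : ℕ) : ℝ[X]) * (1 * (P * derivative P)) := by
    simp only [derivative_mul, derivative_sub, derivative_X, derivative_one, derivative_ofNat]
    push_cast
    ring
  have h4 := polyIntegral_derivative 0 1 ((2 * X - 1) * (P * P))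
  rw [e2, map_sub, map_add, polyIntegral_natCast_mul, polyIntegral_natCast_mul,
    polyIntegral_natCast_mul, h1, h3] at h4
  rw [e, map_sub, polyIntegral_derivative, h2]
  have hz := h.derivative_eval_zero hP
  have ho := h.derivative_eval_one hP
  simp only [eval_mul, hz, ho]
  simp at h4 ⊢
  linear_combination (-(k * (k + 1) : ℝ)) * h4
end Ortho

/-! ### Inverse inequalities on `(0, 1)` -/

/-- Adding the orthogonal polynomials one degree at a time: the constants of the inverse
inequality add up. -/
theorem inverse_inequality_of_ortho {m : ℕ} {w : ℝ[X]} (hw : ∀ x ∈ Set.Icc (0 : ℝ) 1, 0 ≤ w.eval x)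
    {s S : ℕ → ℝ} (hS0 : 0 ≤ S 0) (hS : ∀ k, S k + s (k + 1) ≤ S (k + 1)) (hs : ∀ k, 0 ≤ s k)
    (hP : ∀ k (P : ℝ[X]), P.natDegree = k → P ≠ 0 → OrthoBelow m k P →
      polyDerivForm 0 1 w P P ≤ s k * polyForm 0 1 (X ^ m) P P) :
    ∀ (k : ℕ) (q : ℝ[X]), q.natDegree ≤ k →
      polyDerivForm 0 1 w q q ≤ S k * polyForm 0 1 (X ^ m) q q := by
  have hSnn : ∀ k, 0 ≤ S k := by
    intro k
    induction k with
    | zero => exact hS0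
    | succ k ih => linarith [hS k, hs (k + 1)]
  have hM : ∀ q, 0 ≤ polyForm 0 1 (X ^ m) q q :=
    polyForm_self_nonneg zero_le_one (eval_X_pow_nonneg le_rfl m)
  have hE : ∀ q, 0 ≤ polyDerivForm 0 1 w q q := fun q =>
    polyForm_self_nonneg zero_le_one hw (derivative q)
  intro k
  induction k with
  | zero =>
    intro q hq
    rw [eq_C_of_natDegree_le_zero hq]
    have := hM (C (q.coeff 0))
    have := mul_nonneg (hSnn 0) this
    simpa using this
  | succ k ih =>
    intro q hq
    obtain ⟨P, hPd, hP0, hPo⟩ := exists_orthoBelow m (k + 1)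
    have hlc : P.coeff (k + 1) ≠ 0 := by
      rw [← hPd]; exact leadingCoeff_ne_zero.2 hP0
    set α := q.coeff (k + 1) / P.coeff (k + 1) with hα
    set v := q - α • P with hv
    have hvd : v.natDegree ≤ k := by
      rw [natDegree_le_iff_coeff_eq_zero]
      intro n hn
      rw [hv, coeff_sub, coeff_smul, smul_eq_mul]
      rcases (Nat.succ_le_of_lt hn).eq_or_lt with rfl | hn'
      · rw [hα, Nat.succ_eq_add_one]; field_simp; ring
      · rw [coeff_eq_zero_of_natDegree_lt (p := q) (by omega),
          coeff_eq_zero_of_natDegree_lt (p := P) (by omega)]; ring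
    have hq' : q = α • P + v := by rw [hv]; abel
    have hortho : polyForm 0 1 (X ^ m) P v = 0 :=
      hPo v (lt_of_le_of_lt degree_le_natDegree (by exact_mod_cast Nat.lt_succ_of_le hvd))
    have hortho' : polyForm 0 1 (X ^ m) v P = 0 := by
      rw [polyForm_apply, mul_comm v P]; exact hortho
    have hsymm : polyDerivForm 0 1 w v P = polyDerivForm 0 1 w P v := by
      rw [polyDerivForm_apply, polyDerivForm_apply, mul_comm (derivative v)]
    have hcs := LinearMap.BilinForm.apply_mul_apply_le_of_forall_zero_le
      (polyDerivForm 0 1 w) hE P v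
    rw [hsymm] at hcs
    have h1 := hP (k + 1) P hPd hP0 hPo
    have h2 := ih v hvd
    have hmq : polyForm 0 1 (X ^ m) q q =
        α ^ 2 * polyForm 0 1 (X ^ m) P P + polyForm 0 1 (X ^ m) v v := by
      rw [hq']
      simp only [map_add, map_smul, LinearMap.add_apply, LinearMap.smul_apply, smul_eq_mul,
        hortho, hortho']
      ring
    have heq : polyDerivForm 0 1 w q q = α ^ 2 * polyDerivForm 0 1 w P P +
        2 * (α * polyDerivForm 0 1 w P v) + polyDerivForm 0 1 w v v := by
      rw [hq']
      simp only [map_add, map_smul, LinearMap.add_apply, LinearMap.smul_apply, smul_eq_mul, hsymm]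
      ring
    rw [hmq, heq]
    have hMP := hM P
    have hMv := hM v
    have hEP := hE P
    have hEv := hE v
    generalize polyForm 0 1 (X ^ m) P P = MP at *
    generalize polyForm 0 1 (X ^ m) v v = Mv at *
    generalize polyDerivForm 0 1 w P P = EP at *
    generalize polyDerivForm 0 1 w v v = Ev at *
    generalize polyDerivForm 0 1 w P v = c at *
    have hs1 := hs (k + 1)
    have hSk := hSnn k
    -- Cauchy–Schwarz, then the arithmetic-geometric mean with the constants crossed: S k goes to
    -- the P part and s (k + 1) to the v part, so both parts end up with the factor S k + s (k + 1).
    have hcross : 2 * (α * c) ≤ S k * (α ^ 2 * MP) + s (k + 1) * Mv := by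
      apply le_of_abs_le
      apply abs_le_of_sq_le_sq _ (by positivity)
      have h3 : c * c ≤ (s (k + 1) * MP) * (S k * Mv) :=
        hcs.trans (mul_le_mul h1 h2 hEv (by positivity))
      have h4 := mul_le_mul_of_nonneg_left h3 (sq_nonneg α)
      nlinarith [sq_nonneg (S k * (α ^ 2 * MP) - s (k + 1) * Mv)]
    have h5 := mul_le_mul_of_nonneg_left h1 (sq_nonneg α)
    have h6 : (S k + s (k + 1)) * (α ^ 2 * MP + Mv) ≤ S (k + 1) * (α ^ 2 * MP + Mv) :=
      mul_le_mul_of_nonneg_right (hS k) (by positivity)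
    linarith

theorem inverse_inequality_unweighted {k : ℕ} {q : ℝ[X]} (hq : q.natDegree ≤ k) :
    polyDerivForm 0 1 1 q q ≤ 12 * (k : ℝ) ^ 4 * polyForm 0 1 1 q q := by
  -- This S is the exact sum of the s: S (k + 1) - S k = (k+1)(k+2)(4k+6).
  have h := inverse_inequality_of_ortho (m := 0) (w := 1) (by simp)
    (s := fun k => (k : ℝ) * (k + 1) * (4 * k + 2))
    (S := fun k => (k : ℝ) * (k + 1) ^ 2 * (k + 2)) (by simp)
    (fun k => by push_cast; nlinarith) (fun k => by positivity)
    (fun k P hP hP0 ho => by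
      simp only [polyDerivForm_apply, polyForm_apply, pow_zero]
      exact (ho.integral_derivative_sq_unweighted hP hP0).le) k q hq
  rw [pow_zero] at h
  refine h.trans (mul_le_mul_of_nonneg_right ?_
    (polyForm_self_nonneg zero_le_one (by simp) q))
  rcases Nat.eq_zero_or_pos k with rfl | hk
  · simp
  · have hk1 : (1 : ℝ) ≤ k := by exact_mod_cast hk
    have h1 : ((k : ℝ) + 1) ^ 2 ≤ (2 * k) ^ 2 := by gcongr; linarith
    calc (k : ℝ) * (k + 1) ^ 2 * (k + 2) ≤ k * (2 * k) ^ 2 * (3 * k) := by gcongr; linarith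
      _ = 12 * (k : ℝ) ^ 4 := by ring

theorem inverse_inequality_weighted {m k : ℕ} {q : ℝ[X]} (hq : q.natDegree ≤ k) :
    polyDerivForm 0 1 (X ^ (m + 1)) q q ≤
      (k : ℝ) ^ 2 * (k + m + 1) * (m + 1 + 2 * k) * polyForm 0 1 (X ^ m) q q := by
  -- Here S k = k * s k, a crude bound for the sum, since s is increasing and s 0 = 0.
  refine inverse_inequality_of_ortho (m := m) (w := X ^ (m + 1)) (eval_X_pow_nonneg le_rfl _)
    (s := fun k => (k : ℝ) * (k + m + 1) * (m + 1 + 2 * k))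
    (S := fun k => (k : ℝ) ^ 2 * (k + m + 1) * (m + 1 + 2 * k)) (by simp)
    (fun k => ?_) (fun k => by positivity)
    (fun k P hP _ ho => ?_) k q hq
  · push_cast
    have h : (k : ℝ) ^ 2 * (k + m + 1) * (m + 1 + 2 * k) ≤
        k * (k + 1) * ((k + 1) + m + 1) * (m + 1 + 2 * (k + 1)) := by
      rw [sq]; gcongr <;> linarith
    linarith
  · simp only [polyDerivForm_apply, polyForm_apply]
    exact (ho.integral_derivative_sq hP).le

/-! ### Inverse inequalities on cells -/

theorem derivative_comp_affine (q : ℝ[X]) (ℓ a : ℝ) :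
    derivative (q.comp (C ℓ * X + C a)) = C ℓ * (derivative q).comp (C ℓ * X + C a) := by
  rw [derivative_comp]
  simp

theorem natDegree_comp_affine_le (q : ℝ[X]) (ℓ a : ℝ) :
    (q.comp (C ℓ * X + C a)).natDegree ≤ q.natDegree := by
  rw [natDegree_comp]
  exact (Nat.mul_le_mul_left _ natDegree_linear_le).trans_eq (mul_one _)

theorem inverse_inequality_interval {a b : ℝ} (hab : a < b) {k : ℕ} {q : ℝ[X]}
    (hq : q.natDegree ≤ k) :
    polyDerivForm a b 1 q q ≤ 12 * (k : ℝ) ^ 4 / (b - a) ^ 2 * polyForm a b 1 q q := by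
  have hℓ : 0 < b - a := sub_pos.2 hab
  have h := inverse_inequality_unweighted ((natDegree_comp_affine_le q (b - a) a).trans hq)
  rw [polyDerivForm_apply, polyForm_apply, derivative_comp_affine] at h
  rw [polyDerivForm_apply, polyForm_apply, polyIntegral_comp_linear (a := a) (b := b),
    polyIntegral_comp_linear (a := a) (b := b)]
  simp only [one_mul, mul_comp] at h ⊢
  rw [mul_mul_mul_comm, ← C_mul, polyIntegral_C_mul] at h
  rw [div_mul_eq_mul_div, le_div_iff₀ (by positivity)]
  nlinarith

/-- Scaling to (0,1). The derivative form has one more power of x in its weight, so only 1/b is lost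
and not 1/b². -/
theorem inverse_inequality_disk {b : ℝ} (hb : 0 < b) {m k : ℕ} {q : ℝ[X]}
    (hq : q.natDegree ≤ k) :
    polyDerivForm 0 b (X ^ (m + 1)) q q ≤
      (k : ℝ) ^ 2 * (k + m + 1) * (m + 1 + 2 * k) / b * polyForm 0 b (X ^ m) q q := by
  have h := inverse_inequality_weighted (m := m) ((natDegree_comp_affine_le q b 0).trans hq)
  rw [polyDerivForm_apply, polyForm_apply, derivative_comp_affine] at h
  rw [polyDerivForm_apply, polyForm_apply, polyIntegral_comp_linear (a := 0) (b := b),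
    polyIntegral_comp_linear (a := 0) (b := b)]
  simp only [sub_zero, mul_comp, pow_comp, X_comp]
  have e1 : (C b * X + C 0 : ℝ[X]) ^ m = C (b ^ m) * X ^ m := by simp [mul_pow]
  have e2 : (C b * X + C 0 : ℝ[X]) ^ (m + 1) = C (b ^ (m + 1)) * X ^ (m + 1) := by
    rw [C_0, add_zero, mul_pow, C_pow]
  rw [e1, e2, mul_assoc (C (b ^ m)), mul_assoc (C (b ^ (m + 1))), polyIntegral_C_mul,
    polyIntegral_C_mul]
  rw [mul_mul_mul_comm, ← C_mul, mul_left_comm, polyIntegral_C_mul] at h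
  rw [div_mul_eq_mul_div, le_div_iff₀ hb]
  have := mul_le_mul_of_nonneg_left h (pow_nonneg hb.le (m + 1))
  calc _ = _ := by ring
    _ ≤ _ := this
    _ = _ := by ring

/-- Over an annulus x^m varies by a factor exponential in m, so it cannot be frozen. Instead f(r) =
r^m q(r²) is a polynomial of degree at most d in r, to which the unweighted inequality on (a, b)
applies. The identity rf' = mf + 2r^(m+2) q'(r²) recovers q', and the m² term is the price. -/
theorem inverse_inequality_annulus {a b : ℝ} (ha : 0 < a) (hab : a < b) {m d : ℕ} {q : ℝ[X]}
    (hq : m + 2 * q.natDegree ≤ d) :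
    polyDerivForm (a ^ 2) (b ^ 2) (X ^ (m + 1)) q q ≤
      (12 * (d : ℝ) ^ 4 * b / (a * (b - a) ^ 2) + (m : ℝ) ^ 2 / a ^ 2) / 2 *
        polyForm (a ^ 2) (b ^ 2) (X ^ m) q q := by
  set f : ℝ[X] := X ^ m * q.comp (X ^ 2) with hf
  have hℓ : 0 < b - a := sub_pos.2 hab
  have hfd : f.natDegree ≤ d := by
    refine natDegree_mul_le.trans (le_trans ?_ hq)
    rw [natDegree_comp, natDegree_X_pow, natDegree_X_pow, mul_comm]
  have hXf : X * derivative f = C (m : ℝ) * f + 2 * X ^ (m + 2) * (derivative q).comp (X ^ 2) := by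
    rw [hf, derivative_mul, derivative_comp, derivative_X_pow, derivative_X_pow]
    rcases m with _ | m
    · simp [map_ofNat]; ring
    · simp only [Nat.add_sub_cancel, map_natCast]; push_cast; simp; ring
  have h := inverse_inequality_interval hab hfd
  have hF : 0 ≤ polyForm a b 1 f f := polyForm_self_nonneg hab.le (by simp) f
  have h1 : polyDerivForm (a ^ 2) (b ^ 2) (X ^ (m + 1)) q q ≤
      b * polyDerivForm a b 1 f f + (m : ℝ) ^ 2 / a * polyForm a b 1 f f := by
    rw [polyDerivForm_apply, polyDerivForm_apply, polyForm_apply, polyIntegral_comp_sq,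
      ← polyIntegral_C_mul, ← polyIntegral_C_mul, ← map_add]
    refine polyIntegral_mono hab.le fun r hr => ?_
    have hr0 : 0 < r := ha.trans_le hr.1
    have he := congrArg (eval r) hXf
    simp only [eval_add, eval_mul, eval_pow, eval_X, eval_C, eval_ofNat, eval_comp,
      one_mul, mul_comp, pow_comp, X_comp] at he ⊢
    generalize eval r (derivative f) = F' at *
    generalize eval r f = F at *
    generalize eval (r ^ 2) (derivative q) = Q' at *
    have h2 : (2 * r ^ (m + 2) * Q') ^ 2 ≤ 2 * (r * F') ^ 2 + 2 * (m * F) ^ 2 := by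
      have : 2 * r ^ (m + 2) * Q' = r * F' - m * F := by linarith
      rw [this]; nlinarith [sq_nonneg (r * F' + m * F)]
    have h3 : 2 * r * ((r ^ 2) ^ (m + 1) * (Q' * Q')) = (2 * r ^ (m + 2) * Q') ^ 2 / (2 * r) := by
      field_simp; ring
    have h4 : (2 * (r * F') ^ 2 + 2 * (m * F) ^ 2) / (2 * r) = r * F' ^ 2 + m ^ 2 / r * F ^ 2 := by
      field_simp
    rw [h3]
    refine (div_le_div_of_nonneg_right h2 (by positivity)).trans ?_
    rw [h4, ← sq, ← sq]
    gcongr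
    · exact hr.2
    · exact hr.1
  have h2 : 2 * a * polyForm a b 1 f f ≤ polyForm (a ^ 2) (b ^ 2) (X ^ m) q q := by
    rw [polyForm_apply, polyForm_apply, polyIntegral_comp_sq, ← polyIntegral_C_mul]
    refine polyIntegral_mono hab.le fun r hr => ?_
    have e : eval r (2 * X * ((X ^ m * (q * q)).comp (X ^ 2))) =
        2 * (r * (f.eval r * f.eval r)) := by
      simp only [hf, eval_mul, eval_comp, eval_pow, eval_X, eval_ofNat]; ring
    rw [e]
    simp only [eval_mul, eval_C, one_mul]
    linarith [mul_le_mul_of_nonneg_right hr.1 (mul_self_nonneg (f.eval r))]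
  calc _ ≤ _ := h1
    _ ≤ b * (12 * (d : ℝ) ^ 4 / (b - a) ^ 2 * polyForm a b 1 f f) +
        (m : ℝ) ^ 2 / a * polyForm a b 1 f f := by
      have hb : 0 ≤ b := (ha.trans hab).le
      gcongr
    _ = (12 * (d : ℝ) ^ 4 * b / (a * (b - a) ^ 2) + (m : ℝ) ^ 2 / a ^ 2) / 2 *
        (2 * a * polyForm a b 1 f f) := by field_simp
    _ ≤ _ := by
      have hb : 0 ≤ b := (ha.trans hab).le
      gcongr

/-! ### Poincaré inequalities for continuous piecewise polynomials -/

theorem sum_range_sub_of_match {R L : ℕ → ℝ} {n : ℕ} (hn : n ≠ 0)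
    (h : ∀ i, i + 1 < n → R i = L (i + 1)) :
    ∑ i ∈ Finset.range n, (R i - L i) = R (n - 1) - L 0 := by
  obtain ⟨n, rfl⟩ := Nat.exists_eq_succ_of_ne_zero hn
  clear hn
  induction n with
  | zero => simp
  | succ n ih =>
    rw [Finset.sum_range_succ, ih fun i hi => h i (by omega)]
    have := h n (by omega)
    change R n - L 0 + (R (n + 1) - L (n + 1)) = R (n + 1) - L 0
    linarith

/-- The polynomials `g i` on the cells `[x i, x (i + 1)]`, `i < n`, fit together continuously and
vanish at `x n`. -/
structure ContinuousPieces (n : ℕ) (x : ℕ → ℝ) (g : ℕ → ℝ[X]) : Prop where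
  match_right : ∀ i, i + 1 < n → (g i).eval (x (i + 1)) = (g (i + 1)).eval (x (i + 1))
  last : (g (n - 1)).eval (x n) = 0

/-- Interior nodes cancel by continuity. At the left end either the weight or the function has to
vanish, which covers both the disk and the interval. -/
theorem ContinuousPieces.sum_boundary {n : ℕ} {x : ℕ → ℝ} {g : ℕ → ℝ[X]}
    (hg : ContinuousPieces n x g) (hn : n ≠ 0) (w : ℝ → ℝ)
    (h0 : w (x 0) * (g 0).eval (x 0) ^ 2 = 0) :
    ∑ i ∈ Finset.range n, (w (x (i + 1)) * (g i).eval (x (i + 1)) ^ 2 -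
      w (x i) * (g i).eval (x i) ^ 2) = 0 := by
  rw [sum_range_sub_of_match (R := fun i => w (x (i + 1)) * (g i).eval (x (i + 1)) ^ 2)
    (L := fun i => w (x i) * (g i).eval (x i) ^ 2) hn
    (fun i hi => by simp only [hg.match_right i hi])]
  rw [h0, Nat.sub_add_cancel (Nat.one_le_iff_ne_zero.2 hn), hg.last]
  simp

/-- Put u = ω tan(ωx), which solves u' = ω² + u². Then (ug²)' + g'² - ω²g² = (g' + ug)² ≥ 0. -/
theorem poincare_cell_tan {ω a b : ℝ} (hω : 0 < ω) (hω2 : ω < Real.pi / 2) (ha : -1 ≤ a)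
    (hab : a ≤ b) (hb : b ≤ 1) (g : ℝ[X]) :
    ω ^ 2 * polyForm a b 1 g g ≤ polyDerivForm a b 1 g g +
      (ω * Real.tan (ω * b) * g.eval b ^ 2 - ω * Real.tan (ω * a) * g.eval a ^ 2) := by
  have hcos : ∀ x ∈ Set.Icc a b, Real.cos (ω * x) ≠ 0 := fun x hx =>
    (Real.cos_pos_of_mem_Ioo ⟨by nlinarith [hx.1, hx.2], by nlinarith [hx.1, hx.2]⟩).ne'
  set D : ℝ → ℝ := fun x => ω * (1 / Real.cos (ω * x) ^ 2 * ω) * g.eval x ^ 2 +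
    ω * Real.tan (ω * x) * (2 * g.eval x * (derivative g).eval x) with hD
  have hder : ∀ x ∈ Set.uIcc a b,
      HasDerivAt (fun x => ω * Real.tan (ω * x) * g.eval x ^ 2) (D x) x := by
    intro x hx
    rw [Set.uIcc_of_le hab] at hx
    have h1 : HasDerivAt (fun x : ℝ => ω * x) ω x := by
      simpa using (hasDerivAt_id x).const_mul ω
    have h2 := ((Real.hasDerivAt_tan (hcos x hx)).comp x h1).const_mul ω
    have h3 := (g.hasDerivAt x).pow 2
    exact (h2.mul h3).congr_deriv (by simp [hD])
  have hDcont : ContinuousOn D (Set.Icc a b) := by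
    have htan : ContinuousOn (fun x => Real.tan (ω * x)) (Set.Icc a b) := by
      refine Real.continuousOn_tan.comp (by fun_prop) fun x hx => hcos x hx
    have hc : ContinuousOn (fun x => 1 / Real.cos (ω * x) ^ 2) (Set.Icc a b) :=
      ContinuousOn.div continuousOn_const (by fun_prop) fun x hx => pow_ne_zero 2 (hcos x hx)
    have e1 : ContinuousOn (fun x => g.eval x) (Set.Icc a b) := g.continuous.continuousOn
    have e2 : ContinuousOn (fun x => (derivative g).eval x) (Set.Icc a b) :=
      (derivative g).continuous.continuousOn
    fun_prop
  have hint : IntervalIntegrable D volume a b :=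
    ContinuousOn.intervalIntegrable (by rwa [Set.uIcc_of_le hab])
  rw [← intervalIntegral.integral_eq_sub_of_hasDerivAt hder hint]
  rw [polyForm_apply, polyDerivForm_apply, ← polyIntegral_C_mul, polyIntegral_apply,
    polyIntegral_apply, ← intervalIntegral.integral_add
      (Continuous.intervalIntegrable (Polynomial.continuous _) _ _) hint]
  refine intervalIntegral.integral_mono_on hab
    (Continuous.intervalIntegrable (Polynomial.continuous _) _ _)
    ((Continuous.intervalIntegrable (Polynomial.continuous _) _ _).add hint) fun x hx => ?_
  have hsec : 1 / Real.cos (ω * x) ^ 2 = 1 + Real.tan (ω * x) ^ 2 := by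
    rw [one_div, Real.inv_one_add_tan_sq (hcos x hx) |>.symm, inv_inv]
  simp only [hD, eval_mul, eval_C, eval_one, hsec]
  nlinarith [sq_nonneg ((derivative g).eval x + ω * Real.tan (ω * x) * g.eval x)]

theorem mem_Icc_of_nodes {n : ℕ} {x : ℕ → ℝ} (hx : ∀ i < n, x i < x (i + 1)) {i : ℕ} (hi : i ≤ n) :
    x i ∈ Set.Icc (x 0) (x n) := by
  constructor
  · induction i with
    | zero => exact le_rfl
    | succ i ih => exact (ih (by omega)).trans (hx i (by omega)).le
  · induction hi using Nat.decreasingInduction with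
    | self => exact le_rfl
    | of_succ k hk ih => exact (hx k hk).le.trans ih

theorem poincare_interval {n : ℕ} (hn : n ≠ 0) {x : ℕ → ℝ} (hx : ∀ i < n, x i < x (i + 1))
    (hx0 : x 0 = -1) (hxn : x n = 1) {g : ℕ → ℝ[X]} (hg : ContinuousPieces n x g)
    (hg0 : (g 0).eval (x 0) = 0) :
    ∑ i ∈ Finset.range n, polyForm (x i) (x (i + 1)) 1 (g i) (g i) ≤
      4 / Real.pi ^ 2 * ∑ i ∈ Finset.range n, polyDerivForm (x i) (x (i + 1)) 1 (g i) (g i) := by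
  set A := ∑ i ∈ Finset.range n, polyForm (x i) (x (i + 1)) 1 (g i) (g i)
  set B := ∑ i ∈ Finset.range n, polyDerivForm (x i) (x (i + 1)) 1 (g i) (g i)
  -- For ω below π/2 the tangent is finite at ±1, so the boundary terms are harmless; the endpoint
  -- π/2 is reached only in the limit.
  have key : ∀ ω ∈ Set.Ioo 0 (Real.pi / 2), ω ^ 2 * A ≤ B := by
    intro ω hω
    have h0 := hg.sum_boundary hn (fun y => ω * Real.tan (ω * y)) (by rw [hg0]; simp)
    rw [Finset.mul_sum, ← add_zero B, ← h0, ← Finset.sum_add_distrib]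
    refine Finset.sum_le_sum fun i hi => ?_
    have hi' := Finset.mem_range.1 hi
    exact poincare_cell_tan hω.1 hω.2 (hx0 ▸ (mem_Icc_of_nodes hx hi'.le).1) (hx i hi').le
      (hxn ▸ (mem_Icc_of_nodes hx hi').2) (g i)
  have hpi : 0 < Real.pi / 2 := by positivity
  have hlim : (Real.pi / 2) ^ 2 * A ≤ B := by
    have ht : Filter.Tendsto (fun ω : ℝ => ω ^ 2 * A) (nhdsWithin (Real.pi / 2) (Set.Iio (Real.pi / 2)))
        (nhds ((Real.pi / 2) ^ 2 * A)) :=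
      ((continuous_pow 2).mul continuous_const).continuousAt.tendsto.mono_left nhdsWithin_le_nhds
    refine le_of_tendsto ht ?_
    filter_upwards [Ioo_mem_nhdsLT hpi] with ω hω using key ω hω
  have hpi' : (Real.pi : ℝ) ≠ 0 := Real.pi_ne_zero
  calc A = 4 / Real.pi ^ 2 * ((Real.pi / 2) ^ 2 * A) := by field_simp; norm_num
    _ ≤ _ := by gcongr

/-- On (0,1), adding 2(x^(m+1) g²)' to 4x^(m+1) g'² - x^m g² gives x^(m+1)(2g' + g)² + x^m(1 - x)g²
+ 2m x^m g² ≥ 0. The weight vanishes at 0, so no condition is needed at the centre. -/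
theorem poincare_radial {n : ℕ} (hn : n ≠ 0) {x : ℕ → ℝ} (hx : ∀ i < n, x i < x (i + 1))
    (hx0 : x 0 = 0) (hxn : x n = 1) {g : ℕ → ℝ[X]} (hg : ContinuousPieces n x g) (m : ℕ) :
    ∑ i ∈ Finset.range n, polyForm (x i) (x (i + 1)) (X ^ m) (g i) (g i) ≤
      4 * ∑ i ∈ Finset.range n, polyDerivForm (x i) (x (i + 1)) (X ^ (m + 1)) (g i) (g i) := by
  have h0 := hg.sum_boundary hn (fun y => y ^ (m + 1)) (by rw [hx0]; simp)
  have hcell : ∀ i ∈ Finset.range n,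
      polyForm (x i) (x (i + 1)) (X ^ m) (g i) (g i) ≤
        4 * polyDerivForm (x i) (x (i + 1)) (X ^ (m + 1)) (g i) (g i) +
        2 * (x (i + 1) ^ (m + 1) * (g i).eval (x (i + 1)) ^ 2 -
          x i ^ (m + 1) * (g i).eval (x i) ^ 2) := by
    intro i hi
    have hi' := Finset.mem_range.1 hi
    have hd := polyIntegral_derivative (x i) (x (i + 1)) (X ^ (m + 1) * g i ^ 2)
    simp only [eval_mul, eval_pow, eval_X] at hd
    rw [← hd, polyForm_apply, polyDerivForm_apply, ← polyIntegral_C_mul, ← polyIntegral_C_mul,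
      ← map_add]
    refine polyIntegral_mono (hx i hi').le fun y hy => ?_
    have hy0 : 0 ≤ y := by
      have := (mem_Icc_of_nodes hx hi'.le).1
      rw [hx0] at this
      exact this.trans hy.1
    have hy1 : y ≤ 1 := by
      have := (mem_Icc_of_nodes hx (Nat.succ_le_of_lt hi')).2
      rw [hxn] at this
      exact hy.2.trans this
    simp only [eval_add, eval_mul, eval_C, eval_pow, eval_X, derivative_mul, derivative_X,
      eval_one, derivative_pow, Nat.add_sub_cancel, eval_natCast, map_natCast]
    push_cast
    generalize eval y (g i) = G
    generalize eval y (derivative (g i)) = G'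
    have hym : 0 ≤ y ^ m := pow_nonneg hy0 m
    have hm : (0 : ℝ) ≤ m := m.cast_nonneg
    have e1 : 0 ≤ y ^ m * (y * (2 * G' + G) ^ 2) := by positivity
    have e2 : 0 ≤ y ^ m * G ^ 2 * (1 - y) := mul_nonneg (by positivity) (by linarith)
    have e3 : 0 ≤ m * (y ^ m * G ^ 2) := by positivity
    rw [pow_succ]
    nlinarith
  calc _ ≤ _ := Finset.sum_le_sum hcell
    _ = _ := by rw [Finset.sum_add_distrib, ← Finset.mul_sum, ← Finset.mul_sum, h0]; ring

/-! ### Degrees of orthonormal polynomials -/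

/-- The projections subtracted by Gram-Schmidt have lower degree whatever their coefficients, so no
positivity of the weight is needed yet. -/
theorem monicOrtho_degree (w : ℝ → ℝ) (a b : ℝ) (n : ℕ) :
    (monicOrtho w a b n).natDegree = n ∧ (monicOrtho w a b n).Monic := by
  induction n using Nat.strong_induction_on with
  | _ n ih =>
    have hlt : (∑ k : Fin n, C (polyInner w a b (X ^ n) (monicOrtho w a b k) /
        polyInner w a b (monicOrtho w a b k) (monicOrtho w a b k)) * monicOrtho w a b k).degree
          < (n : WithBot ℕ) := by
      refine (degree_sum_le _ _).trans_lt ((Finset.sup_lt_iff (WithBot.bot_lt_coe n)).2 ?_)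
      intro k _
      rw [← smul_eq_C_mul]
      refine (degree_smul_le _ _).trans_lt ?_
      rw [degree_eq_natDegree (ih k k.2).2.ne_zero, (ih k k.2).1]
      exact Nat.cast_lt.2 k.2
    rw [monicOrtho]
    have hm := monic_X_pow_sub hlt
    exact ⟨natDegree_eq_of_degree_eq_some (by
      rw [degree_sub_eq_left_of_degree_lt (by rwa [degree_X_pow]), degree_X_pow]), hm⟩

theorem polyInner_self_pos {w : ℝ → ℝ} {a b : ℝ} (hab : a < b) (hw : Continuous w)
    (hpos : ∀ x ∈ Set.Ioo a b, 0 < w x) {p : ℝ[X]} (hp : p ≠ 0) : 0 < polyInner w a b p p := by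
  obtain ⟨x, hx, hx0⟩ : ∃ x ∈ Set.Ioo a b, p.eval x ≠ 0 := by
    by_contra! hcon
    exact hp (eq_zero_of_infinite_isRoot p
      ((Set.Ioo_infinite hab).mono fun x hx => hcon x hx))
  have hnn : ∀ y ∈ Set.Icc a b, 0 ≤ w y := by
    intro y hy
    rw [← closure_Ioo hab.ne] at hy
    exact closure_minimal (fun z hz => (hpos z hz).le) (isClosed_le continuous_const hw) hy
  refine intervalIntegral.integral_pos hab (by
      have := p.continuous
      fun_prop)
    (fun y hy => mul_nonneg (mul_self_nonneg _) (hnn y ⟨hy.1.le, hy.2⟩))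
    ⟨x, ⟨hx.1.le, hx.2.le⟩, mul_pos (mul_self_pos.2 hx0) (hpos x hx)⟩

theorem orthonormalPoly_degree {w : ℝ → ℝ} {a b : ℝ} (hab : a < b) (hw : Continuous w)
    (hpos : ∀ x ∈ Set.Ioo a b, 0 < w x) (n : ℕ) :
    (orthonormalPoly w a b n).natDegree = n ∧ orthonormalPoly w a b n ≠ 0 := by
  obtain ⟨h1, h2⟩ := monicOrtho_degree w a b n
  have hc : (Real.sqrt (polyInner w a b (monicOrtho w a b n) (monicOrtho w a b n)))⁻¹ ≠ 0 :=
    inv_ne_zero (Real.sqrt_pos.2 (polyInner_self_pos hab hw hpos h2.ne_zero)).ne'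
  exact ⟨by rw [orthonormalPoly, natDegree_C_mul hc, h1],
    mul_ne_zero (C_ne_zero.2 hc) h2.ne_zero⟩

theorem jacobi_degree (a b n : ℕ) : (jacobi a b n).natDegree = n ∧ jacobi a b n ≠ 0 :=
  orthonormalPoly_degree (by norm_num) (by fun_prop) (fun x hx => by
    have h1 : 0 < 1 - x := by linarith [hx.2]
    have h2 : 0 < 1 + x := by linarith [hx.1]
    positivity) n

theorem semiJacobi_degree {t : ℝ} (ht : 1 ≤ t) (a b c n : ℕ) :
    (semiJacobi t a b c n).natDegree = n ∧ semiJacobi t a b c n ≠ 0 :=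
  orthonormalPoly_degree (by norm_num) (by fun_prop) (fun x hx => by
    have h0 : 0 < x := hx.1
    have h1 : 0 < 1 - x := by linarith [hx.2]
    have h2 : 0 < t - x := by linarith [hx.2]
    positivity) n

theorem eval_eq_eval_zero_of_natDegree {p : ℝ[X]} (hp : p.natDegree = 0) (x : ℝ) :
    p.eval x = p.eval 0 := by
  rw [eq_C_of_natDegree_eq_zero hp]; simp

theorem eval_zero_ne_zero_of_natDegree {p : ℝ[X]} (hp : p.natDegree = 0) (h0 : p ≠ 0) :
    p.eval 0 ≠ 0 := by
  intro h
  apply h0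
  rw [eq_C_of_natDegree_eq_zero hp] at h ⊢
  simpa using h

/-- The common factor W cancels, composition with a polynomial of degree one is injective, and
polynomials of distinct degrees are independent. -/
theorem eq_zero_of_sum_smul_mul_comp {N : ℕ} {W A : ℝ[X]} (hW : W ≠ 0) (hA : A.natDegree = 1)
    {p : ℕ → ℝ[X]} (hp : ∀ l, (p l).natDegree = l ∧ p l ≠ 0) {c : Fin N → ℝ}
    (h : ∑ l : Fin N, c l • (W * (p l).comp A) = 0) : c = 0 := by
  have e : ∑ l : Fin N, c l • (W * (p l).comp A) = W * (∑ l : Fin N, c l • p l).comp A := by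
    rw [sum_comp, Finset.mul_sum]
    refine Finset.sum_congr rfl fun l _ => ?_
    rw [smul_comp, mul_smul_comm]
  rw [e] at h
  have h1 := (mul_eq_zero.1 h).resolve_left hW
  have h2 : ∑ l : Fin N, c l • p l = 0 := by
    rcases comp_eq_zero_iff.1 h1 with h2 | h2
    · exact h2
    · exfalso
      have := congrArg natDegree h2.2
      rw [hA, natDegree_C] at this
      exact one_ne_zero this
  let S : Polynomial.Sequence ℝ := ⟨p, fun i => by
    rw [degree_eq_natDegree (hp i).2, (hp i).1]⟩
  have hli : LinearIndependent ℝ (fun l : Fin N => p l) :=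
    S.linearIndependent.comp _ Fin.val_injective
  exact funext (Fintype.linearIndependent_iff.1 hli c h2)

/-! ### Hierarchical bases of continuous piecewise polynomials -/

theorem nodes_le {n : ℕ} {x : ℕ → ℝ} (hx : ∀ i < n, x i < x (i + 1)) {i j : ℕ} (hij : i ≤ j)
    (hj : j ≤ n) : x i ≤ x j := by
  induction j, hij using Nat.le_induction with
  | base => exact le_rfl
  | succ k hk ih => exact (ih (by omega)).trans (hx k (by omega)).le

/-- Two overlapping cells of a mesh are equal. -/
theorem nodes_cell_eq {n : ℕ} {x : ℕ → ℝ} (hx : ∀ i < n, x i < x (i + 1)) {i k : ℕ} (hi : i < n)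
    (hk : k < n) {y : ℝ} (hyk : y ∈ Set.Ioo (x k) (x (k + 1)))
    (hyi : y ∈ Set.Icc (x i) (x (i + 1))) : i = k := by
  rcases lt_trichotomy i k with h | h | h
  · have := nodes_le hx (Nat.succ_le_of_lt h) hk.le
    linarith [hyk.1, hyi.2]
  · exact h
  · have := nodes_le hx (Nat.succ_le_of_lt h) hi.le
    linarith [hyk.2, hyi.1]

/-- The index set of a hierarchical basis on `n` cells with `N` bubbles on each cell. -/
abbrev HierIndex (n N : ℕ) : Type := Fin (n - 1) ⊕ₗ (Fin N ×ₗ Fin n)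

/-- The restrictions to the cells of the functions of a hierarchical basis: the hat function `i` is
`H₁ i` on cell `i` and `H₂ i` on cell `i + 1`, the bubbles on cell `k` are `B k l`. -/
noncomputable def hierPiece {n N : ℕ} (H₁ H₂ : ℕ → ℝ[X]) (B : ℕ → ℕ → ℝ[X]) (s : HierIndex n N)
    (k : ℕ) : ℝ[X] :=
  match ofLex s with
  | Sum.inl i => if k = i then H₁ i else if k = i + 1 then H₂ i else 0
  | Sum.inr q => if k = (ofLex q).2 then B (ofLex q).2 (ofLex q).1 else 0

theorem hierIndex_cases {n N : ℕ} {motive : HierIndex n N → Prop}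
    (inl : ∀ i, motive (toLex (Sum.inl i)))
    (inr : ∀ l k, motive (toLex (Sum.inr (toLex (l, k))))) (s : HierIndex n N) : motive s := by
  rcases h : ofLex s with i | q
  · have : s = toLex (Sum.inl i) := by rw [← h]; rfl
    rw [this]; exact inl i
  · have : s = toLex (Sum.inr (toLex ((ofLex q).1, (ofLex q).2))) := by
      have h2 : s = toLex (Sum.inr q) := by rw [← h]; rfl
      rw [h2]; rfl
    rw [this]; exact inr _ _

theorem sum_hierIndex {n N : ℕ} {M : Type*} [AddCommMonoid M] (f : HierIndex n N → M) :
    ∑ s, f s = ∑ i, f (toLex (Sum.inl i)) +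
      ∑ l, ∑ k, f (toLex (Sum.inr (toLex (l, k)))) := by
  rw [← (toLex : Fin (n - 1) ⊕ (Fin N ×ₗ Fin n) ≃ _).sum_comp f, Fintype.sum_sum_type,
    ← (toLex : Fin N × Fin n ≃ _).sum_comp (fun q => f (toLex (Sum.inr q))),
    Fintype.sum_prod_type]

section HierPiece

variable {n N : ℕ} {H₁ H₂ : ℕ → ℝ[X]} {B : ℕ → ℕ → ℝ[X]}

theorem hierPiece_inl (i : Fin (n - 1)) (k : ℕ) :
    hierPiece (N := N) H₁ H₂ B (toLex (Sum.inl i)) k =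
      if k = i then H₁ i else if k = i + 1 then H₂ i else 0 := rfl

theorem hierPiece_inr (l : Fin N) (q : Fin n) (k : ℕ) :
    hierPiece H₁ H₂ B (toLex (Sum.inr (toLex (l, q)))) k = if k = q then B q l else 0 := rfl

/-- The hat functions are continuous and vanish outside their two cells, the bubbles vanish at the
ends of their cell (nothing is required at the first node), and the bubbles of each cell are
linearly independent. -/
structure IsHierarchical (n N : ℕ) (x : ℕ → ℝ) (H₁ H₂ : ℕ → ℝ[X]) (B : ℕ → ℕ → ℝ[X]) : Prop where
  hat_match : ∀ i, i + 1 < n → (H₁ i).eval (x (i + 1)) = (H₂ i).eval (x (i + 1))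
  hat_ne : ∀ i, i + 1 < n → (H₁ i).eval (x (i + 1)) ≠ 0
  hat_left : ∀ i, 0 < i → i + 1 < n → (H₁ i).eval (x i) = 0
  hat_right : ∀ i, i + 1 < n → (H₂ i).eval (x (i + 2)) = 0
  bubble_left : ∀ k l, 0 < k → k < n → (B k l).eval (x k) = 0
  bubble_right : ∀ k l, k < n → (B k l).eval (x (k + 1)) = 0
  bubble_indep : ∀ k, k < n → ∀ c : Fin N → ℝ, ∑ l : Fin N, c l • B k l = 0 → c = 0

variable {x : ℕ → ℝ}

theorem IsHierarchical.continuousPieces_hierPiece (h : IsHierarchical n N x H₁ H₂ B)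
    (s : HierIndex n N) : ContinuousPieces n x (hierPiece H₁ H₂ B s) := by
  induction s using hierIndex_cases with
  | inl i =>
    have hi := i.2
    constructor
    · intro k hk
      simp only [hierPiece_inl]
      rcases lt_trichotomy k i with hki | hki | hki
      · rw [if_neg (by omega), if_neg (by omega)]
        by_cases h1 : k + 1 = i
        · rw [if_pos h1, h1, h.hat_left i (by omega) (by omega)]; simp
        · rw [if_neg h1, if_neg (by omega)]
      · subst hki
        rw [if_pos rfl, if_neg (by omega), if_pos rfl]
        exact h.hat_match i hk
      · rw [if_neg (by omega), if_neg (by omega : ¬ k + 1 = (i : ℕ)),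
          if_neg (by omega : ¬ k + 1 = (i : ℕ) + 1)]
        by_cases h1 : k = i + 1
        · rw [if_pos h1, h1, h.hat_right i (by omega)]; simp
        · rw [if_neg h1]
    · rw [hierPiece_inl, if_neg (by omega)]
      by_cases h1 : n - 1 = i + 1
      · rw [if_pos h1]
        have : n = i + 2 := by omega
        have h2 := h.hat_right i (by omega)
        rwa [← this] at h2
      · rw [if_neg h1]; simp
  | inr l q =>
    have hq := q.2
    constructor
    · intro k hk
      simp only [hierPiece_inr]
      by_cases h1 : k = q
      · rw [if_pos h1, if_neg (by omega), h1, h.bubble_right q l hq]; simp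
      · rw [if_neg h1]
        by_cases h2 : k + 1 = q
        · rw [if_pos h2, h2, h.bubble_left q l (by omega) hq]; simp
        · rw [if_neg h2]
    · rw [hierPiece_inr]
      by_cases h1 : n - 1 = q
      · rw [if_pos h1]
        have : n = q + 1 := by omega
        have h2 := h.bubble_right q l hq
        rwa [← this] at h2
      · rw [if_neg h1]; simp

theorem ContinuousPieces.sum {ι : Type*} [Fintype ι] {g : ι → ℕ → ℝ[X]}
    (hg : ∀ s, ContinuousPieces n x (g s)) (v : ι → ℝ) :
    ContinuousPieces n x (∑ s, v s • g s) := by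
  constructor
  · intro i hi
    simp only [Finset.sum_apply, Pi.smul_apply, eval_finsetSum, eval_smul]
    exact Finset.sum_congr rfl fun s _ => by rw [(hg s).match_right i hi]
  · simp only [Finset.sum_apply, Pi.smul_apply, eval_finsetSum, eval_smul]
    exact Finset.sum_eq_zero fun s _ => by rw [(hg s).last]; simp

/-- At the right end of cell i only the hat function i is nonzero, so the hat coefficients vanish.
What remains on each cell is a combination of its bubbles. -/
theorem IsHierarchical.eq_zero (h : IsHierarchical n N x H₁ H₂ B) {v : HierIndex n N → ℝ}
    (hv : ∀ k < n, (∑ s, v s • hierPiece H₁ H₂ B s) k = 0) : v = 0 := by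
  have hhat : ∀ i, v (toLex (Sum.inl i)) = 0 := by
    intro i
    have hi := i.2
    have h0 := congrArg (eval (x (i + 1))) (hv i (by omega))
    rw [eval_zero, sum_hierIndex] at h0
    simp only [Pi.add_apply, Finset.sum_apply, Pi.smul_apply, eval_add, eval_finsetSum,
      eval_smul, hierPiece_inl, hierPiece_inr] at h0
    rw [Finset.sum_eq_single i, Finset.sum_eq_zero, if_pos rfl, add_zero, smul_eq_mul] at h0
    · exact (mul_eq_zero.1 h0).resolve_right (h.hat_ne i (by omega))
    · intro l _
      refine Finset.sum_eq_zero fun k _ => ?_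
      split_ifs with hik
      · rw [hik, h.bubble_right k l k.2, smul_zero]
      · simp
    · intro j _ hji
      have hj := j.2
      have hji' : (i : ℕ) ≠ j := fun e => hji (Fin.ext e.symm)
      rw [if_neg hji']
      split_ifs with hij
      · rw [hij, h.hat_right j (by omega), smul_zero]
      · simp
    · simp
  have hbub : ∀ k : Fin n, (fun l => v (toLex (Sum.inr (toLex (l, k))))) = 0 := by
    intro k
    refine h.bubble_indep k k.2 _ ?_
    have h0 := hv k k.2
    rw [sum_hierIndex] at h0
    simp only [Pi.add_apply, Finset.sum_apply, Pi.smul_apply, hierPiece_inr, hhat, zero_smul,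
      Finset.sum_const_zero, Pi.zero_apply, zero_add] at h0
    rw [← h0]
    refine Finset.sum_congr rfl fun l _ => ?_
    rw [Finset.sum_eq_single (M := ℝ[X]) k]
    · rw [if_pos rfl]
    · intro q _ hq
      rw [if_neg (fun e => hq (Fin.ext e.symm)), smul_zero]
    · simp
  funext s
  induction s using hierIndex_cases with
  | inl i => exact hhat i
  | inr l k => exact congrFun (hbub k) l

theorem natDegree_hierPiece_le {d : ℕ} (h1 : ∀ i, (H₁ i).natDegree ≤ d)
    (h2 : ∀ i, (H₂ i).natDegree ≤ d) (h3 : ∀ k l, l < N → (B k l).natDegree ≤ d)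
    (s : HierIndex n N) (k : ℕ) : (hierPiece H₁ H₂ B s k).natDegree ≤ d := by
  induction s using hierIndex_cases with
  | inl i => rw [hierPiece_inl]; split_ifs <;> simp [h1, h2]
  | inr l q =>
    rw [hierPiece_inr]
    split_ifs
    · exact h3 _ _ l.2
    · simp

theorem natDegree_sum_smul_apply_le {ι : Type*} [Fintype ι] {g : ι → ℕ → ℝ[X]} {d k : ℕ}
    (hg : ∀ s, (g s k).natDegree ≤ d) (v : ι → ℝ) : ((∑ s, v s • g s) k).natDegree ≤ d := by
  rw [Finset.sum_apply]
  exact natDegree_sum_le_of_forall_le _ _ fun s _ => (natDegree_smul_le _ _).trans (hg s)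

end HierPiece

/-- The sum over the cells of bilinear forms on the pieces. -/
noncomputable def cellSum (n : ℕ) (b : ℕ → ℝ[X] →ₗ[ℝ] ℝ[X] →ₗ[ℝ] ℝ) :
    (ℕ → ℝ[X]) →ₗ[ℝ] (ℕ → ℝ[X]) →ₗ[ℝ] ℝ :=
  ∑ k ∈ Finset.range n, (b k).compl₁₂ (LinearMap.proj k) (LinearMap.proj k)

theorem cellSum_apply (n : ℕ) (b : ℕ → ℝ[X] →ₗ[ℝ] ℝ[X] →ₗ[ℝ] ℝ) (g g' : ℕ → ℝ[X]) :
    cellSum n b g g' = ∑ k ∈ Finset.range n, b k (g k) (g' k) := by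
  simp [cellSum, LinearMap.sum_apply]

/-- A sum over the cells of positive weighted integrals vanishes only for the zero function. -/
theorem cellSum_polyForm_pos {n : ℕ} {x : ℕ → ℝ} (hx : ∀ i < n, x i < x (i + 1)) (m : ℕ)
    (hx0 : m = 0 ∨ 0 ≤ x 0) {g : ℕ → ℝ[X]} (hg : ∃ k < n, g k ≠ 0) :
    0 < cellSum n (fun k => polyForm (x k) (x (k + 1)) (X ^ m)) g g := by
  have hw : ∀ k < n, ∀ y ∈ Set.Icc (x k) (x (k + 1)), 0 ≤ (X ^ m : ℝ[X]).eval y := by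
    intro k hk
    rcases hx0 with rfl | h0
    · simp
    · exact eval_X_pow_nonneg (h0.trans (nodes_le hx (Nat.zero_le k) hk.le)) m
  rw [cellSum_apply]
  obtain ⟨k, hk, hgk⟩ := hg
  refine Finset.sum_pos' (fun i hi => ?_) ⟨k, Finset.mem_range.2 hk, ?_⟩
  · have hi' := Finset.mem_range.1 hi
    exact polyForm_self_nonneg (hx i hi').le (hw i hi') _
  · exact polyForm_self_pos (hx k hk) (pow_ne_zero m X_ne_zero) (hw k hk) hgk

/-! ### The basis of the interval -/

/-- Agreement on the open cells suffices because the nodes form a null set; this lets the derivative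
formula ignore the kinks. -/
theorem integral_eq_sum_polyIntegral {n : ℕ} {x : ℕ → ℝ} (hx : ∀ i < n, x i < x (i + 1))
    {F : ℝ → ℝ} {P : ℕ → ℝ[X]}
    (hF : ∀ i < n, ∀ y ∈ Set.Ioo (x i) (x (i + 1)), F y = (P i).eval y) :
    ∫ y in x 0..x n, F y = ∑ i ∈ Finset.range n, polyIntegral (x i) (x (i + 1)) (P i) := by
  have hae : ∀ i < n, ∀ᵐ y, y ∈ Set.uIoc (x i) (x (i + 1)) → F y = (P i).eval y := by
    intro i hi
    have h : ∀ᵐ y : ℝ, y ≠ x (i + 1) := by simp [ae_iff]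
    filter_upwards [h] with y hy hmem
    rw [Set.uIoc_of_le (hx i hi).le] at hmem
    exact hF i hi y ⟨hmem.1, lt_of_le_of_ne hmem.2 hy⟩
  rw [← intervalIntegral.sum_integral_adjacent_intervals]
  · refine Finset.sum_congr rfl fun i hi => ?_
    exact intervalIntegral.integral_congr_ae (hae i (Finset.mem_range.1 hi))
  · intro i hi
    refine IntervalIntegrable.congr_ae ((P i).continuous.intervalIntegrable _ _) ?_
    rw [Filter.EventuallyEq, ae_restrict_iff' measurableSet_uIoc]
    filter_upwards [hae i hi] with y hy hmem using (hy hmem).symm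

/-- The polynomial that equals the bubble function of the cell `[a, b]` on this cell. -/
noncomputable def lineBubblePoly (a b : ℝ) (l : ℕ) : ℝ[X] :=
  (1 - (C (2 / (b - a)) * X + C (-(a + b) / (b - a))) ^ 2) *
    (jacobi 1 1 l).comp (C (2 / (b - a)) * X + C (-(a + b) / (b - a)))

theorem lineBubblePoly_eval (a b : ℝ) (l : ℕ) (y : ℝ) :
    (lineBubblePoly a b l).eval y = (1 - ((2 * y - a - b) / (b - a)) ^ 2) *
      (jacobi 1 1 l).eval ((2 * y - a - b) / (b - a)) := by
  have e : 2 / (b - a) * y + -(a + b) / (b - a) = (2 * y - a - b) / (b - a) := by ring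
  simp only [lineBubblePoly, eval_comp, eval_mul, eval_sub, eval_one, eval_pow, eval_add, eval_C,
    eval_X, e]

theorem natDegree_lineBubblePoly_le (a b : ℝ) (l : ℕ) :
    (lineBubblePoly a b l).natDegree ≤ l + 2 := by
  refine natDegree_mul_le.trans ?_
  rw [add_comm]
  refine add_le_add ((natDegree_comp_affine_le _ _ _).trans (jacobi_degree 1 1 l).1.le) ?_
  refine (natDegree_sub_le _ _).trans (max_le (by simp) ?_)
  exact natDegree_pow_le_of_le 2 natDegree_linear_le

/-- The polynomial that equals the hat function on the cell before its peak. -/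
noncomputable def lineHatPolyLeft (x : ℕ → ℝ) (i : ℕ) : ℝ[X] :=
  C (x (i + 1) - x i)⁻¹ * (X - C (x i))

/-- The polynomial that equals the hat function on the cell after its peak. -/
noncomputable def lineHatPolyRight (x : ℕ → ℝ) (i : ℕ) : ℝ[X] :=
  C (x (i + 2) - x (i + 1))⁻¹ * (C (x (i + 2)) - X)

theorem isHierarchical_line {n N : ℕ} {x : ℕ → ℝ} (hx : ∀ i < n, x i < x (i + 1)) :
    IsHierarchical n N x (lineHatPolyLeft x) (lineHatPolyRight x)
      (fun k l => lineBubblePoly (x k) (x (k + 1)) l) where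
  hat_match i hi := by
    have h1 : x (i + 1) - x i ≠ 0 := (sub_pos.2 (hx i (by omega))).ne'
    have h2 : x (i + 2) - x (i + 1) ≠ 0 := (sub_pos.2 (hx (i + 1) hi)).ne'
    simp [lineHatPolyLeft, lineHatPolyRight, h1, h2]
  hat_ne i hi := by
    have h1 : x (i + 1) - x i ≠ 0 := (sub_pos.2 (hx i (by omega))).ne'
    simp [lineHatPolyLeft, h1]
  hat_left i _ _ := by simp [lineHatPolyLeft]
  hat_right i _ := by simp [lineHatPolyRight]
  bubble_left k l _ hk := by
    have h1 : x (k + 1) - x k ≠ 0 := (sub_pos.2 (hx k hk)).ne'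
    rw [lineBubblePoly_eval, show (2 * x k - x k - x (k + 1)) / (x (k + 1) - x k) = -1 by
      field_simp; ring]
    ring
  bubble_right k l hk := by
    have h1 : x (k + 1) - x k ≠ 0 := (sub_pos.2 (hx k hk)).ne'
    rw [lineBubblePoly_eval, show (2 * x (k + 1) - x k - x (k + 1)) / (x (k + 1) - x k) = 1 by
      field_simp; ring]
    ring
  bubble_indep k hk c hc := by
    have h1 : x (k + 1) - x k ≠ 0 := (sub_pos.2 (hx k hk)).ne'
    refine eq_zero_of_sum_smul_mul_comp ?_ (natDegree_linear (div_ne_zero two_ne_zero h1))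
      (jacobi_degree 1 1) hc
    intro h
    have h2 := congrArg (eval ((x k + x (k + 1)) / 2)) h
    have e : 2 / (x (k + 1) - x k) * ((x k + x (k + 1)) / 2) +
        -(x k + x (k + 1)) / (x (k + 1) - x k) = 0 := by ring
    simp only [eval_sub, eval_one, eval_pow, eval_add, eval_mul, eval_C, eval_X, e, eval_zero] at h2
    norm_num at h2

namespace CylinderMesh

variable (T : CylinderMesh)

theorem nz_ne_zero : T.nz ≠ 0 := by
  intro h
  have h1 := T.ζ_last
  rw [h, T.ζ_zero] at h1
  norm_num at h1

theorem nr_ne_zero : T.nr ≠ 0 := by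
  intro h
  have h1 := T.ρ_last
  rw [h, T.ρ_zero] at h1
  norm_num at h1

/-- The restrictions to the cells of the functions of the basis of the interval. -/
noncomputable def linePiece (p : ℕ) (s : T.LineIndex p) : ℕ → ℝ[X] :=
  hierPiece (lineHatPolyLeft T.ζ) (lineHatPolyRight T.ζ)
    (fun k l => lineBubblePoly (T.ζ k) (T.ζ (k + 1)) l) s

theorem lineBasis_eq_linePiece (p : ℕ) (s : T.LineIndex p) {k : ℕ} (hk : k < T.nz) {y : ℝ}
    (hy : y ∈ Set.Ioo (T.ζ k) (T.ζ (k + 1))) :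
    T.lineBasis p s y = (T.linePiece p s k).eval y := by
  have hcell : ∀ i < T.nz, (T.ζ i ≤ y ∧ y ≤ T.ζ (i + 1)) ↔ k = i := fun i hi =>
    ⟨fun h => (nodes_cell_eq T.ζ_lt hi hk hy h).symm, fun h => h ▸ ⟨hy.1.le, hy.2.le⟩⟩
  induction s using hierIndex_cases with
  | inl i =>
    have hi := i.2
    rw [linePiece, hierPiece_inl]
    change lineHat _ _ _ y = _
    have hlt : (T.ζ (i + 1) < y ∧ y ≤ T.ζ (i + 2)) ↔ k = i + 1 :=
      ⟨fun h => (hcell (i + 1) (by omega)).1 ⟨h.1.le, h.2⟩, fun h => by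
        subst h; exact ⟨hy.1, hy.2.le⟩⟩
    simp only [lineHat, hcell i (by omega), hlt]
    split_ifs
    · simp [lineHatPolyLeft, div_eq_inv_mul]
    · simp [lineHatPolyRight, div_eq_inv_mul]
    · simp
  | inr l q =>
    rw [linePiece, hierPiece_inr]
    change lineBubble (T.ζ q) (T.ζ (q + 1)) l y = _
    simp only [lineBubble, hcell q q.2]
    split_ifs
    · exact (lineBubblePoly_eval _ _ _ _).symm
    · simp

theorem deriv_lineBasis_eq_linePiece (p : ℕ) (s : T.LineIndex p) {k : ℕ} (hk : k < T.nz) {y : ℝ}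
    (hy : y ∈ Set.Ioo (T.ζ k) (T.ζ (k + 1))) :
    deriv (T.lineBasis p s) y = (derivative (T.linePiece p s k)).eval y := by
  have h : T.lineBasis p s =ᶠ[nhds y] fun y => (T.linePiece p s k).eval y := by
    filter_upwards [Ioo_mem_nhds hy.1 hy.2] with z hz using T.lineBasis_eq_linePiece p s hk hz
  rw [h.deriv_eq, Polynomial.deriv]

theorem lineMass_eq (p : ℕ) : T.lineMass p = Matrix.of fun s s' =>
    cellSum T.nz (fun k => polyForm (T.ζ k) (T.ζ (k + 1)) 1)
      (T.linePiece p s) (T.linePiece p s') := by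
  ext s s'
  rw [lineMass, Matrix.of_apply, Matrix.of_apply, cellSum_apply, ← T.ζ_zero, ← T.ζ_last]
  simp only [polyForm_apply]
  refine integral_eq_sum_polyIntegral T.ζ_lt fun i hi y hy => ?_
  rw [T.lineBasis_eq_linePiece p s hi hy, T.lineBasis_eq_linePiece p s' hi hy]
  simp

theorem lineStiffness_eq (p : ℕ) : T.lineStiffness p = Matrix.of fun s s' =>
    cellSum T.nz (fun k => polyDerivForm (T.ζ k) (T.ζ (k + 1)) 1)
      (T.linePiece p s) (T.linePiece p s') := by
  ext s s'
  rw [lineStiffness, Matrix.of_apply, Matrix.of_apply, cellSum_apply, ← T.ζ_zero, ← T.ζ_last]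
  simp only [polyDerivForm_apply]
  refine integral_eq_sum_polyIntegral T.ζ_lt fun i hi y hy => ?_
  rw [T.deriv_lineBasis_eq_linePiece p s hi hy, T.deriv_lineBasis_eq_linePiece p s' hi hy]
  simp

/-- `ContinuousPieces` imposes nothing at the first node, as functions on the disk need not vanish
at the centre. The interval needs this condition separately, since tan(ωx) does not vanish at -1. -/
theorem linePiece_first (p : ℕ) (s : T.LineIndex p) :
    (T.linePiece p s 0).eval (T.ζ 0) = 0 := by
  induction s using hierIndex_cases with
  | inl i =>
    rw [linePiece, hierPiece_inl]
    by_cases h1 : 0 = (i : ℕ)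
    · rw [if_pos h1, ← h1]; simp [lineHatPolyLeft]
    · rw [if_neg h1, if_neg (by omega), eval_zero]
  | inr l q =>
    rw [linePiece, hierPiece_inr]
    split_ifs with h1
    · have h2 := sub_pos.2 (T.ζ_lt 0 (Nat.pos_of_ne_zero T.nz_ne_zero))
      rw [← h1, lineBubblePoly_eval, show (2 * T.ζ 0 - T.ζ 0 - T.ζ (0 + 1)) /
        (T.ζ (0 + 1) - T.ζ 0) = -1 by field_simp; ring]
      ring
    · simp

theorem natDegree_linePiece_le {p : ℕ} (hp : 1 ≤ p) (s : T.LineIndex p) (k : ℕ) :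
    (T.linePiece p s k).natDegree ≤ p := by
  refine natDegree_hierPiece_le (fun i => ?_) (fun i => ?_) (fun k l hl => ?_) s k
  · exact (natDegree_C_mul_le _ _).trans ((natDegree_X_sub_C_le _).trans hp)
  · refine (natDegree_C_mul_le _ _).trans (le_trans ?_ hp)
    rw [← neg_sub, natDegree_neg]
    exact natDegree_X_sub_C_le _
  · exact (natDegree_lineBubblePoly_le _ _ _).trans (by omega)

/-! ### Mesh size and spectral bounds on the interval -/

theorem size_le_ρ {i : ℕ} (hi : i < T.nr) : T.size ≤ T.ρ (i + 1) - T.ρ i :=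
  (min_le_left _ _).trans (ciInf_le (Set.finite_range _).bddBelow (⟨i, hi⟩ : Fin T.nr))

theorem size_le_ζ {k : ℕ} (hk : k < T.nz) : T.size ≤ T.ζ (k + 1) - T.ζ k :=
  (min_le_right _ _).trans (ciInf_le (Set.finite_range _).bddBelow (⟨k, hk⟩ : Fin T.nz))

theorem size_pos : 0 < T.size := by
  -- Nonemptiness matters: the real infimum of an empty family is 0 by default.
  have : Nonempty (Fin T.nr) := ⟨⟨0, Nat.pos_of_ne_zero T.nr_ne_zero⟩⟩
  have : Nonempty (Fin T.nz) := ⟨⟨0, Nat.pos_of_ne_zero T.nz_ne_zero⟩⟩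
  refine lt_min ?_ ?_
  · obtain ⟨i, hi⟩ := exists_eq_ciInf_of_finite
      (f := fun i : Fin T.nr => T.ρ (i + 1) - T.ρ i)
    rw [← hi]
    exact sub_pos.2 (T.ρ_lt i i.2)
  · obtain ⟨i, hi⟩ := exists_eq_ciInf_of_finite
      (f := fun i : Fin T.nz => T.ζ (i + 1) - T.ζ i)
    rw [← hi]
    exact sub_pos.2 (T.ζ_lt i i.2)

theorem numCells_pos : (0 : ℝ) < T.numCells :=
  Nat.cast_pos.2 (Nat.mul_pos (Nat.pos_of_ne_zero T.nr_ne_zero) (Nat.pos_of_ne_zero T.nz_ne_zero))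

/-- Poincaré inequality for the basis of the interval. -/
theorem lineMass_le (p : ℕ) (v : T.LineIndex p → ℝ) :
    v ⬝ᵥ T.lineMass p *ᵥ v ≤ 4 / Real.pi ^ 2 * (v ⬝ᵥ T.lineStiffness p *ᵥ v) := by
  rw [lineMass_eq, lineStiffness_eq, dotProduct_gram_mulVec, dotProduct_gram_mulVec,
    cellSum_apply, cellSum_apply]
  refine poincare_interval T.nz_ne_zero T.ζ_lt T.ζ_zero T.ζ_last
    (ContinuousPieces.sum (fun s =>
      (isHierarchical_line T.ζ_lt).continuousPieces_hierPiece s) v) ?_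
  simp only [Finset.sum_apply, Pi.smul_apply, eval_finsetSum, eval_smul]
  exact Finset.sum_eq_zero fun s _ => by rw [T.linePiece_first p s, smul_zero]

/-- Inverse inequality for the basis of the interval. -/
theorem lineStiffness_le {p : ℕ} (hp : 1 ≤ p) (v : T.LineIndex p → ℝ) :
    v ⬝ᵥ T.lineStiffness p *ᵥ v ≤
      12 * (p : ℝ) ^ 4 / T.size ^ 2 * (v ⬝ᵥ T.lineMass p *ᵥ v) := by
  rw [lineMass_eq, lineStiffness_eq, dotProduct_gram_mulVec, dotProduct_gram_mulVec,
    cellSum_apply, cellSum_apply, Finset.mul_sum]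
  refine Finset.sum_le_sum fun k hk => ?_
  have hk' := Finset.mem_range.1 hk
  refine (inverse_inequality_interval (T.ζ_lt k hk')
    (natDegree_sum_smul_apply_le (fun s => T.natDegree_linePiece_le hp s k) v)).trans ?_
  refine mul_le_mul_of_nonneg_right ?_ (polyForm_self_nonneg (T.ζ_lt k hk').le (by simp) _)
  have := T.size_pos
  have := T.size_le_ζ hk'
  gcongr

theorem lineMass_pos (p : ℕ) {v : T.LineIndex p → ℝ} (hv : v ≠ 0) :
    0 < v ⬝ᵥ T.lineMass p *ᵥ v := by
  rw [lineMass_eq, dotProduct_gram_mulVec]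
  have h := cellSum_polyForm_pos T.ζ_lt 0 (Or.inl rfl) (g := ∑ s, v s • T.linePiece p s) (by
    by_contra! hcon
    exact hv ((isHierarchical_line T.ζ_lt).eq_zero hcon))
  simpa only [pow_zero] using h

/-- The mass form is positive by linear independence, and the Poincaré inequality bounds it by the
stiffness form. -/
theorem lineStiffness_posDef (p : ℕ) : (T.lineStiffness p).PosDef := by
  refine Matrix.PosDef.of_dotProduct_mulVec_pos ?_ fun v hv => ?_
  · ext s s'
    simp [lineStiffness, mul_comm]
  · rw [star_trivial]
    have h1 := T.lineMass_pos p hv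
    have h2 := T.lineMass_le p v
    exact (mul_pos_iff_of_pos_left (by positivity)).1 (h1.trans_le h2)

theorem spectrum_line {θ : ℝ} (hh : θ * (T.size ^ 2)⁻¹ ≤ (T.numCells : ℝ))
    (hθ : 0 < θ) {p : ℕ} (hp : 1 ≤ p) {L : Matrix (T.LineIndex p) (T.LineIndex p) ℝ}
    (hL : IsReverseCholesky (T.lineStiffness p) L) :
    spectrum ℝ (L⁻¹ᵀ * T.lineMass p * L⁻¹) ⊆
      Set.Icc (θ / (12 * (T.numCells : ℝ) * (p : ℝ) ^ 4)) (4 / Real.pi ^ 2) := by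
  refine hL.spectrum_subset (fun v => ?_) (T.lineMass_le p)
  have hN := T.numCells_pos
  have hp0 : (0 : ℝ) < p := by exact_mod_cast hp
  have hs := T.size_pos
  have hM : 0 ≤ v ⬝ᵥ T.lineMass p *ᵥ v := by
    by_cases hv : v = 0
    · simp [hv]
    · exact (T.lineMass_pos p hv).le
  have h1 := T.lineStiffness_le hp v
  calc _ ≤ θ / (12 * (T.numCells : ℝ) * (p : ℝ) ^ 4) *
        (12 * (p : ℝ) ^ 4 / T.size ^ 2 * (v ⬝ᵥ T.lineMass p *ᵥ v)) := by gcongr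
    _ = θ * (T.size ^ 2)⁻¹ * (T.numCells : ℝ)⁻¹ * (v ⬝ᵥ T.lineMass p *ᵥ v) := by field_simp
    _ ≤ (T.numCells : ℝ) * (T.numCells : ℝ)⁻¹ * (v ⬝ᵥ T.lineMass p *ᵥ v) := by gcongr
    _ = _ := by rw [mul_inv_cancel₀ hN.ne', one_mul]

end CylinderMesh

/-! ### The radial polynomials of the disk basis

On each cell, every function of the basis of the mode `(m, j)` is the product of `Y_{m,j}` and a
polynomial in `r ^ 2`. -/

theorem harmonicY_div_ofReal (m : ℕ) (j : Fin 2) (z : ℂ) (ρ : ℝ) :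
    harmonicY m j (z / ρ) = (ρ ^ m)⁻¹ * harmonicY m j z := by
  have h : (z / (ρ : ℂ)) ^ m = (((ρ ^ m)⁻¹ : ℝ) : ℂ) * z ^ m := by
    push_cast
    rw [div_pow, div_eq_inv_mul]
  simp only [harmonicY, h, Complex.re_ofReal_mul, Complex.im_ofReal_mul]
  split_ifs <;> rfl

theorem norm_div_ofReal {ρ : ℝ} (hρ : 0 < ρ) (z : ℂ) : ‖z / (ρ : ℂ)‖ = ‖z‖ / ρ := by
  rw [norm_div, Complex.norm_real, Real.norm_of_nonneg hρ.le]

/-- The polynomial `1 - x / ρ ^ 2`. -/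
noncomputable def outerFactor (ρ : ℝ) : ℝ[X] := C (-(ρ ^ 2)⁻¹) * X + C 1

/-- The polynomial `(x - ρ₁ ^ 2) / ρ₂ ^ 2`. -/
noncomputable def innerFactor (ρ₁ ρ₂ : ℝ) : ℝ[X] := C (ρ₂ ^ 2)⁻¹ * X + C (-(ρ₁ / ρ₂) ^ 2)

theorem outerFactor_eval (ρ y : ℝ) : (outerFactor ρ).eval (y ^ 2) = 1 - (y / ρ) ^ 2 := by
  simp [outerFactor]; ring

theorem innerFactor_eval (ρ₁ ρ₂ y : ℝ) :
    (innerFactor ρ₁ ρ₂).eval (y ^ 2) = (y / ρ₂) ^ 2 - (ρ₁ / ρ₂) ^ 2 := by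
  simp only [innerFactor, eval_add, eval_mul, eval_C, eval_X]; ring

theorem natDegree_outerFactor_le (ρ : ℝ) : (outerFactor ρ).natDegree ≤ 1 := natDegree_linear_le

theorem natDegree_innerFactor_le (ρ₁ ρ₂ : ℝ) : (innerFactor ρ₁ ρ₂).natDegree ≤ 1 :=
  natDegree_linear_le

theorem outerFactor_ne_zero (ρ : ℝ) : outerFactor ρ ≠ 0 := by
  intro h
  have := congrArg (eval 0) h
  simp [outerFactor] at this

theorem innerFactor_ne_zero (ρ₁ : ℝ) {ρ₂ : ℝ} (hρ : ρ₂ ≠ 0) : innerFactor ρ₁ ρ₂ ≠ 0 := by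
  intro h
  have := congrArg natDegree h
  rw [innerFactor, natDegree_linear (by positivity)] at this
  simp at this

theorem one_sub_div_sq_pos {ρ₁ ρ₂ : ℝ} (h0 : 0 ≤ ρ₁) (h : ρ₁ < ρ₂) : 0 < 1 - (ρ₁ / ρ₂) ^ 2 := by
  have h1 : ρ₁ / ρ₂ < 1 := (div_lt_one (h0.trans_lt h)).2 h
  have h2 : 0 ≤ ρ₁ / ρ₂ := div_nonneg h0 (h0.trans h.le)
  nlinarith

theorem one_le_inv_one_sub_div_sq {ρ₁ ρ₂ : ℝ} (h0 : 0 ≤ ρ₁) (h : ρ₁ < ρ₂) :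
    1 ≤ (1 - (ρ₁ / ρ₂) ^ 2)⁻¹ :=
  (one_le_inv₀ (one_sub_div_sq_pos h0 h)).2 (by linarith [sq_nonneg (ρ₁ / ρ₂)])

theorem annulusConst_ne_zero {ρ₁ ρ₂ : ℝ} (h0 : 0 ≤ ρ₁) (h : ρ₁ < ρ₂) (a b m : ℕ) :
    annulusConst ρ₁ ρ₂ a b m ≠ 0 :=
  have hd := semiJacobi_degree (one_le_inv_one_sub_div_sq h0 h) a b m 0
  eval_zero_ne_zero_of_natDegree hd.1 hd.2

/-- The polynomial factor of degree `k` of a bubble function, in the variable `x = r ^ 2`. -/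
noncomputable def bubbleCore (ρ₁ ρ₂ : ℝ) (m k : ℕ) : ℝ[X] :=
  if ρ₁ = 0 then jacobi 1 m k else semiJacobi (1 - (ρ₁ / ρ₂) ^ 2)⁻¹ 1 1 m k

/-- The affine change of variable in the polynomial factor of a bubble function. -/
noncomputable def bubbleArg (ρ₁ ρ₂ : ℝ) : ℝ[X] :=
  if ρ₁ = 0 then C (2 * (ρ₂ ^ 2)⁻¹) * X + C (-1)
  else C (-(ρ₂ ^ 2)⁻¹ / (1 - (ρ₁ / ρ₂) ^ 2)) * X + C (1 / (1 - (ρ₁ / ρ₂) ^ 2))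

/-- The factor of a bubble function that vanishes at the ends of the cell. -/
noncomputable def bubbleWeight (ρ₁ ρ₂ : ℝ) (m : ℕ) : ℝ[X] :=
  C (ρ₂ ^ m)⁻¹ * if ρ₁ = 0 then outerFactor ρ₂ else outerFactor ρ₂ * innerFactor ρ₁ ρ₂

/-- The bubble function of a cell, divided by `Y_{m,j}`, as a polynomial in `r ^ 2`. -/
noncomputable def bubblePoly (ρ₁ ρ₂ : ℝ) (m k : ℕ) : ℝ[X] :=
  bubbleWeight ρ₁ ρ₂ m * (bubbleCore ρ₁ ρ₂ m k).comp (bubbleArg ρ₁ ρ₂)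

/-- The hat function on the inner cell, divided by `Y_{m,j}`, as a polynomial in `r ^ 2`. -/
noncomputable def hatPolyInner (ρ₁ ρ₂ ρ₃ : ℝ) (m : ℕ) : ℝ[X] :=
  if ρ₁ = 0 then C (hatCoeff ρ₁ ρ₂ ρ₃ m * (ρ₂ ^ m)⁻¹ * (jacobi 0 m 0).eval 0)
  else C (hatCoeff ρ₁ ρ₂ ρ₃ m * (ρ₂ ^ m)⁻¹ * annulusConst ρ₁ ρ₂ 0 1 m) * innerFactor ρ₁ ρ₂

/-- The hat function on the outer cell, divided by `Y_{m,j}`, as a polynomial in `r ^ 2`. -/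
noncomputable def hatPolyOuter (ρ₂ ρ₃ : ℝ) (m : ℕ) : ℝ[X] :=
  C ((ρ₃ ^ m)⁻¹ * annulusConst ρ₂ ρ₃ 1 0 m) * outerFactor ρ₃

theorem bubble_eq {ρ₁ ρ₂ : ℝ} (hρ : 0 < ρ₂) (m k : ℕ) (j : Fin 2) (z : ℂ) :
    bubble ρ₁ ρ₂ k m j z = if ρ₁ ≤ ‖z‖ ∧ ‖z‖ ≤ ρ₂ then
      harmonicY m j z * (bubblePoly ρ₁ ρ₂ m k).eval (‖z‖ ^ 2) else 0 := by
  unfold bubble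
  congr 1
  simp only [zernike, zernikeAnnular, norm_div_ofReal hρ, harmonicY_div_ofReal, bubblePoly,
    bubbleWeight, bubbleCore, bubbleArg]
  split_ifs
  · simp only [eval_mul, eval_comp, eval_add, eval_C, eval_X, outerFactor_eval]
    rw [show 2 * (ρ₂ ^ 2)⁻¹ * ‖z‖ ^ 2 + -1 = 2 * (‖z‖ / ρ₂) ^ 2 - 1 by ring]
    ring
  · simp only [eval_mul, eval_comp, eval_add, eval_C, eval_X, outerFactor_eval, innerFactor_eval]
    rw [show -(ρ₂ ^ 2)⁻¹ / (1 - (ρ₁ / ρ₂) ^ 2) * ‖z‖ ^ 2 + 1 / (1 - (ρ₁ / ρ₂) ^ 2) =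
      (1 - (‖z‖ / ρ₂) ^ 2) / (1 - (ρ₁ / ρ₂) ^ 2) by ring]
    ring

theorem hat_eq {ρ₁ ρ₂ ρ₃ : ℝ} (h1 : 0 ≤ ρ₁) (h12 : ρ₁ < ρ₂) (h23 : ρ₂ < ρ₃) (m : ℕ) (j : Fin 2)
    (z : ℂ) :
    hat ρ₁ ρ₂ ρ₃ m j z = if ρ₁ ≤ ‖z‖ ∧ ‖z‖ ≤ ρ₂ then
        harmonicY m j z * (hatPolyInner ρ₁ ρ₂ ρ₃ m).eval (‖z‖ ^ 2)
      else if ρ₂ < ‖z‖ ∧ ‖z‖ ≤ ρ₃ then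
        harmonicY m j z * (hatPolyOuter ρ₂ ρ₃ m).eval (‖z‖ ^ 2)
      else 0 := by
  have h2 : 0 < ρ₂ := h1.trans_lt h12
  have h3 : 0 < ρ₃ := h2.trans h23
  unfold hat
  congr 1
  · simp only [zernike, zernikeAnnular, norm_div_ofReal h2, harmonicY_div_ofReal, hatPolyInner]
    split_ifs
    · rw [eval_eq_eval_zero_of_natDegree (jacobi_degree 0 m 0).1, eval_C]
      ring
    · rw [eval_eq_eval_zero_of_natDegree
        (semiJacobi_degree (one_le_inv_one_sub_div_sq h1 h12) 0 1 m 0).1, eval_mul, eval_C,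
        innerFactor_eval, annulusConst]
      ring
  · congr 1
    simp only [zernikeAnnular, norm_div_ofReal h3, harmonicY_div_ofReal, hatPolyOuter]
    rw [eval_eq_eval_zero_of_natDegree
        (semiJacobi_degree (one_le_inv_one_sub_div_sq h2.le h23) 1 0 m 0).1, eval_mul, eval_C,
        outerFactor_eval, annulusConst]
    ring

theorem hatPolyOuter_eval_ne_zero {ρ₂ ρ₃ : ℝ} (h2 : 0 ≤ ρ₂) (h23 : ρ₂ < ρ₃) (m : ℕ) :
    (hatPolyOuter ρ₂ ρ₃ m).eval (ρ₂ ^ 2) ≠ 0 := by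
  rw [hatPolyOuter, eval_mul, eval_C, outerFactor_eval]
  have h3 : 0 < ρ₃ := h2.trans_lt h23
  exact mul_ne_zero (mul_ne_zero (by positivity) (annulusConst_ne_zero h2 h23 _ _ _))
    (one_sub_div_sq_pos h2 h23).ne'

/-- The normalizing constant of the inner cell cancels against the denominator in `hatCoeff`, which
requires it to be nonzero. -/
theorem hatPoly_match {ρ₁ ρ₂ ρ₃ : ℝ} (h1 : 0 ≤ ρ₁) (h12 : ρ₁ < ρ₂) (h23 : ρ₂ < ρ₃) (m : ℕ) :
    (hatPolyInner ρ₁ ρ₂ ρ₃ m).eval (ρ₂ ^ 2) = (hatPolyOuter ρ₂ ρ₃ m).eval (ρ₂ ^ 2) := by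
  have h2 : 0 < ρ₂ := h1.trans_lt h12
  have h3 : 0 < ρ₃ := h2.trans h23
  rw [hatPolyOuter, eval_mul, eval_C, outerFactor_eval, hatPolyInner, hatCoeff]
  split_ifs
  · have hj := eval_zero_ne_zero_of_natDegree (jacobi_degree 0 m 0).1 (jacobi_degree 0 m 0).2
    rw [eval_C, div_pow ρ₂ ρ₃ m]
    field_simp
  · have hc := annulusConst_ne_zero h1 h12 0 1 m
    have hp := (one_sub_div_sq_pos h1 h12).ne'
    rw [eval_mul, eval_C, innerFactor_eval, div_self h2.ne', one_pow, div_pow ρ₂ ρ₃ m]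
    generalize 1 - (ρ₁ / ρ₂) ^ 2 = w at *
    field_simp

theorem bubbleCore_degree {ρ₁ ρ₂ : ℝ} (h1 : 0 ≤ ρ₁) (h12 : ρ₁ < ρ₂) (m k : ℕ) :
    (bubbleCore ρ₁ ρ₂ m k).natDegree = k ∧ bubbleCore ρ₁ ρ₂ m k ≠ 0 := by
  unfold bubbleCore
  split_ifs
  · exact jacobi_degree 1 m k
  · exact semiJacobi_degree (one_le_inv_one_sub_div_sq h1 h12) 1 1 m k

theorem natDegree_bubbleArg {ρ₁ ρ₂ : ℝ} (h1 : 0 ≤ ρ₁) (h12 : ρ₁ < ρ₂) :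
    (bubbleArg ρ₁ ρ₂).natDegree = 1 := by
  have h2 : 0 < ρ₂ := h1.trans_lt h12
  unfold bubbleArg
  split_ifs
  · exact natDegree_linear (by positivity)
  · exact natDegree_linear (div_ne_zero (neg_ne_zero.2 (by positivity))
      (one_sub_div_sq_pos h1 h12).ne')

theorem bubbleWeight_ne_zero {ρ₁ ρ₂ : ℝ} (h2 : 0 < ρ₂) (m : ℕ) : bubbleWeight ρ₁ ρ₂ m ≠ 0 := by
  unfold bubbleWeight
  refine mul_ne_zero (C_ne_zero.2 (by positivity)) ?_
  split_ifs
  · exact outerFactor_ne_zero ρ₂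
  · exact mul_ne_zero (outerFactor_ne_zero ρ₂) (innerFactor_ne_zero ρ₁ h2.ne')

theorem natDegree_bubblePoly_le {ρ₁ ρ₂ : ℝ} (h1 : 0 ≤ ρ₁) (h12 : ρ₁ < ρ₂) (m k : ℕ) :
    (bubblePoly ρ₁ ρ₂ m k).natDegree ≤ k + if ρ₁ = 0 then 1 else 2 := by
  rw [bubblePoly]
  refine natDegree_mul_le.trans ?_
  rw [natDegree_comp, natDegree_bubbleArg h1 h12, (bubbleCore_degree h1 h12 m k).1, mul_one,
    add_comm]
  refine Nat.add_le_add_left ?_ _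
  refine (natDegree_C_mul_le _ _).trans ?_
  split_ifs
  · exact natDegree_outerFactor_le ρ₂
  · exact natDegree_mul_le.trans
      (add_le_add (natDegree_outerFactor_le ρ₂) (natDegree_innerFactor_le ρ₁ ρ₂))

theorem bubblePoly_eval_outer {ρ₁ ρ₂ : ℝ} (h2 : 0 < ρ₂) (m k : ℕ) :
    (bubblePoly ρ₁ ρ₂ m k).eval (ρ₂ ^ 2) = 0 := by
  have h : (outerFactor ρ₂).eval (ρ₂ ^ 2) = 0 := by
    rw [outerFactor_eval, div_self h2.ne']; ring
  rw [bubblePoly, bubbleWeight]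
  split_ifs <;> simp [h]

theorem bubblePoly_eval_inner {ρ₁ ρ₂ : ℝ} (h1 : ρ₁ ≠ 0) (m k : ℕ) :
    (bubblePoly ρ₁ ρ₂ m k).eval (ρ₁ ^ 2) = 0 := by
  have h : (innerFactor ρ₁ ρ₂).eval (ρ₁ ^ 2) = 0 := by
    rw [innerFactor_eval]; ring
  rw [bubblePoly, bubbleWeight, if_neg h1]
  simp [h]

namespace CylinderMesh

variable (T : CylinderMesh)

theorem ρ_nonneg {i : ℕ} (hi : i ≤ T.nr) : 0 ≤ T.ρ i :=
  T.ρ_zero ▸ nodes_le T.ρ_lt (Nat.zero_le i) hi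

theorem ρ_pos {i : ℕ} (hi0 : 0 < i) (hi : i ≤ T.nr) : 0 < T.ρ i := by
  obtain ⟨i, rfl⟩ := Nat.exists_eq_succ_of_ne_zero hi0.ne'
  exact (T.ρ_nonneg (by omega)).trans_lt (T.ρ_lt i hi)

theorem ρ_sq_lt : ∀ i < T.nr, T.ρ i ^ 2 < T.ρ (i + 1) ^ 2 := fun i hi =>
  pow_lt_pow_left₀ (T.ρ_lt i hi) (T.ρ_nonneg hi.le) two_ne_zero

/-- In the variable x = r² the nodes are the squared radii. The conditions on the left end are
required only away from the centre, where the cell is an annulus. -/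
theorem isHierarchical_disk (N m : ℕ) :
    IsHierarchical T.nr N (fun i => T.ρ i ^ 2)
      (fun i => hatPolyInner (T.ρ i) (T.ρ (i + 1)) (T.ρ (i + 2)) m)
      (fun i => hatPolyOuter (T.ρ (i + 1)) (T.ρ (i + 2)) m)
      (fun k l => bubblePoly (T.ρ k) (T.ρ (k + 1)) m l) where
  hat_match i hi := hatPoly_match (T.ρ_nonneg (by omega)) (T.ρ_lt i (by omega)) (T.ρ_lt _ hi) m
  hat_ne i hi := by
    rw [hatPoly_match (T.ρ_nonneg (by omega)) (T.ρ_lt i (by omega)) (T.ρ_lt _ hi) m]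
    exact hatPolyOuter_eval_ne_zero (T.ρ_nonneg (by omega)) (T.ρ_lt _ hi) m
  hat_left i hi0 hi := by
    rw [hatPolyInner, if_neg (T.ρ_pos hi0 (by omega)).ne', eval_mul, innerFactor_eval]
    ring
  hat_right i hi := by
    rw [hatPolyOuter, eval_mul, outerFactor_eval, div_self (T.ρ_pos (by omega) (by omega)).ne']
    ring
  bubble_left k l hk0 hk := bubblePoly_eval_inner (T.ρ_pos hk0 hk.le).ne' m l
  bubble_right k l hk := bubblePoly_eval_outer (T.ρ_pos k.succ_pos hk) m l
  bubble_indep k hk c hc :=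
    eq_zero_of_sum_smul_mul_comp (bubbleWeight_ne_zero (T.ρ_pos k.succ_pos hk) m)
      (natDegree_bubbleArg (T.ρ_nonneg hk.le) (T.ρ_lt k hk))
      (bubbleCore_degree (T.ρ_nonneg hk.le) (T.ρ_lt k hk) m) hc

/-- The functions of the disk basis on the cells, divided by `Y_{m,j}`, as polynomials
in `r ^ 2`. -/
noncomputable def diskPiece (p m : ℕ) (s : T.DiskIndex p m) : ℕ → ℝ[X] :=
  hierPiece (fun i => hatPolyInner (T.ρ i) (T.ρ (i + 1)) (T.ρ (i + 2)) m)
    (fun i => hatPolyOuter (T.ρ (i + 1)) (T.ρ (i + 2)) m)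
    (fun k l => bubblePoly (T.ρ k) (T.ρ (k + 1)) m l) s

theorem continuousPieces_diskPiece (p m : ℕ) (s : T.DiskIndex p m) :
    ContinuousPieces T.nr (fun i => T.ρ i ^ 2) (T.diskPiece p m s) :=
  (T.isHierarchical_disk _ m).continuousPieces_hierPiece s

theorem diskBasis_eq_diskPiece (p m : ℕ) (j : Fin 2) (s : T.DiskIndex p m) {k : ℕ}
    (hk : k < T.nr) {z : ℂ} (hz : ‖z‖ ∈ Set.Ioo (T.ρ k) (T.ρ (k + 1))) :
    T.diskBasis p m j s z = harmonicY m j z * (T.diskPiece p m s k).eval (‖z‖ ^ 2) := by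
  have hcell : ∀ i < T.nr, (T.ρ i ≤ ‖z‖ ∧ ‖z‖ ≤ T.ρ (i + 1)) ↔ k = i := fun i hi =>
    ⟨fun h => (nodes_cell_eq T.ρ_lt hi hk hz h).symm, fun h => h ▸ ⟨hz.1.le, hz.2.le⟩⟩
  induction s using hierIndex_cases with
  | inl i =>
    have hi := i.2
    rw [diskPiece, hierPiece_inl]
    change hat (T.ρ i) (T.ρ (i + 1)) (T.ρ (i + 2)) m j z = _
    have hlt : (T.ρ (i + 1) < ‖z‖ ∧ ‖z‖ ≤ T.ρ (i + 2)) ↔ k = i + 1 :=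
      ⟨fun h => (hcell (i + 1) (by omega)).1 ⟨h.1.le, h.2⟩, fun h => by
        subst h; exact ⟨hz.1, hz.2.le⟩⟩
    rw [hat_eq (T.ρ_nonneg (by omega)) (T.ρ_lt i (by omega)) (T.ρ_lt (i + 1) (by omega))]
    simp only [hcell i (by omega), hlt]
    split_ifs <;> simp
  | inr l q =>
    have hq := q.2
    rw [diskPiece, hierPiece_inr]
    change bubble (T.ρ q) (T.ρ (q + 1)) l m j z = _
    rw [bubble_eq (T.ρ_pos (Nat.succ_pos _) hq)]
    simp only [hcell q hq]
    split_ifs <;> simp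

/-- On the disk cell hats are constant and bubbles carry only the factor 1 - r²/ρ², so with Y the
total degree stays at most p when m ≤ p. -/
theorem natDegree_diskPiece_zero_le {p m : ℕ} (s : T.DiskIndex p m) :
    (T.diskPiece p m s 0).natDegree ≤ (p - m) / 2 := by
  induction s using hierIndex_cases with
  | inl i =>
    rw [diskPiece, hierPiece_inl]
    by_cases h : 0 = (i : ℕ)
    · rw [if_pos h, ← h, hatPolyInner, if_pos T.ρ_zero, natDegree_C]; exact Nat.zero_le _
    · rw [if_neg h, if_neg (by omega)]; simp
  | inr l q =>
    rw [diskPiece, hierPiece_inr]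
    by_cases h : 0 = (q : ℕ)
    · rw [if_pos h, ← h]
      refine (natDegree_bubblePoly_le T.ρ_zero.ge
        (T.ρ_lt 0 (Nat.pos_of_ne_zero T.nr_ne_zero)) m l).trans ?_
      rw [if_pos T.ρ_zero]
      exact l.2
    · rw [if_neg h]; simp

/-- The extra factor vanishing at the inner radius of an annulus costs one degree in r², so with Y
the total degree can reach p + 2. -/
theorem natDegree_diskPiece_le {p m : ℕ} (s : T.DiskIndex p m) (k : ℕ) :
    (T.diskPiece p m s k).natDegree ≤ (p - m) / 2 + 1 := by
  induction s using hierIndex_cases with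
  | inl i =>
    rw [diskPiece, hierPiece_inl]
    refine le_trans ?_ (Nat.le_add_left 1 _)
    split_ifs
    · rw [hatPolyInner]
      split_ifs
      · rw [natDegree_C]; exact Nat.zero_le _
      · exact (natDegree_C_mul_le _ _).trans (natDegree_innerFactor_le _ _)
    · exact (natDegree_C_mul_le _ _).trans (natDegree_outerFactor_le _)
    · simp
  | inr l q =>
    have hl := l.2
    rw [diskPiece, hierPiece_inr]
    by_cases h : k = (q : ℕ)
    · rw [if_pos h]
      refine (natDegree_bubblePoly_le (T.ρ_nonneg q.2.le) (T.ρ_lt q q.2) m l).trans ?_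
      split_ifs <;> omega
    · rw [if_neg h]; simp

end CylinderMesh

/-! ### Integrals over circular shells -/

/-- The integral of `cos (m θ) ^ 2` (if `j = 1`) or `sin (m θ) ^ 2` (if `j = 0`) over the circle. -/
noncomputable def angularMass (m : ℕ) (j : Fin 2) : ℝ :=
  ∫ θ in Set.Ioo (-Real.pi) Real.pi,
    (if j = 1 then Real.cos (m * θ) else Real.sin (m * θ)) ^ 2

theorem integral_cos_natCast_mul {k : ℕ} (hk : k ≠ 0) :
    ∫ θ in (-Real.pi)..Real.pi, Real.cos (k * θ) = 0 := by
  have hk' : (k : ℝ) ≠ 0 := Nat.cast_ne_zero.2 hk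
  rw [intervalIntegral.integral_comp_mul_left _ hk', integral_cos]
  simp [Real.sin_nat_mul_pi]

theorem angularMass_zero : angularMass 0 1 = 2 * Real.pi := by
  rw [angularMass]
  simp [Real.pi_pos.le, two_mul]

theorem angularMass_of_ne_zero {m : ℕ} (hm : m ≠ 0) (j : Fin 2) : angularMass m j = Real.pi := by
  have h2 := integral_cos_natCast_mul (k := 2 * m) (by omega)
  have hπ : -Real.pi ≤ Real.pi := by linarith [Real.pi_pos]
  have hi : IntervalIntegrable (fun θ : ℝ => Real.cos (((2 * m : ℕ) : ℝ) * θ)) volume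
      (-Real.pi) Real.pi := Continuous.intervalIntegrable (by fun_prop) _ _
  rw [angularMass, ← integral_Ioc_eq_integral_Ioo, ← intervalIntegral.integral_of_le hπ]
  split_ifs
  · have e : ∀ θ : ℝ, Real.cos (m * θ) ^ 2 = 1 / 2 + 1 / 2 * Real.cos (((2 * m : ℕ) : ℝ) * θ) := by
      intro θ
      rw [Real.cos_sq, show (((2 * m : ℕ) : ℝ) * θ) = 2 * (m * θ) by push_cast; ring]; ring
    simp only [e]
    rw [intervalIntegral.integral_add (by simp) (hi.const_mul _),
      intervalIntegral.integral_const_mul, h2]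
    simp; ring
  · have e : ∀ θ : ℝ, Real.sin (m * θ) ^ 2 = 1 / 2 - 1 / 2 * Real.cos (((2 * m : ℕ) : ℝ) * θ) := by
      intro θ
      rw [Real.sin_sq_eq_half_sub, show (((2 * m : ℕ) : ℝ) * θ) = 2 * (m * θ) by push_cast; ring]
      ring
    simp only [e]
    rw [intervalIntegral.integral_sub (by simp) (hi.const_mul _),
      intervalIntegral.integral_const_mul, h2]
    simp; ring

theorem angularMass_pos {m : ℕ} {j : Fin 2} (h : (m, j) ≠ (0, 0)) : 0 < angularMass m j := by
  by_cases hm : m = 0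
  · have hj : j = 1 := by
      have : j ≠ 0 := fun hj => h (by rw [hm, hj])
      omega
    rw [hm, hj, angularMass_zero]
    exact Real.two_pi_pos
  · rw [angularMass_of_ne_zero hm]
    exact Real.pi_pos

theorem harmonicY_polar (m : ℕ) (j : Fin 2) (r θ : ℝ) :
    harmonicY m j (Complex.polarCoord.symm (r, θ)) =
      r ^ m * (if j = 1 then Real.cos (m * θ) else Real.sin (m * θ)) := by
  have h : (Complex.polarCoord.symm (r, θ)) ^ m =
      ((r ^ m : ℝ) : ℂ) * (((Real.cos (m * θ) : ℝ) : ℂ) + ((Real.sin (m * θ) : ℝ) : ℂ) * Complex.I) := by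
    rw [Complex.polarCoord_symm_apply, mul_pow]
    have := Complex.cos_add_sin_mul_I_pow m θ
    push_cast
    rw [this]
  rw [harmonicY, h]
  split_ifs
  · rw [Complex.re_ofReal_mul, Complex.add_re, Complex.ofReal_re, Complex.re_ofReal_mul,
      Complex.I_re]
    ring
  · rw [Complex.im_ofReal_mul, Complex.add_im, Complex.ofReal_im, Complex.im_ofReal_mul,
      Complex.I_im]
    ring

/-- Polar coordinates: r^(2m) comes from Y² and one more r from the Jacobian. -/
theorem integral_harmonicY_sq_mul (m : ℕ) (j : Fin 2) (F : ℝ → ℝ) :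
    ∫ z : ℂ, harmonicY m j z ^ 2 * F ‖z‖ =
      angularMass m j * ∫ r in Set.Ioi (0 : ℝ), r ^ (2 * m + 1) * F r := by
  rw [← Complex.integral_comp_polarCoord_symm, polarCoord_target, mul_comm, angularMass,
    ← setIntegral_prod_mul]
  refine setIntegral_congr_fun (measurableSet_Ioi.prod measurableSet_Ioo) fun q hq => ?_
  have hq0 : 0 < q.1 := hq.1
  have hn : ‖Complex.polarCoord.symm q‖ = q.1 := by
    rw [Complex.norm_polarCoord_symm, abs_of_pos hq0]
  have hY := harmonicY_polar m j q.1 q.2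
  simp only [smul_eq_mul]
  rw [hn, hY]
  ring

/-- The open shell of radii `a < b`, the disk of radius `b` punctured at the origin if `a = 0`. -/
def shell (a b : ℝ) : Set ℂ := {z | ‖z‖ ∈ Set.Ioo a b}

theorem measurableSet_shell (a b : ℝ) : MeasurableSet (shell a b) :=
  measurable_norm measurableSet_Ioo

theorem shell_subset_closedBall (a b : ℝ) : shell a b ⊆ Metric.closedBall 0 b := fun z hz => by
  rw [mem_closedBall_zero_iff]; exact hz.2.le

theorem integrableOn_shell {f : ℂ → ℝ} (hf : Continuous f) (a b : ℝ) :
    IntegrableOn f (shell a b) :=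
  (hf.continuousOn.integrableOn_compact (isCompact_closedBall 0 b)).mono_set
    (shell_subset_closedBall a b)

theorem continuous_harmonicY (m : ℕ) (j : Fin 2) : Continuous (harmonicY m j) := by
  unfold harmonicY
  split_ifs <;> fun_prop

theorem setIntegral_shell_harmonicY (m : ℕ) (j : Fin 2) {a b : ℝ} (ha : 0 ≤ a) (hab : a < b)
    (P : ℝ[X]) :
    ∫ z in shell a b, harmonicY m j z ^ 2 * P.eval (‖z‖ ^ 2) =
      angularMass m j / 2 * polyIntegral (a ^ 2) (b ^ 2) (X ^ m * P) := by
  have h := integral_harmonicY_sq_mul m j ((Set.Ioo a b).indicator fun r => P.eval (r ^ 2))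
  have e1 : ∀ z : ℂ, harmonicY m j z ^ 2 * (Set.Ioo a b).indicator (fun r => P.eval (r ^ 2)) ‖z‖ =
      (shell a b).indicator (fun z => harmonicY m j z ^ 2 * P.eval (‖z‖ ^ 2)) z := by
    intro z
    by_cases hz : ‖z‖ ∈ Set.Ioo a b
    · rw [Set.indicator_of_mem hz, Set.indicator_of_mem (show z ∈ shell a b from hz)]
    · rw [Set.indicator_of_notMem hz, Set.indicator_of_notMem (show z ∉ shell a b from hz),
        mul_zero]
  have e2 : ∀ r : ℝ, r ^ (2 * m + 1) * (Set.Ioo a b).indicator (fun r => P.eval (r ^ 2)) r =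
      (Set.Ioo a b).indicator (fun r => r ^ (2 * m + 1) * P.eval (r ^ 2)) r := by
    intro r
    by_cases hr : r ∈ Set.Ioo a b
    · rw [Set.indicator_of_mem hr, Set.indicator_of_mem hr]
    · rw [Set.indicator_of_notMem hr, Set.indicator_of_notMem hr, mul_zero]
  simp only [e1, e2] at h
  rw [integral_indicator (measurableSet_shell a b), setIntegral_indicator measurableSet_Ioo,
    Set.inter_eq_right.2 (show Set.Ioo a b ⊆ Set.Ioi 0 from fun r hr => ha.trans_lt hr.1),
    ← integral_Ioc_eq_integral_Ioo,
    ← intervalIntegral.integral_of_le hab.le] at h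
  rw [h, div_mul_eq_mul_div, mul_div_assoc, polyIntegral_comp_sq]
  congr 1
  rw [eq_div_iff two_ne_zero, polyIntegral_apply, ← intervalIntegral.integral_mul_const]
  refine intervalIntegral.integral_congr fun r _ => ?_
  simp only [eval_mul, eval_comp, eval_pow, eval_X, eval_ofNat]
  ring

/-- The case Y = 1 of the preceding formula, with angular mass 2π. -/
theorem setIntegral_shell {a b : ℝ} (ha : 0 ≤ a) (hab : a < b) (P : ℝ[X]) :
    ∫ z in shell a b, P.eval (‖z‖ ^ 2) = Real.pi * polyIntegral (a ^ 2) (b ^ 2) P := by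
  have h := setIntegral_shell_harmonicY 0 1 ha hab P
  rw [angularMass_zero] at h
  simpa [harmonicY] using h

/-- The circles of the mesh are null sets, so the open shells fill the ball almost everywhere. -/
theorem integral_ball_eq_sum {n : ℕ} {ρ : ℕ → ℝ} (hρ : ∀ i < n, ρ i < ρ (i + 1))
    (h0 : ρ 0 = 0) {f : ℂ → ℝ} {g : ℕ → ℂ → ℝ} (hg : ∀ i, Continuous (g i))
    (hfg : ∀ i < n, ∀ z ∈ shell (ρ i) (ρ (i + 1)), f z = g i z) :
    IntegrableOn f (Metric.ball 0 (ρ n)) ∧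
      ∫ z in Metric.ball 0 (ρ n), f z =
        ∑ i ∈ Finset.range n, ∫ z in shell (ρ i) (ρ (i + 1)), g i z := by
  induction n with
  | zero => simp [h0]
  | succ n ih =>
    obtain ⟨ih1, ih2⟩ := ih (fun i hi => hρ i (by omega)) (fun i hi => hfg i (by omega))
    have hlt := hρ n (Nat.lt_succ_self n)
    have hset : (Metric.ball 0 (ρ n) ∪ shell (ρ n) (ρ (n + 1)) : Set ℂ) =ᵐ[volume]
        (Metric.ball 0 (ρ (n + 1)) : Set ℂ) := by
      have hs : ∀ᵐ z : ℂ, z ∉ Metric.sphere (0 : ℂ) (ρ n) :=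
        measure_eq_zero_iff_ae_notMem.1 (Measure.addHaar_sphere volume 0 (ρ n))
      filter_upwards [hs] with z hz
      have hz' : ‖z‖ ≠ ρ n := by simpa using hz
      refine propext ?_
      change (z ∈ Metric.ball 0 (ρ n) ∨ z ∈ shell (ρ n) (ρ (n + 1))) ↔ z ∈ Metric.ball 0 (ρ (n + 1))
      rw [mem_ball_zero_iff, mem_ball_zero_iff]
      constructor
      · rintro (h | h)
        · exact h.trans hlt
        · exact h.2
      · intro h
        rcases lt_or_gt_of_ne hz' with h' | h'
        · exact Or.inl h'
        · exact Or.inr ⟨h', h⟩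
    have hcongr := hfg n (Nat.lt_succ_self n)
    have hint : IntegrableOn f (shell (ρ n) (ρ (n + 1))) :=
      (integrableOn_shell (hg n) _ _).congr_fun (fun z hz => (hcongr z hz).symm)
        (measurableSet_shell _ _)
    have hdisj : Disjoint (Metric.ball 0 (ρ n)) (shell (ρ n) (ρ (n + 1))) := by
      rw [Set.disjoint_left]
      intro z hz hz'
      rw [mem_ball_zero_iff] at hz
      exact lt_asymm hz hz'.1
    constructor
    · rw [← integrableOn_congr_set_ae hset]
      exact ih1.union hint
    · rw [← setIntegral_congr_set hset, setIntegral_union hdisj (measurableSet_shell _ _) ih1 hint,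
        ih2, Finset.sum_range_succ, setIntegral_congr_fun (measurableSet_shell _ _) hcongr]

/-! ### Gradients -/

/-- The gradient of `Y_{m,j}`. -/
noncomputable def gradY (m : ℕ) (j : Fin 2) (z : ℂ) : ℂ :=
  if j = 1 then (starRingEnd ℂ) (m * z ^ (m - 1)) else
    Complex.I * (starRingEnd ℂ) (m * z ^ (m - 1))

theorem hasGradientAt_harmonicY (m : ℕ) (j : Fin 2) (z : ℂ) :
    HasGradientAt (harmonicY m j) (gradY m j z) z := by
  rw [hasGradientAt_iff_hasFDerivAt]
  have hp : HasFDerivAt (fun z : ℂ => z ^ m)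
      (((ContinuousLinearMap.toSpanSingleton ℂ (m * z ^ (m - 1) : ℂ))).restrictScalars ℝ) z :=
    (hasDerivAt_pow m z).hasFDerivAt.restrictScalars ℝ
  by_cases hj : j = 1
  · have h1 := (Complex.reCLM.hasFDerivAt (x := z ^ m)).comp z hp
    have e : harmonicY m j = Complex.reCLM ∘ fun z => z ^ m := by
      funext w; simp [harmonicY, hj]
    rw [e]
    refine h1.congr_fderiv ?_
    ext w
    simp [gradY, hj, Complex.inner]
  · have h1 := (Complex.imCLM.hasFDerivAt (x := z ^ m)).comp z hp
    have e : harmonicY m j = Complex.imCLM ∘ fun z => z ^ m := by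
      funext w; simp [harmonicY, hj]
    rw [e]
    refine h1.congr_fderiv ?_
    ext w
    simp [gradY, hj, Complex.inner]
    ring

theorem norm_gradY_sq (m : ℕ) (j : Fin 2) (z : ℂ) :
    inner ℝ (gradY m j z) (gradY m j z) = (m : ℝ) ^ 2 * (‖z‖ ^ 2) ^ (m - 1) := by
  rw [real_inner_self_eq_norm_sq]
  have : ‖gradY m j z‖ = m * ‖z‖ ^ (m - 1) := by
    unfold gradY
    split_ifs <;> simp
  rw [this, mul_pow, ← pow_mul, ← pow_mul, mul_comm 2]

/-- Euler's identity for a homogeneous function of degree m. -/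
theorem inner_gradY (m : ℕ) (j : Fin 2) (z : ℂ) :
    inner ℝ z (gradY m j z) = m * harmonicY m j z := by
  have hz : (m : ℂ) * z ^ (m - 1) * z = m * z ^ m := by
    rcases m with _ | m
    · simp
    · rw [Nat.add_sub_cancel, mul_assoc, ← pow_succ]
  rw [real_inner_comm, Complex.inner]
  unfold gradY harmonicY
  split_ifs
  · rw [Complex.conj_conj, mul_comm, hz, ← Complex.ofReal_natCast, Complex.re_ofReal_mul]
  · rw [map_mul, Complex.conj_conj, Complex.conj_I, mul_comm, mul_assoc, hz]
    simp

theorem hasGradientAt_harmonicY_mul (m : ℕ) (j : Fin 2) (P : ℝ[X]) (z : ℂ) :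
    HasGradientAt (fun z => harmonicY m j z * P.eval (‖z‖ ^ 2))
      (P.eval (‖z‖ ^ 2) • gradY m j z +
        (2 * harmonicY m j z * (derivative P).eval (‖z‖ ^ 2)) • z) z := by
  rw [hasGradientAt_iff_hasFDerivAt]
  have h1 := (hasGradientAt_iff_hasFDerivAt.1 (hasGradientAt_harmonicY m j z))
  have h2 : HasFDerivAt (fun z : ℂ => ‖z‖ ^ 2) (2 • innerSL ℝ z) z :=
    (hasStrictFDerivAt_norm_sq z).hasFDerivAt
  have h3 := (P.hasDerivAt (‖z‖ ^ 2)).comp_hasFDerivAt z h2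
  refine (h1.mul h3).congr_fderiv ?_
  ext w
  simp
  ring

theorem inner_gradient_harmonicY_mul (m : ℕ) (j : Fin 2) (P Q : ℝ[X]) (z : ℂ) :
    inner ℝ (gradient (fun z => harmonicY m j z * P.eval (‖z‖ ^ 2)) z)
        (gradient (fun z => harmonicY m j z * Q.eval (‖z‖ ^ 2)) z) =
      (C ((m : ℝ) ^ 2) * (X ^ (m - 1) * (P * Q))).eval (‖z‖ ^ 2) +
        harmonicY m j z ^ 2 * (C (2 * (m : ℝ)) * derivative (P * Q) +
          C 4 * (X * (derivative P * derivative Q))).eval (‖z‖ ^ 2) := by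
  rw [(hasGradientAt_harmonicY_mul m j P z).gradient, (hasGradientAt_harmonicY_mul m j Q z).gradient]
  simp only [inner_add_left, inner_add_right, real_inner_smul_left, real_inner_smul_right,
    norm_gradY_sq, real_inner_comm (gradY m j z) z]
  rw [real_inner_comm, inner_gradY, real_inner_self_eq_norm_sq]
  simp only [eval_add, eval_mul, eval_C, eval_pow, eval_X, derivative_mul]
  ring

/-! ### The matrices of the disk -/

theorem ContinuousPieces.sum_boundary_mul {n : ℕ} {x : ℕ → ℝ} {g g' : ℕ → ℝ[X]}
    (hg : ContinuousPieces n x g) (hg' : ContinuousPieces n x g') (hn : n ≠ 0) (w : ℝ → ℝ)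
    (h0 : w (x 0) = 0) :
    ∑ i ∈ Finset.range n,
      (w (x (i + 1)) * ((g i).eval (x (i + 1)) * (g' i).eval (x (i + 1))) -
        w (x i) * ((g i).eval (x i) * (g' i).eval (x i))) = 0 := by
  rw [sum_range_sub_of_match
    (R := fun i => w (x (i + 1)) * ((g i).eval (x (i + 1)) * (g' i).eval (x (i + 1))))
    (L := fun i => w (x i) * ((g i).eval (x i) * (g' i).eval (x i))) hn
    (fun i hi => by simp only [hg.match_right i hi, hg'.match_right i hi])]
  rw [h0, Nat.sub_add_cancel (Nat.one_le_iff_ne_zero.2 hn), hg.last]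
  simp

theorem coeffNorm_nonneg (lam : ℝ → ℝ) : 0 ≤ coeffNorm lam := ENNReal.toReal_nonneg

/-- Needed for λ, which is not polynomial on the cells, so that its quadratic form must be compared
pointwise under the integral. -/
theorem integral_quadForm {ι α : Type*} [Fintype ι] [MeasurableSpace α] {μ : Measure α} {w : α → ℝ}
    {φ : ι → α → ℝ} (h : ∀ s s', Integrable (fun z => w z * φ s z * φ s' z) μ) (v : ι → ℝ) :
    Integrable (fun z => w z * (∑ s, v s * φ s z) ^ 2) μ ∧
      v ⬝ᵥ (Matrix.of fun s s' => ∫ z, w z * φ s z * φ s' z ∂μ) *ᵥ v =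
        ∫ z, w z * (∑ s, v s * φ s z) ^ 2 ∂μ := by
  have e : ∀ z, w z * (∑ s, v s * φ s z) ^ 2 =
      ∑ s, ∑ s', v s * (v s' * (w z * φ s z * φ s' z)) := by
    intro z
    rw [sq, Finset.sum_mul_sum, Finset.mul_sum]
    refine Finset.sum_congr rfl fun s _ => ?_
    rw [Finset.mul_sum]
    exact Finset.sum_congr rfl fun s' _ => by ring
  have hint : ∀ s s', Integrable (fun z => v s * (v s' * (w z * φ s z * φ s' z))) μ :=
    fun s s' => ((h s s').const_mul _).const_mul _
  simp only [e]
  refine ⟨integrable_finsetSum _ fun s _ => integrable_finsetSum _ fun s' _ => hint s s', ?_⟩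
  rw [integral_finsetSum _ fun s _ => integrable_finsetSum _ fun s' _ => hint s s']
  simp only [dotProduct, mulVec, Matrix.of_apply, Finset.mul_sum]
  refine Finset.sum_congr rfl fun s _ => ?_
  rw [integral_finsetSum _ fun s' _ => hint s s']
  refine Finset.sum_congr rfl fun s' _ => ?_
  rw [integral_const_mul, integral_const_mul, mul_comm (v s')]

namespace CylinderMesh

variable (T : CylinderMesh)

theorem integral_diskBasis_mul (p m : ℕ) (j : Fin 2) (s s' : T.DiskIndex p m) :
    IntegrableOn (fun z => T.diskBasis p m j s z * T.diskBasis p m j s' z) (Metric.ball 0 1) ∧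
      ∫ z in Metric.ball (0 : ℂ) 1, T.diskBasis p m j s z * T.diskBasis p m j s' z =
        angularMass m j / 2 * cellSum T.nr
          (fun k => polyForm (T.ρ k ^ 2) (T.ρ (k + 1) ^ 2) (X ^ m))
          (T.diskPiece p m s) (T.diskPiece p m s') := by
  obtain ⟨h1, h2⟩ := integral_ball_eq_sum T.ρ_lt T.ρ_zero
    (f := fun z => T.diskBasis p m j s z * T.diskBasis p m j s' z)
    (g := fun i z => harmonicY m j z ^ 2 *
      (T.diskPiece p m s i * T.diskPiece p m s' i).eval (‖z‖ ^ 2))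
    (fun i => ((continuous_harmonicY m j).pow 2).mul
      ((Polynomial.continuous _).comp (continuous_norm.pow 2)))
    (fun i hi z hz => by
      rw [T.diskBasis_eq_diskPiece p m j s hi hz, T.diskBasis_eq_diskPiece p m j s' hi hz, eval_mul]
      ring)
  rw [T.ρ_last] at h1 h2
  refine ⟨h1, ?_⟩
  rw [h2, cellSum_apply, Finset.mul_sum]
  refine Finset.sum_congr rfl fun i hi => ?_
  have hi' := Finset.mem_range.1 hi
  rw [setIntegral_shell_harmonicY m j (T.ρ_nonneg hi'.le) (T.ρ_lt i hi'), polyForm_apply]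

theorem diskMass_eq (p m : ℕ) (j : Fin 2) : T.diskMass p m j = Matrix.of fun s s' =>
    ((angularMass m j / 2) • cellSum T.nr
      (fun k => polyForm (T.ρ k ^ 2) (T.ρ (k + 1) ^ 2) (X ^ m)))
      (T.diskPiece p m s) (T.diskPiece p m s') := by
  ext s s'
  exact (T.integral_diskBasis_mul p m j s s').2

theorem gradient_diskBasis (p m : ℕ) (j : Fin 2) (s : T.DiskIndex p m) {k : ℕ} (hk : k < T.nr)
    {z : ℂ} (hz : z ∈ shell (T.ρ k) (T.ρ (k + 1))) :
    gradient (T.diskBasis p m j s) z =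
      gradient (fun z => harmonicY m j z * (T.diskPiece p m s k).eval (‖z‖ ^ 2)) z := by
  have hopen : IsOpen (shell (T.ρ k) (T.ρ (k + 1))) := isOpen_Ioo.preimage continuous_norm
  have h : T.diskBasis p m j s =ᶠ[nhds z]
      fun z => harmonicY m j z * (T.diskPiece p m s k).eval (‖z‖ ^ 2) := by
    filter_upwards [hopen.mem_nhds hz] with w hw using T.diskBasis_eq_diskPiece p m j s hk hw
  rw [gradient, gradient, h.fderiv_eq]

/-- The term m²x^(m-1)PQ from |∇Y|² and the cross terms 2m x^m (PQ)' form an exact derivative, so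
only boundary values remain beside the integral of x^(m+1) P'Q'. -/
theorem setIntegral_shell_inner_gradient (m : ℕ) (j : Fin 2) {a b : ℝ} (ha : 0 ≤ a)
    (hab : a < b) (P Q : ℝ[X]) :
    ∫ z in shell a b, ((C ((m : ℝ) ^ 2) * (X ^ (m - 1) * (P * Q))).eval (‖z‖ ^ 2) +
        harmonicY m j z ^ 2 * (C (2 * (m : ℝ)) * derivative (P * Q) +
          C 4 * (X * (derivative P * derivative Q))).eval (‖z‖ ^ 2)) =
      2 * angularMass m j * polyDerivForm (a ^ 2) (b ^ 2) (X ^ (m + 1)) P Q +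
        angularMass m j * m * ((b ^ 2) ^ m * (P.eval (b ^ 2) * Q.eval (b ^ 2)) -
          (a ^ 2) ^ m * (P.eval (a ^ 2) * Q.eval (a ^ 2))) := by
  have hcont : ∀ R : ℝ[X], Continuous fun z : ℂ => R.eval (‖z‖ ^ 2) := fun R =>
    R.continuous.comp (continuous_norm.pow 2)
  have hi2 : ∀ R : ℝ[X], IntegrableOn (fun z => harmonicY m j z ^ 2 * R.eval (‖z‖ ^ 2))
      (shell a b) := fun R =>
    integrableOn_shell (((continuous_harmonicY m j).pow 2).mul (hcont R)) a b
  rw [integral_add (integrableOn_shell (hcont _) a b) (hi2 _), setIntegral_shell ha hab,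
    setIntegral_shell_harmonicY m j ha hab]
  have hd := polyIntegral_derivative (a ^ 2) (b ^ 2) (X ^ m * (P * Q))
  simp only [eval_mul, eval_pow, eval_X] at hd
  rw [← hd, polyDerivForm_apply, polyIntegral_C_mul]
  have e1 : X ^ m * (C (2 * (m : ℝ)) * derivative (P * Q) +
      C 4 * (X * (derivative P * derivative Q))) =
      C (2 * (m : ℝ)) * (X ^ m * derivative (P * Q)) +
        C 4 * (X ^ (m + 1) * (derivative P * derivative Q)) := by ring
  have e2 : derivative (X ^ m * (P * Q)) =
      C (m : ℝ) * (X ^ (m - 1) * (P * Q)) + X ^ m * derivative (P * Q) := by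
    rw [derivative_mul, derivative_X_pow, mul_assoc]
  rw [e1, e2, map_add, map_add, polyIntegral_C_mul, polyIntegral_C_mul, polyIntegral_C_mul]
  -- For m = 0 the angular mass is not π in general, but every term where this would matter carries
  -- a factor m.
  by_cases hm : m = 0
  · subst hm; simp; ring
  · rw [angularMass_of_ne_zero hm]; ring

theorem diskStiffness_eq (p m : ℕ) (j : Fin 2) : T.diskStiffness p m j = Matrix.of fun s s' =>
    ((2 * angularMass m j) • cellSum T.nr
      (fun k => polyDerivForm (T.ρ k ^ 2) (T.ρ (k + 1) ^ 2) (X ^ (m + 1))))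
      (T.diskPiece p m s) (T.diskPiece p m s') := by
  ext s s'
  obtain ⟨-, h2⟩ := integral_ball_eq_sum T.ρ_lt T.ρ_zero
    (f := fun z => inner ℝ (gradient (T.diskBasis p m j s) z) (gradient (T.diskBasis p m j s') z))
    (g := fun i z =>
      (C ((m : ℝ) ^ 2) * (X ^ (m - 1) * (T.diskPiece p m s i * T.diskPiece p m s' i))).eval
        (‖z‖ ^ 2) +
      harmonicY m j z ^ 2 *
        (C (2 * (m : ℝ)) * derivative (T.diskPiece p m s i * T.diskPiece p m s' i) +
          C 4 * (X * (derivative (T.diskPiece p m s i) *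
            derivative (T.diskPiece p m s' i)))).eval (‖z‖ ^ 2))
    (fun i => ((Polynomial.continuous _).comp (continuous_norm.pow 2)).add
      (((continuous_harmonicY m j).pow 2).mul
        ((Polynomial.continuous _).comp (continuous_norm.pow 2))))
    (fun i hi z hz => by
      rw [T.gradient_diskBasis p m j s hi hz, T.gradient_diskBasis p m j s' hi hz,
        inner_gradient_harmonicY_mul])
  rw [T.ρ_last] at h2
  rw [diskStiffness, Matrix.of_apply, Matrix.of_apply, h2, LinearMap.smul_apply,
    LinearMap.smul_apply, cellSum_apply, smul_eq_mul, Finset.mul_sum]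
  -- At the origin the weight vanishes through its factor m if m = 0, and through the power of y
  -- otherwise.
  have hb := (T.continuousPieces_diskPiece p m s).sum_boundary_mul
    (T.continuousPieces_diskPiece p m s') T.nr_ne_zero (fun y => angularMass m j * m * y ^ m) (by
      rw [T.ρ_zero]
      by_cases hm : m = 0 <;> simp [hm])
  rw [← add_zero (∑ i ∈ Finset.range T.nr, 2 * angularMass m j * _), ← hb,
    ← Finset.sum_add_distrib]
  refine Finset.sum_congr rfl fun i hi => ?_
  have hi' := Finset.mem_range.1 hi
  rw [setIntegral_shell_inner_gradient m j (T.ρ_nonneg hi'.le) (T.ρ_lt i hi')]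
  ring

/-- Poincaré inequality for the basis of the disk. -/
theorem diskMass_le {p m : ℕ} {j : Fin 2} (hmj : (m, j) ≠ (0, 0)) (v : T.DiskIndex p m → ℝ) :
    v ⬝ᵥ T.diskMass p m j *ᵥ v ≤ v ⬝ᵥ T.diskStiffness p m j *ᵥ v := by
  have hc := angularMass_pos hmj
  rw [diskMass_eq, diskStiffness_eq, dotProduct_gram_mulVec, dotProduct_gram_mulVec]
  simp only [LinearMap.smul_apply, smul_eq_mul, cellSum_apply]
  have h := poincare_radial T.nr_ne_zero T.ρ_sq_lt (by simp [T.ρ_zero]) (by simp [T.ρ_last])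
    (ContinuousPieces.sum (T.continuousPieces_diskPiece p m) v) m
  -- The factor 4 is exactly the ratio of the prefactors 2 * angularMass and angularMass / 2, so the
  -- constant becomes 1.
  calc _ ≤ angularMass m j / 2 * (4 * _) := mul_le_mul_of_nonneg_left h (by positivity)
    _ = _ := by ring

theorem diskMass_pos {p m : ℕ} {j : Fin 2} (hmj : (m, j) ≠ (0, 0)) {v : T.DiskIndex p m → ℝ}
    (hv : v ≠ 0) : 0 < v ⬝ᵥ T.diskMass p m j *ᵥ v := by
  have hc := angularMass_pos hmj
  rw [diskMass_eq, dotProduct_gram_mulVec]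
  simp only [LinearMap.smul_apply, smul_eq_mul]
  refine mul_pos (by positivity) (cellSum_polyForm_pos T.ρ_sq_lt m (Or.inr (by positivity)) ?_)
  by_contra! hcon
  exact hv ((T.isHierarchical_disk _ m).eq_zero hcon)

theorem diskMass_nonneg {p m : ℕ} {j : Fin 2} (hmj : (m, j) ≠ (0, 0)) (v : T.DiskIndex p m → ℝ) :
    0 ≤ v ⬝ᵥ T.diskMass p m j *ᵥ v := by
  by_cases hv : v = 0
  · simp [hv]
  · exact (T.diskMass_pos hmj hv).le

/-- The innermost cell needs the weighted inequality, as its inner radius is 0; all others use the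
annulus inequality. The constant 973 is 12 · 3⁴ for the annulus plus 1 for its m² term, with room to
spare for the disk cell. -/
theorem polyDerivForm_diskPiece_le {κ : ℝ} (hκ : 1 ≤ κ) (hT : T.QuasiUniform κ) {p m : ℕ}
    (hp : 1 ≤ p) (hm : m ≤ p) {k : ℕ} (hk : k < T.nr) (v : T.DiskIndex p m → ℝ) :
    polyDerivForm (T.ρ k ^ 2) (T.ρ (k + 1) ^ 2) (X ^ (m + 1))
        ((∑ s, v s • T.diskPiece p m s) k) ((∑ s, v s • T.diskPiece p m s) k) ≤
      973 * (1 + κ) * (p : ℝ) ^ 4 / T.size ^ 2 *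
        polyForm (T.ρ k ^ 2) (T.ρ (k + 1) ^ 2) (X ^ m)
          ((∑ s, v s • T.diskPiece p m s) k) ((∑ s, v s • T.diskPiece p m s) k) := by
  have hh := T.size_pos
  have hp1 : (1 : ℝ) ≤ p := by exact_mod_cast hp
  have hsize := T.size_le_ρ hk
  have hM : 0 ≤ polyForm (T.ρ k ^ 2) (T.ρ (k + 1) ^ 2) (X ^ m)
      ((∑ s, v s • T.diskPiece p m s) k) ((∑ s, v s • T.diskPiece p m s) k) :=
    polyForm_self_nonneg (T.ρ_sq_lt k hk).le (eval_X_pow_nonneg (sq_nonneg _) m) _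
  rcases Nat.eq_zero_or_pos k with rfl | hk0
  · have hρ1 : T.size ≤ T.ρ (0 + 1) := by rwa [T.ρ_zero, sub_zero] at hsize
    have hz : T.ρ 0 ^ 2 = 0 := by rw [T.ρ_zero]; norm_num
    rw [hz] at hM ⊢
    have hρ := T.ρ_pos (Nat.succ_pos 0) hk
    have h := inverse_inequality_disk (b := T.ρ (0 + 1) ^ 2) (by positivity) (m := m)
      (natDegree_sum_smul_apply_le (fun s => T.natDegree_diskPiece_zero_le s) v)
    refine h.trans (mul_le_mul_of_nonneg_right ?_ hM)
    have hK : ((p - m) / 2) * 2 + m ≤ p := by omega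
    have hK' : (((p - m) / 2 : ℕ) : ℝ) * 2 + m ≤ p := by exact_mod_cast hK
    have hK0 : (0 : ℝ) ≤ ((p - m) / 2 : ℕ) := Nat.cast_nonneg _
    have hm0 : (0 : ℝ) ≤ m := Nat.cast_nonneg _
    generalize (((p - m) / 2 : ℕ) : ℝ) = K at hK' hK0
    calc K ^ 2 * (K + m + 1) * (m + 1 + 2 * K) / T.ρ (0 + 1) ^ 2
        ≤ (p : ℝ) ^ 2 * (2 * p) * (2 * p) / T.size ^ 2 := by gcongr <;> linarith
      _ = 4 * ((p : ℝ) ^ 4 / T.size ^ 2) := by ring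
      _ ≤ 973 * (1 + κ) * ((p : ℝ) ^ 4 / T.size ^ 2) := by gcongr; linarith
      _ = _ := by ring
  · have ha := T.ρ_pos hk0 hk.le
    have hab := T.ρ_lt k hk
    have ha1 : T.size ≤ T.ρ k := by
      have h1 := T.size_le_ρ (i := 0) (by omega)
      have h2 := nodes_le T.ρ_lt (show 0 + 1 ≤ k from hk0) hk.le
      rw [T.ρ_zero] at h1
      linarith
    -- The total degree is at most p + 2, which is at most 3p because p ≥ 1.
    have hd : m + 2 * ((∑ s, v s • T.diskPiece p m s) k).natDegree ≤ 3 * p := by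
      have := natDegree_sum_smul_apply_le (fun s => T.natDegree_diskPiece_le s k) v
      omega
    refine (inverse_inequality_annulus ha hab hd).trans (mul_le_mul_of_nonneg_right ?_ hM)
    have hδ := hT.1 k hk
    have hm' : (m : ℝ) ≤ p := by exact_mod_cast hm
    -- The inner radius is at least the thickness h of the first cell, and the annulus is at most κh
    -- thick.
    have hba : T.ρ (k + 1) / T.ρ k ≤ 1 + κ := by
      rw [div_le_iff₀ ha]
      nlinarith [mul_le_mul_of_nonneg_left ha1 (zero_le_one.trans hκ)]
    have hδ0 : 0 < T.ρ (k + 1) - T.ρ k := sub_pos.2 hab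
    have h1 : 12 * ((3 * p : ℕ) : ℝ) ^ 4 * T.ρ (k + 1) / (T.ρ k * (T.ρ (k + 1) - T.ρ k) ^ 2) ≤
        972 * (p : ℝ) ^ 4 * (1 + κ) / T.size ^ 2 := by
      have e : 12 * ((3 * p : ℕ) : ℝ) ^ 4 * T.ρ (k + 1) / (T.ρ k * (T.ρ (k + 1) - T.ρ k) ^ 2) =
          972 * (p : ℝ) ^ 4 * (T.ρ (k + 1) / T.ρ k) / (T.ρ (k + 1) - T.ρ k) ^ 2 := by
        push_cast; field_simp; ring
      rw [e]
      gcongr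
    have h2 : (m : ℝ) ^ 2 / T.ρ k ^ 2 ≤ (p : ℝ) ^ 4 / T.size ^ 2 := by
      have h3 : (m : ℝ) ^ 2 ≤ (p : ℝ) ^ 4 := by
        calc (m : ℝ) ^ 2 ≤ (p : ℝ) ^ 2 := by gcongr
          _ ≤ (p : ℝ) ^ 4 := pow_le_pow_right₀ hp1 (by norm_num)
      gcongr
    have h4 : 0 ≤ (p : ℝ) ^ 4 / T.size ^ 2 := by positivity
    calc _ ≤ (972 * (p : ℝ) ^ 4 * (1 + κ) / T.size ^ 2 + (p : ℝ) ^ 4 / T.size ^ 2) / 2 := by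
          linarith
      _ = (972 * (1 + κ) + 1) / 2 * ((p : ℝ) ^ 4 / T.size ^ 2) := by ring
      _ ≤ 973 * (1 + κ) * ((p : ℝ) ^ 4 / T.size ^ 2) := by gcongr; linarith
      _ = _ := by ring

/-- Inverse inequality for the basis of the disk. -/
theorem diskStiffness_le {κ : ℝ} (hκ : 1 ≤ κ) (hT : T.QuasiUniform κ) {p m : ℕ}
    (hp : 1 ≤ p) (hm : m ≤ p) {j : Fin 2} (hmj : (m, j) ≠ (0, 0)) (v : T.DiskIndex p m → ℝ) :
    v ⬝ᵥ T.diskStiffness p m j *ᵥ v ≤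
      3892 * (1 + κ) * (p : ℝ) ^ 4 / T.size ^ 2 * (v ⬝ᵥ T.diskMass p m j *ᵥ v) := by
  have hc := angularMass_pos hmj
  rw [diskMass_eq, diskStiffness_eq, dotProduct_gram_mulVec, dotProduct_gram_mulVec]
  simp only [LinearMap.smul_apply, smul_eq_mul, cellSum_apply]
  have h := Finset.sum_le_sum fun k hk =>
    T.polyDerivForm_diskPiece_le hκ hT hp hm (Finset.mem_range.1 hk) v
  rw [← Finset.mul_sum] at h
  -- The prefactors of the stiffness and mass forms have ratio 4, whence 3892 = 4 · 973.
  calc _ ≤ 2 * angularMass m j * _ := mul_le_mul_of_nonneg_left h (by positivity)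
    _ = _ := by ring

theorem diskWeightedMass_bounds {lam : ℝ → ℝ} (hlam : AdmissibleCoeff lam) (p m : ℕ) (j : Fin 2)
    (v : T.DiskIndex p m → ℝ) :
    0 ≤ v ⬝ᵥ T.diskWeightedMass lam p m j *ᵥ v ∧
      v ⬝ᵥ T.diskWeightedMass lam p m j *ᵥ v ≤ coeffNorm lam * (v ⬝ᵥ T.diskMass p m j *ᵥ v) := by
  have hbound : ∀ᵐ z : ℂ ∂(volume.restrict (Metric.ball (0 : ℂ) 1)),
      ‖lam ‖z‖‖ ≤ coeffNorm lam := by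
    have h := ae_le_eLpNormEssSup (f := fun z : ℂ => lam ‖z‖)
      (μ := volume.restrict (Metric.ball (0 : ℂ) 1))
    filter_upwards [h] with z hz
    have hfin := hlam.1.2.ne
    rw [← eLpNorm_exponent_top] at hz
    have := ENNReal.toReal_mono hfin hz
    simpa [coeffNorm] using this
  have hint := fun s s' => (T.integral_diskBasis_mul p m j s s').1
  have h1 := integral_quadForm (w := fun z : ℂ => lam ‖z‖) (φ := T.diskBasis p m j)
    (μ := volume.restrict (Metric.ball (0 : ℂ) 1)) (fun s s' => by
      have := (hint s s').bdd_mul hlam.1.1 hbound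
      simpa only [mul_assoc] using this) v
  have h2 := integral_quadForm (w := fun _ : ℂ => 1) (φ := T.diskBasis p m j)
    (μ := volume.restrict (Metric.ball (0 : ℂ) 1)) (fun s s' => by
      simp only [one_mul]; exact hint s s') v
  have e1 : v ⬝ᵥ T.diskWeightedMass lam p m j *ᵥ v = _ := h1.2
  have e2 : v ⬝ᵥ T.diskMass p m j *ᵥ v =
      ∫ z in Metric.ball (0 : ℂ) 1, 1 * (∑ s, v s * T.diskBasis p m j s z) ^ 2 := by
    rw [← h2.2]
    simp only [one_mul]
    rfl
  rw [e1, e2]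
  constructor
  · refine integral_nonneg_of_ae ?_
    filter_upwards [hlam.2] with z hz using mul_nonneg hz (sq_nonneg _)
  · rw [← integral_const_mul]
    refine integral_mono_ae h1.1 (h2.1.const_mul _) ?_
    filter_upwards [hbound] with z hz
    rw [one_mul]
    exact mul_le_mul_of_nonneg_right ((le_abs_self _).trans hz) (sq_nonneg _)

theorem diskHelmholtz_dotProduct (lam : ℝ → ℝ) (p m : ℕ) (j : Fin 2) (v : T.DiskIndex p m → ℝ) :
    v ⬝ᵥ T.diskHelmholtz lam p m j *ᵥ v =
      v ⬝ᵥ T.diskWeightedMass lam p m j *ᵥ v + v ⬝ᵥ T.diskStiffness p m j *ᵥ v := by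
  rw [diskHelmholtz, Matrix.add_mulVec, dotProduct_add]

theorem diskHelmholtz_posDef {lam : ℝ → ℝ} (hlam : AdmissibleCoeff lam) {p m : ℕ} {j : Fin 2}
    (hmj : (m, j) ≠ (0, 0)) : (T.diskHelmholtz lam p m j).PosDef := by
  refine Matrix.PosDef.of_dotProduct_mulVec_pos ?_ fun v hv => ?_
  · ext s s'
    simp only [diskHelmholtz, diskWeightedMass, diskStiffness, Matrix.conjTranspose_apply,
      Matrix.add_apply, Matrix.of_apply, star_trivial]
    congr 2
    · funext z; ring
    · funext z; exact real_inner_comm _ _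
  · rw [star_trivial, diskHelmholtz_dotProduct]
    have h1 := T.diskMass_pos hmj hv
    have h2 := T.diskMass_le hmj v
    have h3 := (T.diskWeightedMass_bounds hlam p m j v).1
    linarith

/-- The stiffness form is at most 3892(1+κ)p⁴h⁻² times the mass form, the λ form at most ‖λ‖ times
it. The quotient in the minimum turns the first factor into N_h p⁴, and the 1 takes care of the
second. The upper end is 1 because the λ form is nonnegative. -/
theorem spectrum_disk {κ θ : ℝ} (hκ : 1 ≤ κ) (hθ : 0 < θ) (hT : T.QuasiUniform κ)
    (hh : θ * (T.size ^ 2)⁻¹ ≤ (T.numCells : ℝ)) {lam : ℝ → ℝ} (hlam : AdmissibleCoeff lam)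
    {p m : ℕ} (hp : 1 ≤ p) (hm : m ≤ p) {j : Fin 2} (hmj : (m, j) ≠ (0, 0))
    {V : Matrix (T.DiskIndex p m) (T.DiskIndex p m) ℝ}
    (hV : IsReverseCholesky (T.diskHelmholtz lam p m j) V) :
    spectrum ℝ (V⁻¹ᵀ * T.diskMass p m j * V⁻¹) ⊆
      Set.Icc (min 1 (θ / (3892 * (1 + κ))) *
        ((T.numCells : ℝ) * (p : ℝ) ^ 4 + coeffNorm lam)⁻¹) 1 := by
  refine hV.spectrum_subset (fun v => ?_) (fun v => ?_)
  · have hM := T.diskMass_nonneg hmj v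
    have h1 := T.diskStiffness_le hκ hT hp hm hmj v
    have h2 := (T.diskWeightedMass_bounds hlam p m j v).2
    have hN := T.numCells_pos
    have hp0 : (0 : ℝ) < p := by exact_mod_cast hp
    have hΛ := coeffNorm_nonneg lam
    have hs := T.size_pos
    set c := min 1 (θ / (3892 * (1 + κ))) with hc
    have hc0 : 0 ≤ c := le_min zero_le_one (by positivity)
    have hc1 : c ≤ 1 := min_le_left _ _
    have hc2 : c * (3892 * (1 + κ)) ≤ θ := by
      rw [← le_div_iff₀ (by positivity)]; exact min_le_right _ _
    have h3 : c * (3892 * (1 + κ) * (p : ℝ) ^ 4 / T.size ^ 2) ≤ T.numCells * (p : ℝ) ^ 4 := by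
      calc _ = c * (3892 * (1 + κ)) * (T.size ^ 2)⁻¹ * (p : ℝ) ^ 4 := by ring
        _ ≤ θ * (T.size ^ 2)⁻¹ * (p : ℝ) ^ 4 := by gcongr
        _ ≤ _ := by gcongr
    rw [diskHelmholtz_dotProduct, mul_right_comm, ← div_eq_mul_inv, div_le_iff₀ (by positivity)]
    have h4 := mul_le_mul_of_nonneg_left h1 hc0
    have h5 := mul_le_mul_of_nonneg_right h3 hM
    have h6 := mul_le_mul_of_nonneg_left h2 hc0
    have h7 := mul_le_mul_of_nonneg_right hc1 (mul_nonneg hΛ hM)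
    nlinarith
  · rw [diskHelmholtz_dotProduct, one_mul]
    have h2 := T.diskMass_le hmj v
    have h3 := (T.diskWeightedMass_bounds hlam p m j v).1
    linarith

end CylinderMesh

/-! ### The number of ADI iterations -/

/-- The lower bound amounts to (μb - μa)(μd - μc) ≥ 0. For the upper bound, (μa - μc)/(μb - μc) ≤ 1,
and adding -μd > 0 to numerator and denominator of μb/μa only lowers the quotient. -/
theorem adiGamma_bounds {μa μb μc μd : ℝ} (ha : 0 < μa) (hab : μa ≤ μb) (hcd : μc ≤ μd)
    (hd : μd < 0) : 1 ≤ adiGamma μa μb μc μd ∧ adiGamma μa μb μc μd ≤ μb / μa := by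
  have e : adiGamma μa μb μc μd = (μa - μc) * (μb - μd) / ((μb - μc) * (μa - μd)) := by
    rw [adiGamma, abs_of_nonpos (by linarith : μc - μa ≤ 0),
      abs_of_nonpos (by linarith : μd - μb ≤ 0), abs_of_nonpos (by linarith : μc - μb ≤ 0),
      abs_of_nonpos (by linarith : μd - μa ≤ 0)]
    simp only [neg_sub]
  have h1 : 0 < μb - μc := by linarith
  have h2 : 0 < μa - μd := by linarith
  rw [e]
  constructor
  · rw [le_div_iff₀ (mul_pos h1 h2)]
    nlinarith [mul_nonneg (sub_nonneg.2 hab) (sub_nonneg.2 hcd)]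
  · rw [div_le_div_iff₀ (mul_pos h1 h2) ha]
    have h3 : (μb - μd) * μa ≤ μb * (μa - μd) := by nlinarith
    have h4 : μa - μc ≤ μb - μc := by linarith
    have h5 : 0 ≤ μb * (μa - μd) := mul_nonneg (by linarith) h2.le
    calc (μa - μc) * (μb - μd) * μa = (μa - μc) * ((μb - μd) * μa) := by ring
      _ ≤ (μb - μc) * (μb * (μa - μd)) := by
        apply mul_le_mul h4 h3 _ h1.le
        exact mul_nonneg (by linarith) ha.le
      _ = _ := by ring

/-- Additive constants become multiplicative ones because log x ≥ log x₀ > 0 and log ε⁻¹ ≥ log ε₀⁻¹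
> 0, where x = N^(1/4) p. -/
theorem adiIterations_le {θ x₀ ε₀ : ℝ} (hθ : 0 < θ) (hx₀ : 1 < x₀) (hε₀ : 0 < ε₀) (hε₁ : ε₀ < 1)
    {N p : ℝ} (hN : 0 < N) (hp : 0 < p) {μa μb μc μd ε : ℝ} (hab : μa ≤ μb) (hcd : μc ≤ μd)
    (ha : θ / (12 * N * p ^ 4) ≤ μa) (hb : μb ≤ 4 / Real.pi ^ 2) (hd : μd < 0)
    (hε : 0 < ε) (hεε : ε ≤ ε₀) (hx : x₀ ≤ N ^ (1 / 4 : ℝ) * p) :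
    (adiIterations μa μb μc μd ε : ℝ) ≤
      ((|Real.log (768 / (Real.pi ^ 2 * θ))| / Real.log x₀ + 4) *
        (Real.log 4 / Real.log ε₀⁻¹ + 1) / Real.pi ^ 2 + (Real.log x₀ * Real.log ε₀⁻¹)⁻¹) *
        Real.log (N ^ (1 / 4 : ℝ) * p) * Real.log ε⁻¹ := by
  have hπ := Real.pi_pos
  have ha0 : 0 < μa := lt_of_lt_of_le (by positivity) ha
  obtain ⟨hγ1, hγ2⟩ := adiGamma_bounds ha0 hab hcd hd
  set γ := adiGamma μa μb μc μd with hγ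
  set x := N ^ (1 / 4 : ℝ) * p with hxdef
  have hx4 : x ^ 4 = N * p ^ 4 := by
    rw [hxdef, mul_pow, ← Real.rpow_natCast (N ^ (1 / 4 : ℝ)), ← Real.rpow_mul hN.le]
    norm_num
  have hx0 : 0 < x := by linarith
  have hlx0 : 0 < Real.log x₀ := Real.log_pos hx₀
  have hlx : Real.log x₀ ≤ Real.log x := Real.log_le_log (by linarith) hx
  have hle0 : 0 < Real.log ε₀⁻¹ := Real.log_pos ((one_lt_inv₀ hε₀).2 hε₁)
  have hle : Real.log ε₀⁻¹ ≤ Real.log ε⁻¹ :=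
    Real.log_le_log (by positivity) (inv_anti₀ hε hεε)
  -- 768 = 16 · 4 · 12, from the definition of the count and the two ends of the interval's
  -- spectrum.
  have hγ3 : 16 * γ ≤ 768 / (Real.pi ^ 2 * θ) * x ^ 4 := by
    have h1 : μb / μa ≤ (4 / Real.pi ^ 2) / (θ / (12 * N * p ^ 4)) := by gcongr
    calc 16 * γ ≤ 16 * ((4 / Real.pi ^ 2) / (θ / (12 * N * p ^ 4))) := by linarith
      _ = _ := by rw [hx4]; field_simp; norm_num
  have hlogγ : Real.log (16 * γ) ≤
      (|Real.log (768 / (Real.pi ^ 2 * θ))| / Real.log x₀ + 4) * Real.log x := by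
    have h1 := Real.log_le_log (by linarith) hγ3
    rw [Real.log_mul (x := 768 / _) (by positivity) (by positivity), Real.log_pow] at h1
    have h2 := le_abs_self (Real.log (768 / (Real.pi ^ 2 * θ)))
    have h3 : |Real.log (768 / (Real.pi ^ 2 * θ))| ≤
        |Real.log (768 / (Real.pi ^ 2 * θ))| / Real.log x₀ * Real.log x := by
      rw [div_mul_eq_mul_div, le_div_iff₀ hlx0]
      exact mul_le_mul_of_nonneg_left hlx (abs_nonneg _)
    push_cast at h1
    linarith
  have hlogε : Real.log (4 / ε) ≤ (Real.log 4 / Real.log ε₀⁻¹ + 1) * Real.log ε⁻¹ := by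
    rw [div_eq_mul_inv, Real.log_mul (by norm_num) (by positivity)]
    have h3 : Real.log 4 ≤ Real.log 4 / Real.log ε₀⁻¹ * Real.log ε⁻¹ := by
      rw [div_mul_eq_mul_div, le_div_iff₀ hle0]
      exact mul_le_mul_of_nonneg_left hle (Real.log_nonneg (by norm_num))
    linarith
  have hlogγ0 : 0 ≤ Real.log (16 * γ) := Real.log_nonneg (by linarith)
  have hlogε0 : 0 ≤ Real.log (4 / ε) := Real.log_nonneg (by
    rw [le_div_iff₀ hε]; linarith)
  -- This absorbs the 1 added by rounding up.
  have h1 : 1 ≤ (Real.log x₀ * Real.log ε₀⁻¹)⁻¹ * (Real.log x * Real.log ε⁻¹) := by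
    rw [inv_mul_eq_div, le_div_iff₀ (by positivity), one_mul]
    exact mul_le_mul hlx hle hle0.le (hlx0.le.trans hlx)
  have h2 := mul_le_mul hlogγ hlogε hlogε0 (hlogγ0.trans hlogγ)
  have h3 := Nat.ceil_lt_add_one (a := Real.log (16 * γ) * Real.log (4 / ε) / Real.pi ^ 2)
    (by positivity)
  have h4 := div_le_div_of_nonneg_right h2 (sq_nonneg Real.pi)
  calc (adiIterations μa μb μc μd ε : ℝ)
      ≤ Real.log (16 * γ) * Real.log (4 / ε) / Real.pi ^ 2 + 1 := h3.le
    _ ≤ _ := add_le_add h4 h1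
    _ = _ := by ring

end DiskFEM

/-! ### Choice of the constants -/

theorem mainTheorem5 (κ θ : ℝ) (hκ : 1 ≤ κ) (hθ : 0 < θ) :
    ∃ c C : ℝ, 0 < c ∧ c ≤ C ∧
      -- the two spectral inclusions
      (∀ (T : CylinderMesh), T.QuasiUniform κ → θ * (T.size ^ 2)⁻¹ ≤ (T.numCells : ℝ) →
        ∀ (lam : ℝ → ℝ), AdmissibleCoeff lam → ∀ p : ℕ, 1 ≤ p →
          ((∃ L, IsReverseCholesky (T.lineStiffness p) L) ∧
            ∀ L, IsReverseCholesky (T.lineStiffness p) L →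
              spectrum ℝ (L⁻¹ᵀ * T.lineMass p * L⁻¹) ⊆
                Set.Icc (θ / (12 * (T.numCells : ℝ) * (p : ℝ) ^ 4)) (4 / Real.pi ^ 2)) ∧
          ∀ (m : ℕ) (j : Fin 2), m ≤ p → (m, j) ≠ (0, 0) →
            (∃ V, IsReverseCholesky (T.diskHelmholtz lam p m j) V) ∧
              ∀ V, IsReverseCholesky (T.diskHelmholtz lam p m j) V →
                spectrum ℝ (V⁻¹ᵀ * T.diskMass p m j * V⁻¹) ⊆
                  Set.Icc (c * ((T.numCells : ℝ) * (p : ℝ) ^ 4 + coeffNorm lam)⁻¹) C) ∧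
      -- the number of ADI iterations
      (∀ x₀ ε₀ : ℝ, 1 < x₀ → 0 < ε₀ → ε₀ < 1 → ∃ D : ℝ,
        ∀ (T : CylinderMesh), T.QuasiUniform κ → θ * (T.size ^ 2)⁻¹ ≤ (T.numCells : ℝ) →
        ∀ (lam : ℝ → ℝ), AdmissibleCoeff lam → ∀ p : ℕ, 1 ≤ p →
        ∀ (m : ℕ) (j : Fin 2), m ≤ p → (m, j) ≠ (0, 0) →
        ∀ L, IsReverseCholesky (T.lineStiffness p) L →
        ∀ V, IsReverseCholesky (T.diskHelmholtz lam p m j) V →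
        ∀ μa μb μc μd : ℝ, μa ≤ μb → μc ≤ μd →
          spectrum ℝ (L⁻¹ᵀ * T.lineMass p * L⁻¹) ⊆ Set.Icc μa μb →
          spectrum ℝ (-(V⁻¹ᵀ * T.diskMass p m j * V⁻¹)) ⊆ Set.Icc μc μd →
          Set.Icc μa μb ⊆
            Set.Icc (θ / (12 * (T.numCells : ℝ) * (p : ℝ) ^ 4)) (4 / Real.pi ^ 2) →
          Set.Icc μc μd ⊆
            Set.Icc (-C) (-(c * ((T.numCells : ℝ) * (p : ℝ) ^ 4 + coeffNorm lam)⁻¹)) →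
          ∀ ε : ℝ, 0 < ε → ε ≤ ε₀ → x₀ ≤ (T.numCells : ℝ) ^ (1 / 4 : ℝ) * (p : ℝ) →
            (adiIterations μa μb μc μd ε : ℝ) ≤
              D * Real.log ((T.numCells : ℝ) ^ (1 / 4 : ℝ) * (p : ℝ)) * Real.log ε⁻¹) := by
  refine ⟨min 1 (θ / (3892 * (1 + κ))), 1, lt_min one_pos (by positivity), min_le_left _ _,
    fun T hT hh lam hlam p hp => ⟨⟨exists_isReverseCholesky (T.lineStiffness_posDef p),
      fun L hL => T.spectrum_line hh hθ hp hL⟩, fun m j hm hmj =>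
      ⟨exists_isReverseCholesky (T.diskHelmholtz_posDef hlam hmj),
        fun V hV => T.spectrum_disk hκ hθ hT hh hlam hp hm hmj hV⟩⟩, ?_⟩
  intro x₀ ε₀ hx₀ hε₀ hε₁
  -- The constant D is read off from `adiIterations_le`, where it is explicit in θ, x₀ and ε₀.
  -- Nonemptiness of the intervals places their endpoints within the prescribed bounds.
  refine ⟨_, fun T _ _ lam _ p hp m j _ _ L _ V _ μa μb μc μd hab hcd _ _ hline hdisk ε hε hεε hx =>
    adiIterations_le hθ hx₀ hε₀ hε₁ T.numCells_pos (Nat.cast_pos.2 hp) hab hcd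
      (hline (Set.left_mem_Icc.2 hab)).1 (hline (Set.right_mem_Icc.2 hab)).2
      ((hdisk (Set.right_mem_Icc.2 hcd)).2.trans_lt ?_) hε hεε hx⟩
  have hN := T.numCells_pos
  have hp0 : (0 : ℝ) < p := Nat.cast_pos.2 hp
  have hΛ := coeffNorm_nonneg lam
  have hc : 0 < min 1 (θ / (3892 * (1 + κ))) := lt_min one_pos (by positivity)
  exact neg_neg_of_pos (by positivity)
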